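/- **Theorem 4.1.** Let $n\ge 2$, $R>0$, $\alpha\in\mathbb R$ with $\alpha\ge (1-n)/2$, and let $f$ be an infinitely differentiable (real- or complex-valued) function on $\mathbb R^n$ with compact support in the open ball $B=\{x\in\mathbb R^n:|x|<R\}$. Let $u(x,t)$ be the solution on $\mathbb R^n\times[0,\infty)$ ($C^2$ for $t>0$ and $C^1$ up to $t=0$) of the Cauchy problem $$\Delta u-u_{tt}-\frac{n+2\alpha-1}{t}\,u_t=0,\qquad u(x,0)=f(x),\quad u_t(x,0)=0 .$$ Write $u_\xi(t)=u(\xi,t)$ for $\xi\in\partial B$, $\eta=n/2-1$ and $D=\frac1{2t}\frac{d}{dt}$. For $a>0$ let $$(I_\nu^{a}\varphi)(t)=\frac{2t^{-2(a+\nu)}}{\Gamma(a)}\int_0^t(t^2-r^2)^{a-1}r^{2\nu+1}\varphi(r)\,dr,\qquad t>0,$$ be the Erdélyi–Kober fractional integral, and for $a\le 0$ let $I_\nu^a$ be its continuation in the order, $$(I_\nu^{a}\varphi)(t)=t^{-2(a+\nu)}D^m\big[t^{2(a+m+\nu)}(I_\nu^{a+m}\varphi)(t)\big],$$ where $m$ is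 the least positive integer with $a+m>0$. Then $I^{-\alpha}_{\eta+\alpha}u_\xi$ is infinitely differentiable on $(0,\infty)$ for every $\xi\in\partial B$, and for every $x\in B$ the following holds, where $d\xi$ is the surface measure on $\partial B$, the integrals converge absolutely and are $C^2$ functions of $x\in B$, and $\Delta$ acts in $x$. (i) If $n=3,5,\dots$, then $$f(x)=\tilde d_{n,1}\,\Delta\int_{\partial B}D^{n-3}\big[t^{n-2}(I^{-\alpha}_{\eta+\alpha}u_\xi)(t)\big]\Big|_{t=|x-\xi|}\,d\xi,\qquad \tilde d_{n,1}=\frac{(-1)^{(n-1)/2}\,\pi^{1-n/2}}{4R\,\Gamma(\alpha+n/2)} .$$ (ii) If $n=2,4,6,\dots$, then $$f(x)=\tilde d_{n,2}\,\Delta\int_{\partial B}d\xi\int_0^{2R}t\,D^{n-2}\big[t^{n-2}(I^{-\alpha}_{\eta+\alpha}u_\xi)(t)\big]\log\big|t^2-|x-\xi|^2\big|\,dt,\qquad \tilde d_{n,2}=\frac{(-1)^{n/2-1}\,\pi^{-n/2}}{2R\,\Gamma(\alpha+n/2)} .$$ -/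

import Mathlib

open Real Set Metric MeasureTheory
open scoped ContDiff

noncomputable section

/-- The surface measure on the sphere `{ξ : |ξ| = R}` of `ℝⁿ`, as a measure on `ℝⁿ`: the
surface measure of the unit sphere is transported by `θ ↦ R θ` and multiplied by `R ^ (n - 1)`. -/
def sphereMeasure (n : ℕ) (R : ℝ) : Measure (EuclideanSpace ℝ (Fin n)) :=
  ENNReal.ofReal (R ^ (n - 1)) •
    Measure.map (fun θ : sphere (0 : EuclideanSpace ℝ (Fin n)) 1 =>
      R • (θ : EuclideanSpace ℝ (Fin n)))
      (volume : Measure (EuclideanSpace ℝ (Fin n))).toSphere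

/-- The operator `D = (1 / (2 t)) d/dt`. -/
def opD {F : Type*} [NormedAddCommGroup F] [NormedSpace ℝ F] (g : ℝ → F) (t : ℝ) : F :=
  (1 / (2 * t)) • deriv g t

/-- The Erdélyi–Kober fractional integral of order `a > 0`:
`(I_η^a φ)(t) = (2 t^{-2(a+η)} / Γ(a)) ∫₀ᵗ (t² - r²)^{a-1} r^{2η+1} φ(r) dr`. -/
def ekIntegral {F : Type*} [NormedAddCommGroup F] [NormedSpace ℝ F]
    (η a : ℝ) (φ : ℝ → F) (t : ℝ) : F :=
  (2 * t ^ (-2 * (a + η)) / Real.Gamma a) •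
    ∫ r in (0 : ℝ)..t, ((t ^ 2 - r ^ 2) ^ (a - 1) * r ^ (2 * η + 1)) • φ r

/-- The Erdélyi–Kober operator `I_η^a` of arbitrary real order `a`. For `a > 0` it is the fractional
integral. For `a ≤ 0` it is the fractional derivative
`I_η^a φ = t^{-2(a+η)} D^m t^{2(a+m+η)} I_η^{a+m} φ`, where `m` is the least positive integer with
`a + m > 0`. On smooth functions that vanish near the origin the right-hand side does not depend on
the choice of `m` with `a + m > 0`, and it is the value at `a` of the analytic continuation of the
fractional integral in its order; for `a = -k` it is `t^{-2(η-k)} D^k t^{2η} φ`. -/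
def ekOp {F : Type*} [NormedAddCommGroup F] [NormedSpace ℝ F]
    (η a : ℝ) (φ : ℝ → F) (t : ℝ) : F :=
  if 0 < a then ekIntegral η a φ t
  else
    t ^ (-2 * (a + η)) •
      (opD^[⌊-a⌋₊ + 1] fun s : ℝ =>
        s ^ (2 * (a + ((⌊-a⌋₊ + 1 : ℕ) : ℝ) + η)) •
          ekIntegral η (a + ((⌊-a⌋₊ + 1 : ℕ) : ℝ)) φ s) t

/-- `u = u(x, t)` is a classical solution on `ℝⁿ × [0, ∞)` of the Cauchy problem
`Δu - u_tt - ((n + 2α - 1) / t) u_t = 0`, `u(x, 0) = f(x)`, `u_t(x, 0) = 0`: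
it is `C²` for `t > 0` and `C¹` up to `t = 0`. -/
structure IsEPDSolution {F : Type*} [NormedAddCommGroup F] [NormedSpace ℝ F] {n : ℕ}
    (α : ℝ) (f : EuclideanSpace ℝ (Fin n) → F) (u : EuclideanSpace ℝ (Fin n) → ℝ → F) : Prop where
  contDiffOn_two :
    ContDiffOn ℝ 2 (fun p : EuclideanSpace ℝ (Fin n) × ℝ => u p.1 p.2) (univ ×ˢ Ioi (0 : ℝ))
  contDiffOn_one :
    ContDiffOn ℝ 1 (fun p : EuclideanSpace ℝ (Fin n) × ℝ => u p.1 p.2) (univ ×ˢ Ici (0 : ℝ))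
  equation : ∀ x : EuclideanSpace ℝ (Fin n), ∀ t : ℝ, 0 < t →
    Laplacian.laplacian (fun y => u y t) x - deriv (deriv (u x)) t
      - (((n : ℝ) + 2 * α - 1) / t) • deriv (u x) t = 0
  initial : ∀ x, u x 0 = f x
  initial_deriv : ∀ x, HasDerivWithinAt (u x) 0 (Ici (0 : ℝ)) 0

end

/-! The argument separates the equation from the geometry. Write M f(x, t) for the mean of f over
the sphere of radius t about x.

Equation. For α > 0 the solution is the Erdélyi–Kober integral of order α of M f(x, ·), normalized
so that it is an average of M f(x, t√s) over a beta distributed s (`epdBase`). Darboux's relation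
for M f, obtained from Green's formula in `deriv_sphMean_eq`, gives ∂ₜU_α f = t/(2α+n) · U_{α+1} Δf,
and a descent relation expresses U_α f through U_{α+1} f and U_{α+2} Δf. The descent continues the
solution to the remaining α (`epd`, `isEPDSolution_epd`). Uniqueness is an energy estimate in a
cone: the damping coefficient (n+2α-1)/t is nonnegative exactly because α ≥ (1-n)/2
(`IsEPDSolution.unique`). Since Erdélyi–Kober integrals form a semigroup (`betaMean_betaMean`) and D
inverts those of integer order (`opD_iterate_betaMean`), the operator of order -α recovers M f up to
the factor Γ(α+n/2)/Γ(n/2): this is `IsEPDSolution.ekOp_eq_smul_sphMean`. What is left is the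
inversion of spherical means with centres on ∂B.

Geometry. In the variable s = t² the operator D is d/ds, and t^(n-2) M f(ξ, t) becomes a profile
G_ξ(s). Because f vanishes near ∂B, G_ξ vanishes for small s and is smooth. Both formulas then ask
for the integral over ξ of ∫ k(|x-ξ|² - s) G_ξ^(n-2)(s) ds, with k = sgn for odd n (where the
s-integral undoes one derivative) and k = log|·| for even n. This is the (n-2)-nd derivative at ε =
0 of J(ε), the same expression with G_ξ underived and |x-ξ|² replaced by |x-ξ|² + ε.

By Fubini J(ε) is an integral of f(y) against the average over ξ of k(|x-ξ|² + ε - |y-ξ|²). The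
argument is affine in ξ: it equals b(z - cos β) with b = 2R|x-y| and z = (|x|²-|y|²+ε)/b, so the
average has weight sin^(n-2) β. The decisive fact is that ∫ sin^(n-2) β k(z - cos β) dβ is a
polynomial Q(z) of degree at most n-2 for |z| < 1 (`exists_isBackprojectionKernel_log`, by Chebyshev
polynomials, and `exists_isBackprojectionKernel_sgn`). Taking the coefficient of ε^(n-2) leaves the
leading coefficient of Q times b^(2-n), a multiple of the Newtonian kernel; for n = 2 the logarithm
comes from the scaling k(bz) = log b + k(z). Where |z| ≥ 1 one has |x-y| ≤ C|ε|, and the error is at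
most C(|ε|/|x-y|)^(n-1), which is integrable in y and hence of order ε^(n-1)
(`exists_backprojection_expansion`). Thus the backprojection is a Newtonian or logarithmic potential
of f, and Δ returns f (`laplacian_radial_potential`). The constants agree by the duplication formula
for Γ. -/

/-! ### Parameter integrals over compact sets. -/

/-- Differentiation under an integral over a compact set, with an integrable scalar weight. -/
theorem hasFDerivAt_setIntegral_smul {H X F : Type*} [NormedAddCommGroup H] [NormedSpace ℝ H]
    [LocallyCompactSpace H] [TopologicalSpace X] [T2Space X]
    [MeasurableSpace X] [OpensMeasurableSpace X]
    [NormedAddCommGroup F] [NormedSpace ℝ F] {μ : Measure X} {K : Set X} (hK : IsCompact K)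
    {w : X → ℝ} (hw : IntegrableOn w K μ) {U : Set H} (hU : IsOpen U)
    {Φ : H → X → F} {Φ' : H → X → H →L[ℝ] F}
    (hΦ : ContinuousOn (Function.uncurry Φ) (U ×ˢ K))
    (hΦ' : ContinuousOn (Function.uncurry Φ') (U ×ˢ K))
    (hd : ∀ p ∈ U, ∀ x ∈ K, HasFDerivAt (fun q => Φ q x) (Φ' p x) p) {p : H} (hp : p ∈ U) :
    HasFDerivAt (fun q => ∫ x in K, w x • Φ q x ∂μ) (∫ x in K, w x • Φ' p x ∂μ) p := by
  have hKm : MeasurableSet K := hK.isClosed.measurableSet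
  obtain ⟨V, hV, hVU, hVc⟩ := local_compact_nhds (hU.mem_nhds hp)
  have hVK : IsCompact (V ×ˢ K) := hVc.prod hK
  obtain ⟨C, hC⟩ := hVK.exists_bound_of_continuousOn
    (hΦ'.mono (prod_mono hVU Subset.rfl))
  have sec : ∀ q ∈ U, ContinuousOn (Φ q) K := fun q hq =>
    hΦ.comp (f := fun x => (q, x)) (by fun_prop) (fun x hx => ⟨hq, hx⟩)
  have sec' : ∀ q ∈ U, ContinuousOn (Φ' q) K := fun q hq =>
    hΦ'.comp (f := fun x => (q, x)) (by fun_prop) (fun x hx => ⟨hq, hx⟩)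
  have wm := hw.aestronglyMeasurable
  refine hasFDerivAt_integral_of_dominated_of_fderiv_le (𝕜 := ℝ) (s := V)
    (F := fun q x => w x • Φ q x) (F' := fun q x => w x • Φ' q x) (bound := fun x => ‖w x‖ * C) hV
    ?_ ?_ ?_ ?_ (hw.norm.mul_const C) ?_
  · filter_upwards [hU.mem_nhds hp] with q hq
    exact wm.smul ((sec q hq).aestronglyMeasurable_of_isCompact hK hKm)
  · obtain ⟨C', hC'⟩ := hK.exists_bound_of_continuousOn (sec p hp)
    refine Integrable.smul_bdd hw C' ((sec p hp).aestronglyMeasurable_of_isCompact hK hKm) ?_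
    exact (ae_restrict_iff' hKm).2 (.of_forall hC')
  · exact wm.smul ((sec' p hp).aestronglyMeasurable_of_isCompact hK hKm)
  · refine (ae_restrict_iff' hKm).2 (.of_forall fun x hx q hq => ?_)
    rw [norm_smul]
    exact mul_le_mul_of_nonneg_left (hC (q, x) ⟨hq, hx⟩) (norm_nonneg _)
  · refine (ae_restrict_iff' hKm).2 (.of_forall fun x hx q hq => ?_)
    exact (hd q (hVU hq) x hx).const_smul (w x)

/-- One-variable form of `hasFDerivAt_setIntegral_smul`. -/
theorem hasDerivAt_setIntegral_smul {X F : Type*} [TopologicalSpace X] [T2Space X]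
    [MeasurableSpace X] [OpensMeasurableSpace X]
    [NormedAddCommGroup F] [NormedSpace ℝ F] {μ : Measure X} {K : Set X} (hK : IsCompact K)
    {w : X → ℝ} (hw : IntegrableOn w K μ) {U : Set ℝ} (hU : IsOpen U)
    {Φ : ℝ → X → F} {Φ' : ℝ → X → F}
    (hΦ : ContinuousOn (Function.uncurry Φ) (U ×ˢ K))
    (hΦ' : ContinuousOn (Function.uncurry Φ') (U ×ˢ K))
    (hd : ∀ p ∈ U, ∀ x ∈ K, HasDerivAt (fun q => Φ q x) (Φ' p x) p) {p : ℝ} (hp : p ∈ U) :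
    HasDerivAt (fun q => ∫ x in K, w x • Φ q x ∂μ) (∫ x in K, w x • Φ' p x ∂μ) p := by
  have hKm : MeasurableSet K := hK.isClosed.measurableSet
  obtain ⟨V, hV, hVU, hVc⟩ := local_compact_nhds (hU.mem_nhds hp)
  have hVK : IsCompact (V ×ˢ K) := hVc.prod hK
  obtain ⟨C, hC⟩ := hVK.exists_bound_of_continuousOn
    (hΦ'.mono (prod_mono hVU Subset.rfl))
  have sec : ∀ q ∈ U, ContinuousOn (Φ q) K := fun q hq =>
    hΦ.comp (f := fun x => (q, x)) (by fun_prop) (fun x hx => ⟨hq, hx⟩)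
  have sec' : ∀ q ∈ U, ContinuousOn (Φ' q) K := fun q hq =>
    hΦ'.comp (f := fun x => (q, x)) (by fun_prop) (fun x hx => ⟨hq, hx⟩)
  have wm := hw.aestronglyMeasurable
  refine (hasDerivAt_integral_of_dominated_loc_of_deriv_le (𝕜 := ℝ) (s := V)
    (F := fun q x => w x • Φ q x) (F' := fun q x => w x • Φ' q x) (bound := fun x => ‖w x‖ * C) hV ?_ ?_ ?_ ?_ (hw.norm.mul_const C) ?_).2
  · filter_upwards [hU.mem_nhds hp] with q hq
    exact wm.smul ((sec q hq).aestronglyMeasurable_of_isCompact hK hKm)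
  · obtain ⟨C', hC'⟩ := hK.exists_bound_of_continuousOn (sec p hp)
    refine Integrable.smul_bdd hw C' ((sec p hp).aestronglyMeasurable_of_isCompact hK hKm) ?_
    exact (ae_restrict_iff' hKm).2 (.of_forall hC')
  · exact wm.smul ((sec' p hp).aestronglyMeasurable_of_isCompact hK hKm)
  · refine (ae_restrict_iff' hKm).2 (.of_forall fun x hx q hq => ?_)
    rw [norm_smul]
    exact mul_le_mul_of_nonneg_left (hC (q, x) ⟨hq, hx⟩) (norm_nonneg _)
  · refine (ae_restrict_iff' hKm).2 (.of_forall fun x hx q hq => ?_)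
    exact (hd q (hVU hq) x hx).const_smul (w x)

/-- The partial derivative in the first variable of a differentiable function. -/
theorem hasFDerivAt_fst_of_contDiff {H G F : Type*} [NormedAddCommGroup H] [NormedSpace ℝ H]
    [NormedAddCommGroup G] [NormedSpace ℝ G] [NormedAddCommGroup F] [NormedSpace ℝ F]
    {Φ : H × G → F} (hΦ : ContDiff ℝ 1 Φ) (p : H) (y : G) :
    HasFDerivAt (fun q => Φ (q, y))
      ((fderiv ℝ Φ (p, y)).comp (ContinuousLinearMap.inl ℝ H G)) p :=
  ((hΦ.differentiable one_ne_zero) (p, y)).hasFDerivAt.comp p (hasFDerivAt_prodMk_left p y)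

/-- An integral over a compact set of a jointly smooth function is smooth in the parameter. -/
theorem contDiff_setIntegral_smul {H : Type} {X G : Type*} {F : Type*} [NormedAddCommGroup H]
    [NormedSpace ℝ H] [LocallyCompactSpace H] [TopologicalSpace X] [T2Space X]
    [MeasurableSpace X] [OpensMeasurableSpace X] [NormedAddCommGroup G] [NormedSpace ℝ G]
    [NormedAddCommGroup F] [NormedSpace ℝ F] {μ : Measure X} {K : Set X} (hK : IsCompact K)
    {w : X → ℝ} (hw : IntegrableOn w K μ) {ι : X → G} (hι : Continuous ι)
    {Φ : H × G → F} (hΦ : ContDiff ℝ ∞ Φ) :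
    ContDiff ℝ ∞ (fun p => ∫ x in K, w x • Φ (p, ι x) ∂μ) := by
  rw [contDiff_infty]
  intro m
  -- The inductive step passes from F to `H →L[ℝ] F`. Taking `H : Type` keeps this space in the
  -- universe of F, so that the induction hypothesis applies to it.
  induction m generalizing F with
  | zero =>
    refine contDiff_zero.2 (continuous_iff_continuousAt.2 fun p => ?_)
    have h1 : ContDiff ℝ 1 Φ := hΦ.of_le (by simp)
    refine (hasFDerivAt_setIntegral_smul (Φ := fun q x => Φ (q, ι x))
      (Φ' := fun q x => (fderiv ℝ Φ (q, ι x)).comp (ContinuousLinearMap.inl ℝ H G)) hK hw isOpen_univ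
      ?_ ?_ (fun q _ x _ => hasFDerivAt_fst_of_contDiff h1 q (ι x)) (mem_univ p)).continuousAt
    · exact (hΦ.continuous.comp (by fun_prop : Continuous fun z : H × X => (z.1, ι z.2))).continuousOn
    · have h2 := hΦ.continuous_fderiv (by simp)
      have : Continuous fun z : H × X => fderiv ℝ Φ (z.1, ι z.2) :=
        h2.comp (by fun_prop : Continuous fun z : H × X => (z.1, ι z.2))
      exact (this.clm_comp continuous_const).continuousOn
  | succ m ih =>
    have h1 : ContDiff ℝ 1 Φ := hΦ.of_le (by simp)
    have h2 : ContDiff ℝ ∞ (fun z => (fderiv ℝ Φ z).comp (ContinuousLinearMap.inl ℝ H G)) :=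
      (hΦ.fderiv_right (by simp)).clm_comp contDiff_const
    refine (contDiff_succ_iff_hasFDerivAt).2
      ⟨_, ih h2, fun p => hasFDerivAt_setIntegral_smul (Φ := fun q x => Φ (q, ι x))
      (Φ' := fun q x => (fderiv ℝ Φ (q, ι x)).comp (ContinuousLinearMap.inl ℝ H G)) hK hw isOpen_univ
      ?_ ?_ (fun q _ x _ => hasFDerivAt_fst_of_contDiff h1 q (ι x)) (mem_univ p)⟩
    · exact (hΦ.continuous.comp (by fun_prop : Continuous fun z : H × X => (z.1, ι z.2))).continuousOn
    · exact (h2.continuous.comp (by fun_prop : Continuous fun z : H × X => (z.1, ι z.2))).continuousOn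

/-! ### Polar coordinates and functions of one coordinate on the sphere. -/

/-- The radial measure `r ^ k dr` on `(0, ∞)`, as a measure on `ℝ`. -/
noncomputable def radialMeasure (k : ℕ) : Measure ℝ :=
  (volume.restrict (Ioi (0 : ℝ))).withDensity fun r => ENNReal.ofReal (r ^ k)

instance (k : ℕ) : SFinite (radialMeasure k) := by unfold radialMeasure; infer_instance

theorem map_val_volumeIoiPow (k : ℕ) :
    (Measure.volumeIoiPow k).map Subtype.val = radialMeasure k := by
  ext s hs
  rw [Measure.map_apply measurable_subtype_coe hs, Measure.volumeIoiPow,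
    withDensity_apply _ (measurable_subtype_coe hs), radialMeasure, withDensity_apply _ hs,
    setLIntegral_subtype measurableSet_Ioi _ fun a : ℝ => ENNReal.ofReal (a ^ k),
    Measure.restrict_restrict hs]
  congr 2
  ext x; simp [and_comm]

/-- Polar coordinates, as a measure preserving map. -/
theorem measurePreserving_smul_sphere {E : Type*} [NormedAddCommGroup E] [NormedSpace ℝ E]
    [Nontrivial E] [FiniteDimensional ℝ E] [MeasurableSpace E] [BorelSpace E] (μ : Measure E)
    [μ.IsAddHaarMeasure] :
    MeasurePreserving (fun p : sphere (0 : E) 1 × ℝ => p.2 • (p.1 : E))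
      (μ.toSphere.prod (radialMeasure (Module.finrank ℝ E - 1))) μ := by
  have h1 := (μ.measurePreserving_homeomorphUnitSphereProd).symm
    (homeomorphUnitSphereProd E).toMeasurableEquiv
  have h2 : MeasurePreserving (Subtype.val : ({0}ᶜ : Set E) → E) (μ.comap (↑)) μ := by
    refine ⟨measurable_subtype_coe, ?_⟩
    rw [map_comap_subtype_coe (measurableSet_singleton _).compl, restrict_compl_singleton]
  have h3 := h2.comp h1
  have h4 : MeasurePreserving (Prod.map id Subtype.val : sphere (0 : E) 1 × Ioi (0 : ℝ) → _)
      (μ.toSphere.prod (Measure.volumeIoiPow (Module.finrank ℝ E - 1)))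
      (μ.toSphere.prod (radialMeasure (Module.finrank ℝ E - 1))) :=
    (MeasurePreserving.id _).prod ⟨measurable_subtype_coe, map_val_volumeIoiPow _⟩
  have hm : Measurable (fun p : sphere (0 : E) 1 × ℝ => p.2 • (p.1 : E)) := by fun_prop
  refine ⟨hm, ?_⟩
  rw [← h4.map_eq, Measure.map_map hm h4.measurable]
  exact h3.map_eq

theorem lintegral_radialMeasure (k : ℕ) {φ : ℝ → ENNReal} (hφ : Measurable φ) :
    ∫⁻ r, φ r ∂(radialMeasure k) = ∫⁻ r in Ioi 0, ENNReal.ofReal (r ^ k) * φ r := by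
  rw [radialMeasure, lintegral_withDensity_eq_lintegral_mul _ (by fun_prop) hφ]
  rfl

theorem integral_radialMeasure {F : Type*} [NormedAddCommGroup F] [NormedSpace ℝ F] (k : ℕ)
    (φ : ℝ → F) : ∫ r, φ r ∂(radialMeasure k) = ∫ r in Ioi 0, r ^ k • φ r := by
  rw [radialMeasure, integral_withDensity_eq_integral_toReal_smul (by fun_prop) (by simp)]
  refine setIntegral_congr_fun measurableSet_Ioi fun r hr => ?_
  simp [ENNReal.toReal_ofReal (pow_nonneg (mem_Ioi.1 hr).le k)]

theorem lintegral_eq_lintegral_sphere {E : Type*} [NormedAddCommGroup E] [NormedSpace ℝ E]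
    [Nontrivial E] [FiniteDimensional ℝ E] [MeasurableSpace E] [BorelSpace E] (μ : Measure E)
    [μ.IsAddHaarMeasure] {G : E → ENNReal} (hG : Measurable G) :
    ∫⁻ x, G x ∂μ = ∫⁻ r in Ioi 0, ENNReal.ofReal (r ^ (Module.finrank ℝ E - 1)) *
      ∫⁻ θ : sphere (0 : E) 1, G (r • (θ : E)) ∂μ.toSphere := by
  have h := measurePreserving_smul_sphere μ
  have hm : Measurable (fun p : sphere (0 : E) 1 × ℝ => G (p.2 • (p.1 : E))) := by fun_prop
  rw [← h.lintegral_comp hG, lintegral_prod_symm _ hm.aemeasurable, lintegral_radialMeasure]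
  exact hm.lintegral_prod_left'

theorem integrable_sphere_prod {E F : Type*} [NormedAddCommGroup E] [NormedSpace ℝ E]
    [Nontrivial E] [FiniteDimensional ℝ E] [MeasurableSpace E] [BorelSpace E] (μ : Measure E)
    [μ.IsAddHaarMeasure] [NormedAddCommGroup F] [NormedSpace ℝ F] {G : E → F}
    (hG : Integrable G μ) :
    Integrable (fun p : sphere (0 : E) 1 × ℝ => G (p.2 • (p.1 : E)))
      (μ.toSphere.prod (radialMeasure (Module.finrank ℝ E - 1))) :=
  ((measurePreserving_smul_sphere μ).integrable_comp hG.1).2 hG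

theorem integral_eq_integral_sphere {E F : Type*} [NormedAddCommGroup E] [NormedSpace ℝ E]
    [Nontrivial E] [FiniteDimensional ℝ E] [MeasurableSpace E] [BorelSpace E] (μ : Measure E)
    [μ.IsAddHaarMeasure] [NormedAddCommGroup F] [NormedSpace ℝ F] {G : E → F}
    (hG : Integrable G μ) :
    ∫ x, G x ∂μ = ∫ r in Ioi (0 : ℝ), r ^ (Module.finrank ℝ E - 1) •
      ∫ θ : sphere (0 : E) 1, G (r • (θ : E)) ∂μ.toSphere := by
  have h := measurePreserving_smul_sphere μ
  have h1 := integrable_sphere_prod μ hG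
  rw [← h.map_eq, integral_map h.measurable.aemeasurable (by rw [h.map_eq]; exact hG.1),
    integral_prod_symm _ h1, integral_radialMeasure, h.map_eq]

/-- Fubini with the rays inside. This order is needed when the integrand is an exact derivative
along each ray. -/
theorem integral_eq_sphere_integral {E F : Type*} [NormedAddCommGroup E] [NormedSpace ℝ E]
    [Nontrivial E] [FiniteDimensional ℝ E] [MeasurableSpace E] [BorelSpace E] (μ : Measure E)
    [μ.IsAddHaarMeasure] [NormedAddCommGroup F] [NormedSpace ℝ F] {G : E → F}
    (hG : Integrable G μ) :
    ∫ x, G x ∂μ = ∫ θ : sphere (0 : E) 1, (∫ r in Ioi (0 : ℝ),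
      r ^ (Module.finrank ℝ E - 1) • G (r • (θ : E))) ∂μ.toSphere := by
  have h := measurePreserving_smul_sphere μ
  have h1 := integrable_sphere_prod μ hG
  rw [← h.map_eq, integral_map h.measurable.aemeasurable (by rw [h.map_eq]; exact hG.1),
    integral_prod _ h1]
  simp_rw [integral_radialMeasure]
  rw [h.map_eq]

theorem lintegral_radial {E : Type*} [NormedAddCommGroup E] [NormedSpace ℝ E]
    [Nontrivial E] [FiniteDimensional ℝ E] [MeasurableSpace E] [BorelSpace E] (μ : Measure E)
    [μ.IsAddHaarMeasure] {φ : ℝ → ENNReal} (hφ : Measurable φ) :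
    ∫⁻ x, φ ‖x‖ ∂μ = μ.toSphere univ *
      ∫⁻ r in Ioi 0, ENNReal.ofReal (r ^ (Module.finrank ℝ E - 1)) * φ r := by
  rw [lintegral_eq_lintegral_sphere μ (by fun_prop), ← lintegral_const_mul _ (by fun_prop)]
  refine setLIntegral_congr_fun measurableSet_Ioi fun r hr => ?_
  have : ∀ θ : sphere (0 : E) 1, ‖r • (θ : E)‖ = r := fun θ => by
    rw [norm_smul, norm_eq_of_mem_sphere, mul_one, Real.norm_of_nonneg (mem_Ioi.1 hr).le]
  simp only [this, lintegral_const]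
  ring

/-- Splitting off one coordinate and passing to polar coordinates in the half-plane. -/
theorem lintegral_norm_inner {m : ℕ} (hm : 1 ≤ m) {e : EuclideanSpace ℝ (Fin (m + 1))}
    (he : ‖e‖ = 1) {H : ℝ × ℝ → ENNReal} (hH : Measurable H) :
    ∫⁻ x : EuclideanSpace ℝ (Fin (m + 1)), H (‖x‖, inner ℝ e x) =
      (volume : Measure (EuclideanSpace ℝ (Fin m))).toSphere univ *
      ∫⁻ r in Ioi (0 : ℝ), ∫⁻ β in Ioo 0 π, ENNReal.ofReal (r * (r * sin β) ^ (m - 1)) *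
        H (r, r * cos β) := by
  have : Nonempty (Fin m) := ⟨⟨0, hm⟩⟩
  -- In an orthonormal basis that starts with e the inner product is the zeroth coordinate. The
  -- other m coordinates enter only through their norm ρ, and (s, ρ) runs over a half-plane.
  obtain ⟨b, hb⟩ := Orthonormal.exists_orthonormalBasis_extension_of_card_eq (𝕜 := ℝ)
    (E := EuclideanSpace ℝ (Fin (m + 1))) (ι := Fin (m + 1)) (by simp) (v := fun _ => e) (s := {0})
    (by
      rw [orthonormal_iff_ite]
      rintro ⟨i, hi⟩ ⟨j, hj⟩
      simp only [mem_singleton_iff] at hi hj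
      subst hi; subst hj
      simp [he])
  have hb0 : b 0 = e := hb 0 rfl
  have e1 : ∫⁻ x : EuclideanSpace ℝ (Fin (m + 1)), H (‖x‖, inner ℝ e x) = ∫⁻ y : EuclideanSpace ℝ (Fin (m + 1)), H (‖y‖, y 0) := by
    rw [← b.measurePreserving_repr.lintegral_comp (f := fun y => H (‖y‖, y 0)) (by fun_prop)]
    refine lintegral_congr fun x => ?_
    rw [b.repr_apply_apply, hb0, LinearIsometryEquiv.norm_map]
  have e2 : ∫⁻ y : EuclideanSpace ℝ (Fin (m + 1)), H (‖y‖, y 0) =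
      ∫⁻ s : ℝ, ∫⁻ z : EuclideanSpace ℝ (Fin m), H (√(s ^ 2 + ‖z‖ ^ 2), s) := by
    rw [← (PiLp.volume_preserving_toLp (Fin (m + 1))).lintegral_comp (by fun_prop),
      ← (volume_preserving_piFinSuccAbove (fun _ : Fin (m + 1) => ℝ) 0).symm.lintegral_comp
        (by fun_prop), Measure.volume_eq_prod, lintegral_prod _ (by fun_prop)]
    refine lintegral_congr fun s => ?_
    rw [← (PiLp.volume_preserving_toLp (Fin m)).lintegral_comp (by fun_prop)]
    refine lintegral_congr fun z => ?_
    simp [EuclideanSpace.norm_eq, Fin.sum_univ_succ, MeasurableEquiv.piFinSuccAbove,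
      Real.sq_sqrt (Finset.sum_nonneg fun i _ => sq_nonneg (z i))]
  have e3 : ∀ s : ℝ, ∫⁻ z : EuclideanSpace ℝ (Fin m), H (√(s ^ 2 + ‖z‖ ^ 2), s) =
      (volume : Measure (EuclideanSpace ℝ (Fin m))).toSphere univ *
      ∫⁻ ρ in Ioi 0, ENNReal.ofReal (ρ ^ (m - 1)) * H (√(s ^ 2 + ρ ^ 2), s) := fun s => by
    have := lintegral_radial (volume : Measure (EuclideanSpace ℝ (Fin m)))
      (φ := fun ρ => H (√(s ^ 2 + ρ ^ 2), s)) (by fun_prop)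
    simpa using this
  rw [e1, e2]
  simp_rw [e3]
  rw [lintegral_const_mul _ (Measurable.lintegral_prod_right' (f := fun p : ℝ × ℝ =>
    ENNReal.ofReal (p.2 ^ (m - 1)) * H (√(p.1 ^ 2 + p.2 ^ 2), p.1)) (by fun_prop))]
  congr 1
  have hi : Measurable fun p : ℝ × ℝ => (Ioi (0 : ℝ)).indicator
      (fun ρ => ENNReal.ofReal (ρ ^ (m - 1)) * H (√(p.1 ^ 2 + ρ ^ 2), p.1)) p.2 := by
    have : (fun p : ℝ × ℝ => (Ioi (0 : ℝ)).indicator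
      (fun ρ => ENNReal.ofReal (ρ ^ (m - 1)) * H (√(p.1 ^ 2 + ρ ^ 2), p.1)) p.2) =
      (univ ×ˢ Ioi (0 : ℝ)).indicator
      (fun p => ENNReal.ofReal (p.2 ^ (m - 1)) * H (√(p.1 ^ 2 + p.2 ^ 2), p.1)) := by
      ext p; simp [indicator]
    rw [this]
    exact Measurable.indicator (by fun_prop) (MeasurableSet.univ.prod measurableSet_Ioi)
  have e4 : ∫⁻ s : ℝ, ∫⁻ ρ in Ioi 0, ENNReal.ofReal (ρ ^ (m - 1)) * H (√(s ^ 2 + ρ ^ 2), s) =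
      ∫⁻ p : ℝ × ℝ, (Ioi (0 : ℝ)).indicator
      (fun ρ => ENNReal.ofReal (ρ ^ (m - 1)) * H (√(p.1 ^ 2 + ρ ^ 2), p.1)) p.2 := by
    rw [Measure.volume_eq_prod, lintegral_prod _ hi.aemeasurable]
    refine lintegral_congr fun s => ?_
    rw [← lintegral_indicator measurableSet_Ioi]
  rw [e4, ← lintegral_comp_polarCoord_symm, polarCoord_target, Measure.volume_eq_prod,
    ← Measure.prod_restrict, lintegral_prod _ ?_]
  · refine setLIntegral_congr_fun measurableSet_Ioi fun r hr => ?_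
    have hr' : 0 < r := hr
    rw [← lintegral_indicator measurableSet_Ioo, ← lintegral_indicator measurableSet_Ioo]
    refine lintegral_congr fun β => ?_
    by_cases hβ : β ∈ Ioo (-π) π
    · have hn : √((r * cos β) ^ 2 + (r * sin β) ^ 2) = r := by
        rw [show (r * cos β) ^ 2 + (r * sin β) ^ 2 = r ^ 2 * (sin β ^ 2 + cos β ^ 2) by ring,
          sin_sq_add_cos_sq, mul_one, Real.sqrt_sq hr'.le]
      by_cases h0 : 0 < β
      · have hs : 0 < sin β := sin_pos_of_pos_of_lt_pi h0 hβ.2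
        have : r * sin β ∈ Ioi (0 : ℝ) := mul_pos hr' hs
        rw [indicator_of_mem hβ, indicator_of_mem (show β ∈ Ioo 0 π from ⟨h0, hβ.2⟩)]
        simp only [polarCoord_symm_apply, smul_eq_mul]
        rw [indicator_of_mem this, hn, ← mul_assoc, ← ENNReal.ofReal_mul hr'.le]
      -- Nonpositive angles lie outside the open half-plane ρ > 0, so only (0, π) contributes.
      · have hs : sin β ≤ 0 := sin_nonpos_of_nonpos_of_neg_pi_le (not_lt.1 h0) hβ.1.le
        have : r * sin β ∉ Ioi (0 : ℝ) := not_lt.2 (mul_nonpos_of_nonneg_of_nonpos hr'.le hs)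
        rw [indicator_of_mem hβ, indicator_of_notMem (fun h : β ∈ Ioo 0 π => h0 h.1)]
        simp only [polarCoord_symm_apply, smul_eq_mul]
        rw [indicator_of_notMem this, mul_zero]
    · rw [indicator_of_notMem hβ, indicator_of_notMem]
      exact fun h => hβ ⟨by linarith [h.1, pi_pos], h.2⟩
  · refine AEMeasurable.mul (by fun_prop) ?_
    exact (hi.comp continuous_polarCoord_symm.measurable).aemeasurable

/-- Integration over the unit sphere of a function of one coordinate. -/
theorem lintegral_sphere_inner {m : ℕ} (hm : 1 ≤ m) {e : EuclideanSpace ℝ (Fin (m + 1))}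
    (he : ‖e‖ = 1) {φ : ℝ → ENNReal} (hφ : Measurable φ) :
    ∫⁻ θ, φ (inner ℝ e (θ : EuclideanSpace ℝ (Fin (m + 1))))
        ∂(volume : Measure (EuclideanSpace ℝ (Fin (m + 1)))).toSphere =
      (volume : Measure (EuclideanSpace ℝ (Fin m))).toSphere univ *
      ∫⁻ β in Ioo 0 π, ENNReal.ofReal (sin β ^ (m - 1)) * φ (cos β) := by
  -- `lintegral_norm_inner` is applied to the extension of φ that is constant along rays, cut off to
  -- the unit ball. Both sides acquire the radial factor c, which is finite and nonzero and cancels.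
  set c : ENNReal := ∫⁻ r in Ioi (0 : ℝ), ENNReal.ofReal (r ^ m) * (Iio 1).indicator 1 r with hc
  have hc' : c = ENNReal.ofReal (∫ r in (0 : ℝ)..1, r ^ m) := by
    rw [intervalIntegral.integral_of_le zero_le_one, ← restrict_Ioo_eq_restrict_Ioc,
      ofReal_integral_eq_lintegral_ofReal, hc, ← Iio_inter_Ioi,
      ← Measure.restrict_restrict measurableSet_Iio, ← lintegral_indicator measurableSet_Iio]
    · refine lintegral_congr fun r => ?_
      by_cases h : r ∈ Iio (1 : ℝ)
      · simp [indicator_of_mem h]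
      · simp [indicator_of_notMem h]
    · exact ((continuous_pow m).integrableOn_Icc (a := 0) (b := 1)).mono_set Ioo_subset_Icc_self
    · filter_upwards [ae_restrict_mem measurableSet_Ioo] with r hr using pow_nonneg hr.1.le _
  have hc0 : c ≠ 0 := by
    rw [hc', integral_pow]; simp; positivity
  have hct : c ≠ ⊤ := by rw [hc']; exact ENNReal.ofReal_ne_top
  have h1i : Measurable ((Iio (1 : ℝ)).indicator (1 : ℝ → ENNReal)) :=
    measurable_one.indicator measurableSet_Iio
  have key := lintegral_norm_inner hm he (H := fun p => (Iio 1).indicator 1 p.1 * φ (p.2 / p.1))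
    (by fun_prop)
  have hG : Measurable fun x : EuclideanSpace ℝ (Fin (m + 1)) =>
      (Iio (1 : ℝ)).indicator (1 : ℝ → ENNReal) ‖x‖ * φ (inner ℝ e x / ‖x‖) := by fun_prop
  rw [lintegral_eq_lintegral_sphere _ hG] at key
  refine (ENNReal.mul_right_inj hc0 hct).1 ?_
  calc c * _ = _ := by
        rw [hc, ← lintegral_mul_const _ (by fun_prop)]
      _ = _ := by
        refine Eq.trans (setLIntegral_congr_fun measurableSet_Ioi fun r hr => ?_) key
        have hr' : 0 < r := hr
        have hn : ∀ θ : sphere (0 : EuclideanSpace ℝ (Fin (m + 1))) 1,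
            ‖r • (θ : EuclideanSpace ℝ (Fin (m + 1)))‖ = r := fun θ => by
          rw [norm_smul, norm_eq_of_mem_sphere, mul_one, Real.norm_of_nonneg hr'.le]
        simp only [hn, finrank_euclideanSpace_fin, Nat.add_sub_cancel, inner_smul_right]
        rw [lintegral_const_mul' _ _ (by
          by_cases h : r ∈ Iio (1 : ℝ)
          · simp [indicator_of_mem h]
          · simp [indicator_of_notMem h]), mul_assoc]
        simp only [mul_div_cancel_left₀ _ hr'.ne']
      _ = _ := by
        rw [mul_left_comm]
        congr 1
        rw [hc, ← lintegral_mul_const _ (by fun_prop)]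
        refine setLIntegral_congr_fun measurableSet_Ioi fun r hr => ?_
        have hr' : 0 < r := hr
        rw [← lintegral_const_mul _ (by fun_prop)]
        refine setLIntegral_congr_fun measurableSet_Ioo fun β hβ => ?_
        have hs : 0 < sin β := sin_pos_of_pos_of_lt_pi hβ.1 hβ.2
        have : r * (r * sin β) ^ (m - 1) = r ^ m * sin β ^ (m - 1) := by
          obtain ⟨k, rfl⟩ : ∃ k, m = k + 1 := ⟨m - 1, by omega⟩
          simp; ring
        simp only [this, mul_div_cancel_left₀ _ hr'.ne']
        rw [ENNReal.ofReal_mul (by positivity)]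
        ring

/-! ### Logarithmic potentials of polynomials for the arcsine measure. -/

/-- Serves to show that the zeros of sin (K x) compensate the logarithmic singularities of log (2
sin (x / 2)). -/
theorem abs_sin_natCast_mul_le (k : ℕ) (x : ℝ) : |sin (k * x)| ≤ k * |sin x| := by
  induction k with
  | zero => simp
  | succ k ih =>
    have : sin ((k + 1 : ℕ) * x) = sin (k * x) * cos x + cos (k * x) * sin x := by
      rw [← sin_add]; push_cast; ring_nf
    rw [this]
    calc _ ≤ |sin (k * x) * cos x| + |cos (k * x) * sin x| := abs_add_le _ _
      _ ≤ |sin (k * x)| * 1 + 1 * |sin x| := by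
        rw [abs_mul, abs_mul]
        gcongr
        · exact abs_cos_le_one _
        · exact abs_cos_le_one _
      _ ≤ _ := by push_cast; linarith

/-- The function `sin (k x) cot (x / 2)` is a trigonometric polynomial with integral `2 π`. -/
theorem exists_sin_mul_cot (k : ℕ) : ∃ D : ℝ → ℝ, Continuous D ∧
    (∀ x, sin (x / 2) * D x = sin ((k + 1 : ℕ) * x) * cos (x / 2)) ∧
    ∫ x in (0 : ℝ)..(2 * π), D x = 2 * π := by
  have hc : ∀ j : ℕ, ∫ x in (0 : ℝ)..(2 * π), cos ((j + 1 : ℕ) * x) = 0 := fun j => by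
    rw [intervalIntegral.integral_comp_mul_left (fun x => cos x) (by positivity), integral_cos]
    have := sin_nat_mul_pi ((j + 1) * 2)
    push_cast at this ⊢
    simp [← mul_assoc, this]
  induction k with
  | zero =>
    refine ⟨fun x => 1 + cos x, by fun_prop, fun x => ?_, ?_⟩
    · have h1 := cos_two_mul (x / 2)
      have h2 := sin_two_mul (x / 2)
      rw [mul_div_cancel₀ x two_ne_zero] at h1 h2
      simp only [zero_add, Nat.cast_one, one_mul]
      rw [h1, h2]; ring
    · rw [intervalIntegral.integral_add (by simp) (by simp)]
      simp
  | succ k ih =>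
    obtain ⟨D, hD, h1, h2⟩ := ih
    refine ⟨fun x => D x + (cos ((k + 1 : ℕ) * x) + cos ((k + 1 + 1 : ℕ) * x)), by fun_prop,
      fun x => ?_, ?_⟩
    · obtain ⟨y, hy⟩ : ∃ y, y = x / 2 := ⟨_, rfl⟩
      obtain ⟨A, hA⟩ : ∃ A, A = ((k + 1 : ℕ) : ℝ) * x + y := ⟨_, rfl⟩
      have e1 : ((k + 1 + 1 : ℕ) : ℝ) * x = A + y := by rw [hA, hy]; push_cast; ring
      have e2 : ((k + 1 : ℕ) : ℝ) * x = A - y := by rw [hA]; ring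
      rw [mul_add, h1 x, e1, e2, ← hy, sin_sub, sin_add, cos_sub, cos_add]
      ring
    · rw [intervalIntegral.integral_add (hD.intervalIntegrable _ _)
        (Continuous.intervalIntegrable (by fun_prop) _ _),
        intervalIntegral.integral_add (Continuous.intervalIntegrable (by fun_prop) _ _)
        (Continuous.intervalIntegrable (by fun_prop) _ _), h2, hc, hc]
      simp

/-- The logarithm in the library is log |·|, and for a meromorphic function it has only integrable
singularities. -/
theorem intervalIntegrable_log_of_analytic {g : ℝ → ℝ} (hg : ∀ x, AnalyticAt ℝ g x) (a b : ℝ) :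
    IntervalIntegrable (fun x => log (g x)) volume a b :=
  MeromorphicOn.intervalIntegrable_log (f := g) fun x _ => (hg x).meromorphicAt

theorem intervalIntegrable_log_two_sin_half (a b : ℝ) :
    IntervalIntegrable (fun x => log (2 * sin (x / 2))) volume a b :=
  intervalIntegrable_log_of_analytic (fun x => by fun_prop) a b

/-- Halving the variable reduces this to Euler's integral of log sin over (0, π), whose value
cancels the contribution of log 2. It is the Fourier coefficient of index zero. -/
theorem integral_log_two_sin_half :
    ∫ x in (0 : ℝ)..(2 * π), log (2 * sin (x / 2)) = 0 := by
  have h1 : ∫ x in (0 : ℝ)..(2 * π), log (2 * sin (x / 2)) =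
      ∫ x in (0 : ℝ)..(2 * π), (log 2 + log (sin (x / 2))) := by
    refine intervalIntegral.integral_congr_ae ?_
    have : ∀ᵐ x : ℝ, x ≠ 2 * π := by simp [ae_iff]
    filter_upwards [this] with x hx hm
    rw [uIoc_of_le (by positivity)] at hm
    have hx2 : x < 2 * π := lt_of_le_of_ne hm.2 hx
    have : 0 < sin (x / 2) := sin_pos_of_pos_of_lt_pi (by linarith [hm.1]) (by linarith)
    rw [log_mul two_ne_zero this.ne']
  rw [h1, intervalIntegral.integral_add (by simp)
    (intervalIntegrable_log_of_analytic (fun x => by fun_prop) _ _),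
    intervalIntegral.integral_comp_div (fun x => log (sin x)) two_ne_zero]
  have : 2 * π / 2 = π := by ring
  rw [zero_div, this, integral_log_sin_zero_pi]
  simp; ring

/-- Fourier coefficients of `log |2 sin (x / 2)|`. -/
theorem integral_log_two_sin_half_mul_cos (k : ℕ) :
    ∫ x in (0 : ℝ)..(2 * π), log (2 * sin (x / 2)) * cos ((k + 1 : ℕ) * x) =
      -(π / (k + 1 : ℕ)) := by
  set K : ℝ := ((k + 1 : ℕ) : ℝ) with hK
  have hK0 : K ≠ 0 := by positivity
  obtain ⟨D, hD, h1, h2⟩ := exists_sin_mul_cot k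
  rw [← hK] at h1
  have hcont : Continuous fun x : ℝ => log (2 * sin (x / 2)) * (sin (K * x) / K) := by
    refine continuous_iff_continuousAt.2 fun x => ?_
    by_cases hx : 2 * sin (x / 2) = 0
    -- With y = 2 sin (z / 2), the product is dominated by |y log y|, which is continuous and
    -- vanishes at y = 0.
    · have hb : ∀ z : ℝ, ‖log (2 * sin (z / 2)) * (sin (K * z) / K)‖ ≤
          |(2 * sin (z / 2)) * log (2 * sin (z / 2))| := fun z => by
        have h3 := abs_sin_natCast_mul_le (k + 1) z
        rw [← hK] at h3
        have h4 : |sin z| ≤ |2 * sin (z / 2)| := by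
          have h5 := sin_two_mul (z / 2)
          rw [mul_div_cancel₀ z two_ne_zero] at h5
          rw [h5, abs_mul]
          exact mul_le_of_le_one_right (abs_nonneg _) (abs_cos_le_one _)
        have hKp : 0 < K := by positivity
        rw [norm_eq_abs, abs_mul, abs_mul, mul_comm, abs_div, abs_of_pos hKp]
        gcongr
        rw [div_le_iff₀ hKp]
        nlinarith
      have h0 : log (2 * sin (x / 2)) * (sin (K * x) / K) = 0 := by
        rw [hx]; simp
      rw [ContinuousAt, h0]
      refine squeeze_zero_norm hb ?_
      have : Continuous fun z : ℝ => |(2 * sin (z / 2)) * log (2 * sin (z / 2))| :=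
        (continuous_mul_log.comp (by fun_prop : Continuous fun z : ℝ => 2 * sin (z / 2))).abs
      have h5 := this.tendsto x
      simpa [hx] using h5
    · exact (ContinuousAt.log (f := fun z : ℝ => 2 * sin (z / 2)) (by fun_prop) hx).mul (by fun_prop)
  have hder : ∀ x ∈ Ioo (0 : ℝ) (2 * π), HasDerivAt
      (fun x : ℝ => log (2 * sin (x / 2)) * (sin (K * x) / K))
      (log (2 * sin (x / 2)) * cos (K * x) + 1 / (2 * K) * D x) x := fun x hx => by
    have hs : 0 < sin (x / 2) := sin_pos_of_pos_of_lt_pi (by linarith [hx.1]) (by linarith [hx.2])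
    have d1 : HasDerivAt (fun x : ℝ => sin (x / 2)) (cos (x / 2) * (1 / 2)) x :=
      ((hasDerivAt_id x).div_const 2).sin
    have d2 := (d1.const_mul 2).log (by positivity)
    have d3 : HasDerivAt (fun x : ℝ => sin (K * x) / K) (cos (K * x) * (K * 1) / K) x :=
      (((hasDerivAt_id x).const_mul K).sin).div_const K
    refine (d2.mul d3).congr_deriv ?_
    have h3 := h1 x
    have : D x = sin (K * x) * cos (x / 2) / sin (x / 2) := by
      rw [← h3]; field_simp
    rw [this]
    field_simp
    ring
  have hi : IntervalIntegrable (fun x => log (2 * sin (x / 2)) * cos (K * x)) volume 0 (2 * π) :=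
    (intervalIntegrable_log_two_sin_half _ _).mul_continuousOn (by fun_prop)
  have hi2 : IntervalIntegrable (fun x => 1 / (2 * K) * D x) volume 0 (2 * π) :=
    Continuous.intervalIntegrable (by fun_prop) _ _
  -- Integration by parts: the primitive vanishes at 0 and 2π, so the wanted integral is minus the
  -- integral of D / (2K), that is -π/K.
  have := intervalIntegral.integral_eq_sub_of_hasDerivAt_of_le (by positivity)
    hcont.continuousOn hder (hi.add hi2)
  rw [intervalIntegral.integral_add hi hi2, intervalIntegral.integral_const_mul, h2] at this
  have h5 := sin_nat_mul_pi ((k + 1) * 2)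
  have h6 : sin (K * (2 * π)) = 0 := by
    rw [← h5, hK]; push_cast; ring_nf
  rw [h6] at this
  simp only [zero_div, mul_zero, sin_zero, sub_self] at this
  rw [eq_neg_of_add_eq_zero_left this]
  field_simp

theorem intervalIntegrable_log_sub_cos (z a b : ℝ) :
    IntervalIntegrable (fun x => log (z - cos x)) volume a b :=
  intervalIntegrable_log_of_analytic (fun x => by fun_prop) a b

/-- Convolution on the circle of `log |2 sin (x / 2)|` with a cosine. -/
theorem integral_log_cos_sub_cos (γ : ℝ) (k : ℕ) :
    ∫ β in (0 : ℝ)..π, log (cos γ - cos β) * cos (k * β) =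
      cos (k * γ) * (∫ x in (0 : ℝ)..(2 * π), log (2 * sin (x / 2)) * cos (k * x)) -
        log 2 * ∫ β in (0 : ℝ)..π, cos (k * β) := by
  set L : ℝ → ℝ := fun x => log (2 * sin (x / 2)) with hL
  have Lper : Function.Periodic L (2 * π) := fun x => by
    have : (x + 2 * π) / 2 = x / 2 + π := by ring
    simp only [hL, this, sin_add_pi, mul_neg, log_neg_eq_log]
  have Leven : ∀ x, L (-x) = L x := fun x => by
    simp only [hL, neg_div, sin_neg, mul_neg, log_neg_eq_log]
  have Lint : ∀ a b, IntervalIntegrable L volume a b := intervalIntegrable_log_two_sin_half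
  have hk : Continuous fun β : ℝ => cos (k * β) := by fun_prop
  have i1 : ∀ a b, IntervalIntegrable (fun β => L (β + γ) * cos (k * β)) volume a b := fun a b =>
    IntervalIntegrable.mul_continuousOn
      (intervalIntegrable_log_of_analytic (fun x => by fun_prop) a b) hk.continuousOn
  have i2 : ∀ a b, IntervalIntegrable (fun β => L (β - γ) * cos (k * β)) volume a b := fun a b =>
    IntervalIntegrable.mul_continuousOn
      (intervalIntegrable_log_of_analytic (fun x => by fun_prop) a b) hk.continuousOn
  have i3 : ∀ a b, IntervalIntegrable (fun β => log 2 * cos (k * β)) volume a b := fun a b =>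
    Continuous.intervalIntegrable (by fun_prop) a b
  have e1 : ∫ β in (0 : ℝ)..π, log (cos γ - cos β) * cos (k * β) =
      ∫ β in (0 : ℝ)..π, (L (β + γ) * cos (k * β) + L (β - γ) * cos (k * β) -
        log 2 * cos (k * β)) := by
    refine intervalIntegral.integral_congr_ae ?_
    have hz : ∀ δ : ℝ, ∀ᵐ x : ℝ, sin ((x + δ) / 2) ≠ 0 := fun δ => by
      have : {x : ℝ | ¬ sin ((x + δ) / 2) ≠ 0} ⊆ range fun n : ℤ => 2 * (n * π) - δ := by
        intro x hx
        obtain ⟨n, hn⟩ := sin_eq_zero_iff.1 (not_not.1 hx)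
        exact ⟨n, by simp only [hn]; ring⟩
      exact measure_mono_null this ((countable_range _).measure_zero _)
    filter_upwards [hz γ, hz (-γ)] with β h1 h2 _
    rw [← sub_eq_add_neg] at h2
    -- The division by 2 here is the source of the term with log 2.
    have h3 : cos γ - cos β = (2 * sin ((β + γ) / 2)) * (2 * sin ((β - γ) / 2)) / 2 := by
      rw [cos_sub_cos, add_comm γ β, ← neg_sub β γ, neg_div, sin_neg]
      ring
    rw [h3, log_div (by simp [h1, h2]) two_ne_zero, log_mul (by simp [h1]) (by simp [h2])]
    simp only [hL]; ring
  rw [e1, intervalIntegral.integral_sub ((i1 _ _).add (i2 _ _)) (i3 _ _),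
    intervalIntegral.integral_add (i1 _ _) (i2 _ _), intervalIntegral.integral_const_mul]
  congr 1
  -- Reflection moves the second logarithm to (-π, 0) with the same integrand as the first. The two
  -- together fill one period, which may be translated by γ.
  have e2 : ∫ β in (0 : ℝ)..π, L (β - γ) * cos (k * β) =
      ∫ β in (-π : ℝ)..0, L (β + γ) * cos (k * β) := by
    have := intervalIntegral.integral_comp_neg (a := 0) (b := π)
      (fun β => L (β + γ) * cos (k * β))
    rw [neg_zero] at this
    rw [← this]
    refine intervalIntegral.integral_congr fun β _ => ?_
    simp only [mul_neg, cos_neg]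
    rw [← Leven (β - γ)]
    congr 2; ring
  rw [e2, add_comm, intervalIntegral.integral_add_adjacent_intervals (i1 _ _) (i1 _ _)]
  have e3 : ∫ β in (-π : ℝ)..π, L (β + γ) * cos (k * β) =
      ∫ x in (-π + γ)..(π + γ), L x * cos (k * (x - γ)) := by
    rw [← intervalIntegral.integral_comp_add_right (fun x => L x * cos (k * (x - γ)))]
    simp
  have kper : ∀ δ : ℝ, Function.Periodic (fun x : ℝ => L x * cos (k * (x - δ))) (2 * π) :=
    fun δ x => by
    simp only [Lper x]
    have : (k : ℝ) * (x + 2 * π - δ) = k * (x - δ) + k * (2 * π) := by ring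
    rw [this, cos_add_nat_mul_two_pi]
  have e4 : ∫ x in (-π + γ)..(π + γ), L x * cos (k * (x - γ)) =
      ∫ x in (-π)..π, L x * cos (k * (x - γ)) := by
    have := (kper γ).intervalIntegral_add_eq (-π + γ) (-π)
    rw [show -π + γ + 2 * π = π + γ by ring, show -π + 2 * π = π by ring] at this
    exact this
  have e5 : ∫ x in (0 : ℝ)..(2 * π), L x * cos (k * x) = ∫ x in (-π)..π, L x * cos (k * x) := by
    have := (kper 0).intervalIntegral_add_eq 0 (-π)
    rw [show -π + 2 * π = π by ring] at this
    simpa using this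
  have i4 : ∀ a b, IntervalIntegrable (fun x => cos (k * γ) * (L x * cos (k * x))) volume a b :=
    fun a b => ((Lint a b).mul_continuousOn hk.continuousOn).const_mul _
  have i5 : ∀ a b, IntervalIntegrable (fun x => sin (k * γ) * (L x * sin (k * x))) volume a b :=
    fun a b => ((Lint a b).mul_continuousOn (by fun_prop)).const_mul _
  rw [e3, e4, e5]
  have e6 : ∀ x, L x * cos (k * (x - γ)) =
      cos (k * γ) * (L x * cos (k * x)) + sin (k * γ) * (L x * sin (k * x)) := fun x => by
    rw [mul_sub, cos_sub]; ring
  simp_rw [e6]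
  rw [intervalIntegral.integral_add (i4 _ _) (i5 _ _), intervalIntegral.integral_const_mul,
    intervalIntegral.integral_const_mul]
  have e7 : ∫ x in (-π)..π, L x * sin (k * x) = 0 := by
    have := intervalIntegral.integral_comp_neg (a := -π) (b := π) (fun x => L x * sin (k * x))
    simp only [Leven, mul_neg, sin_neg, neg_neg, intervalIntegral.integral_neg] at this
    linarith
  rw [e7]; simp

theorem integral_log_cos_sub_cos_mul_cos (γ : ℝ) (k : ℕ) :
    ∫ β in (0 : ℝ)..π, log (cos γ - cos β) * cos ((k + 1 : ℕ) * β) =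
      -(π / (k + 1 : ℕ)) * cos ((k + 1 : ℕ) * γ) := by
  rw [integral_log_cos_sub_cos, integral_log_two_sin_half_mul_cos]
  have : ∫ β in (0 : ℝ)..π, cos ((k + 1 : ℕ) * β) = 0 := by
    rw [intervalIntegral.integral_comp_mul_left (fun x => cos x) (by positivity), integral_cos,
      sin_nat_mul_pi]
    simp
  rw [this]; ring

theorem integral_log_cos_sub_cos_zero (γ : ℝ) :
    ∫ β in (0 : ℝ)..π, log (cos γ - cos β) = -(π * log 2) := by
  have := integral_log_cos_sub_cos γ 0
  simp only [Nat.cast_zero, zero_mul, cos_zero, mul_one, one_mul, integral_log_two_sin_half] at this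
  rw [this]; simp; ring

open Polynomial in
/-- The logarithmic potential of a polynomial with respect to the arcsine measure is, on `(-1, 1)`,
a polynomial of the same degree. -/
theorem exists_polynomial_log_potential (m : ℕ) (p : ℝ[X]) (hp : p.natDegree ≤ m) :
    ∃ q : ℝ[X], q.natDegree ≤ m ∧ (1 ≤ m → q.coeff m = -(π / m) * p.coeff m) ∧
      (m = 0 → q = C (-(π * log 2) * p.coeff 0)) ∧
      ∀ z ∈ Icc (-1 : ℝ) 1,
        ∫ β in (0 : ℝ)..π, log (z - cos β) * p.eval (cos β) = q.eval z := by
  induction m generalizing p with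
  | zero =>
    refine ⟨C (-(π * log 2) * p.coeff 0), (natDegree_C _).le, by simp, fun _ => rfl, fun z hz => ?_⟩
    rw [eq_C_of_natDegree_le_zero hp]
    simp only [eval_C, coeff_C_zero, intervalIntegral.integral_mul_const]
    rw [← cos_arccos hz.1 hz.2, integral_log_cos_sub_cos_zero]
  | succ m ih =>
    have hT1 : (Chebyshev.T ℝ ((m + 1 : ℕ) : ℤ)).natDegree = m + 1 := by
      rw [Chebyshev.natDegree_T, Int.natAbs_natCast]
    have hT2 : (Chebyshev.T ℝ ((m + 1 : ℕ) : ℤ)).coeff (m + 1) = 2 ^ m := by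
      have := Chebyshev.leadingCoeff_T (R := ℝ) ((m + 1 : ℕ) : ℤ)
      rw [leadingCoeff, hT1] at this
      rw [this, Int.natAbs_natCast, Nat.add_sub_cancel]
    -- The Chebyshev polynomial of degree m + 1 has leading coefficient 2^m and is an eigenfunction
    -- of the potential, with eigenvalue -π/(m+1). Subtracting a times it lowers the degree.
    set a : ℝ := p.coeff (m + 1) / 2 ^ m with ha
    set T := Chebyshev.T ℝ ((m + 1 : ℕ) : ℤ) with hT
    have hr : (p - C a * T).natDegree ≤ m := by
      refine natDegree_le_iff_coeff_eq_zero.2 fun N hN => ?_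
      rcases Nat.lt_or_ge (m + 1) N with h | h
      · rw [coeff_sub, coeff_C_mul, coeff_eq_zero_of_natDegree_lt (lt_of_le_of_lt hp h),
          coeff_eq_zero_of_natDegree_lt (by rw [hT1]; exact h)]
        simp
      · have : N = m + 1 := by omega
        rw [this, coeff_sub, coeff_C_mul, hT2, ha]
        field_simp; simp
    obtain ⟨q, hq1, -, -, hq2⟩ := ih _ hr
    refine ⟨q + C (-(π / (m + 1 : ℕ)) * a) * T, ?_, fun _ => ?_, by simp, fun z hz => ?_⟩
    · refine natDegree_add_le_of_degree_le (by omega) ?_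
      exact (natDegree_C_mul_le _ _).trans hT1.le
    · rw [coeff_add, coeff_C_mul, hT2, coeff_eq_zero_of_natDegree_lt (by omega), ha]
      field_simp; ring
    · have hTc : ∀ β : ℝ, T.eval (cos β) = cos ((m + 1 : ℕ) * β) := fun β => by
        rw [hT, Chebyshev.T_real_cos]; norm_cast
      have h1 : ∀ β : ℝ, log (z - cos β) * p.eval (cos β) =
          log (z - cos β) * (p - C a * T).eval (cos β) +
            a * (log (z - cos β) * cos ((m + 1 : ℕ) * β)) := fun β => by
        rw [eval_sub, eval_mul, eval_C, hTc]; ring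
      simp_rw [h1]
      rw [intervalIntegral.integral_add, hq2 z hz, intervalIntegral.integral_const_mul]
      · obtain ⟨γ, rfl⟩ : ∃ γ, z = cos γ := ⟨arccos z, (cos_arccos hz.1 hz.2).symm⟩
        rw [integral_log_cos_sub_cos_mul_cos, eval_add, eval_mul, eval_C, hTc]
        ring
      · exact (intervalIntegrable_log_sub_cos _ _ _).mul_continuousOn
          (Continuous.continuousOn (by fun_prop))
      · exact ((intervalIntegrable_log_sub_cos _ _ _).mul_continuousOn
          (Continuous.continuousOn (by fun_prop))).const_mul _

/-- Integration over the unit sphere of a real function of one coordinate. -/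
theorem integral_sphere_inner {m : ℕ} (hm : 1 ≤ m) {e : EuclideanSpace ℝ (Fin (m + 1))}
    (he : ‖e‖ = 1) {φ : ℝ → ℝ} (hφ : Measurable φ) :
    ∫ θ, φ (inner ℝ e (θ : EuclideanSpace ℝ (Fin (m + 1))))
        ∂(volume : Measure (EuclideanSpace ℝ (Fin (m + 1)))).toSphere =
      (volume : Measure (EuclideanSpace ℝ (Fin m))).toSphere.real univ *
      ∫ β in (0 : ℝ)..π, sin β ^ (m - 1) * φ (cos β) := by
  have hi : Measurable fun θ : sphere (0 : EuclideanSpace ℝ (Fin (m + 1))) 1 =>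
      inner ℝ e (θ : EuclideanSpace ℝ (Fin (m + 1))) := by fun_prop
  -- The formula for nonnegative functions identifies two image measures. It therefore passes to
  -- real φ without any integrability assumption.
  have hμ : Measure.map (fun θ : sphere (0 : EuclideanSpace ℝ (Fin (m + 1))) 1 =>
      inner ℝ e (θ : EuclideanSpace ℝ (Fin (m + 1))))
      (volume : Measure (EuclideanSpace ℝ (Fin (m + 1)))).toSphere =
      (volume : Measure (EuclideanSpace ℝ (Fin m))).toSphere univ •
      Measure.map cos ((volume.restrict (Ioo 0 π)).withDensity
        fun β => ENNReal.ofReal (sin β ^ (m - 1))) := by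
    refine Measure.ext_of_lintegral _ fun g hg => ?_
    rw [lintegral_map hg hi, lintegral_sphere_inner hm he hg, lintegral_smul_measure,
      lintegral_map hg measurable_cos,
      lintegral_withDensity_eq_lintegral_mul _ (by fun_prop) (by fun_prop)]
    rfl
  rw [← integral_map hi.aemeasurable hφ.aestronglyMeasurable, hμ, integral_smul_measure,
    integral_map measurable_cos.aemeasurable hφ.aestronglyMeasurable,
    integral_withDensity_eq_integral_toReal_smul (by fun_prop) (by simp),
    intervalIntegral.integral_of_le pi_pos.le, ← restrict_Ioo_eq_restrict_Ioc]
  congr 1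
  refine setIntegral_congr_fun measurableSet_Ioo fun β hβ => ?_
  have : 0 ≤ sin β := (sin_pos_of_pos_of_lt_pi hβ.1 hβ.2).le
  simp [ENNReal.toReal_ofReal (pow_nonneg this _)]

theorem toSphere_real_univ {m : ℕ} (hm : 1 ≤ m) :
    (volume : Measure (EuclideanSpace ℝ (Fin m))).toSphere.real univ =
      2 * π ^ ((m : ℝ) / 2) / Gamma ((m : ℝ) / 2) := by
  have : Nonempty (Fin m) := ⟨⟨0, hm⟩⟩
  have hm0 : (0 : ℝ) < (m : ℝ) / 2 := by positivity
  rw [Measure.toSphere_real_apply_univ, Measure.real, EuclideanSpace.volume_ball]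
  simp only [finrank_euclideanSpace_fin, Fintype.card_fin, ENNReal.ofReal_one, one_pow, one_mul]
  rw [ENNReal.toReal_ofReal (by positivity), Gamma_add_one hm0.ne', sqrt_eq_rpow,
    ← rpow_natCast, ← rpow_mul pi_pos.le]
  have := (Gamma_pos_of_pos hm0).ne'
  field_simp

/-! ### The kernels log and sgn. -/

open Polynomial in
theorem exists_antiderivative (m : ℕ) (p : ℝ[X]) (hp : p.natDegree ≤ m) :
    ∃ P : ℝ[X], P.natDegree ≤ m + 1 ∧ derivative P = p ∧ P.coeff (m + 1) = p.coeff m / (m + 1) := by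
  refine ⟨∑ i ∈ Finset.range (m + 1), monomial (i + 1) (p.coeff i / (i + 1)), ?_, ?_, ?_⟩
  · refine natDegree_sum_le_of_forall_le _ _ fun i hi => (natDegree_monomial_le _).trans ?_
    have := Finset.mem_range.1 hi
    omega
  · rw [derivative_sum]
    conv_rhs => rw [p.as_sum_range' (m + 1) (by omega)]
    refine Finset.sum_congr rfl fun i _ => ?_
    rw [derivative_monomial]
    simp only [Nat.add_sub_cancel, Nat.cast_add, Nat.cast_one]
    congr 1
    field_simp
  · rw [finsetSum_coeff, Finset.sum_eq_single m]
    · simp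
    · intro i _ hi
      rw [coeff_monomial, if_neg (by omega)]
    · simp

open Polynomial in
theorem natDegree_one_sub_X_sq_pow_le (j : ℕ) :
    ((1 - X ^ 2 : ℝ[X]) ^ j).natDegree ≤ 2 * j := by
  have : (1 - X ^ 2 : ℝ[X]).natDegree ≤ 2 := by compute_degree
  refine natDegree_pow_le.trans ?_
  nlinarith

open Polynomial in
theorem coeff_one_sub_X_sq_pow (j : ℕ) :
    ((1 - X ^ 2 : ℝ[X]) ^ j).coeff (2 * j) = (-1) ^ j := by
  rw [mul_comm, coeff_pow_of_natDegree_le (by compute_degree)]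
  simp [coeff_one]

open Polynomial in
/-- The properties of the kernels `sgn` and `log` that make the backprojection polynomial: up to a
function of the scale `k` is homogeneous of degree zero, and the averages of `k (z - cos β)` with
weight `sin ^ N β` are polynomial of degree at most `N` for `|z| < 1`. -/
structure IsBackprojectionKernel (N : ℕ) (k lam : ℝ → ℝ) (Q : ℝ[X]) : Prop where
  measurable : Measurable k
  locallyIntegrable : LocallyIntegrable k
  lam_intervalIntegrable : ∀ T, IntervalIntegrable lam volume 0 T
  scaling : ∀ b, 0 < b → ∀ z, z ≠ 0 → k (b * z) = lam b + k z
  natDegree_le : Q.natDegree ≤ N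
  intervalIntegrable : ∀ z, IntervalIntegrable (fun β => k (z - cos β)) volume 0 π
  inner : ∀ z, |z| < 1 → ∫ β in (0 : ℝ)..π, sin β ^ N * k (z - cos β) = Q.eval z
  outer : ∃ C, 0 ≤ C ∧ ∀ z, 1 ≤ |z| →
    |∫ β in (0 : ℝ)..π, sin β ^ N * k (z - cos β)| ≤ C * |z| ^ (N + 1)

theorem sin_even_pow (j : ℕ) (β : ℝ) :
    sin β ^ (2 * j) = ((1 - Polynomial.X ^ 2 : Polynomial ℝ) ^ j).eval (cos β) := by
  rw [pow_mul, sin_sq]; simp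

theorem norm_integral_sin_pow_mul_le (N : ℕ) {g B : ℝ → ℝ}
    (hB : IntervalIntegrable B volume 0 π) (h : ∀ β ∈ Ioo 0 π, |g β| ≤ B β) :
    |∫ β in (0 : ℝ)..π, sin β ^ N * g β| ≤ ∫ β in (0 : ℝ)..π, B β := by
  refine intervalIntegral.norm_integral_le_of_norm_le (E := ℝ) pi_pos.le ?_ hB
  have : ∀ᵐ x : ℝ, x ≠ π := by simp [ae_iff]
  filter_upwards [this] with β h1 h2
  have hβ : β ∈ Ioo 0 π := ⟨h2.1, lt_of_le_of_ne h2.2 h1⟩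
  have hs : 0 ≤ sin β := (sin_pos_of_pos_of_lt_pi hβ.1 hβ.2).le
  rw [norm_mul, norm_pow, norm_eq_abs, norm_eq_abs]
  calc _ ≤ 1 * |g β| := by
        gcongr
        exact pow_le_one₀ (abs_nonneg _) (abs_sin_le_one β)
    _ ≤ _ := by rw [one_mul]; exact h β hβ

/-- From below, |z - cos β| ≥ 1 - |cos β| ≥ sin² β / 2; from above, |z - cos β| ≤ |z| + 1. The
singular part of the bound is integrable and independent of z, so the averaged kernel grows at most
linearly. -/
theorem abs_log_sub_cos_le {z β : ℝ} (hz : 1 ≤ |z|) (hβ : β ∈ Ioo 0 π) :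
    |log (z - cos β)| ≤ |z| + |log (2⁻¹ * (sin β * sin β))| := by
  have hs : 0 < sin β := sin_pos_of_pos_of_lt_pi hβ.1 hβ.2
  have hc : |cos β| ≤ 1 := abs_cos_le_one β
  have h1 : 2⁻¹ * (sin β * sin β) ≤ |z - cos β| := by
    have h2 : 1 - |cos β| ≤ |z - cos β| := by
      have := abs_sub_abs_le_abs_sub z (cos β)
      linarith
    have h3 : sin β * sin β = (1 - |cos β|) * (1 + |cos β|) := by
      have := sin_sq_add_cos_sq β
      nlinarith [sq_abs (cos β)]
    rw [h3]
    nlinarith [abs_nonneg (cos β)]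
  have h0 : 0 < 2⁻¹ * (sin β * sin β) := by positivity
  rw [← log_abs (z - cos β)]
  refine abs_le.2 ⟨?_, ?_⟩
  · have := log_le_log h0 h1
    have h4 := neg_abs_le (log (2⁻¹ * (sin β * sin β)))
    have := abs_nonneg z
    linarith
  · have h5 : |z - cos β| ≤ |z| + 1 := (abs_sub _ _).trans (by linarith)
    have h6 := log_le_log (h0.trans_le h1) h5
    have h7 := log_le_sub_one_of_pos (show 0 < |z| + 1 by positivity)
    have := abs_nonneg (log (2⁻¹ * (sin β * sin β)))
    linarith

-- An even power of sin β is a polynomial in cos β, so the average of the logarithm is the potential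
-- of a polynomial, computed above. For j = 0 the polynomial is a constant, and the singularity in
-- |x - y| will come from the scaling term alone.
open Polynomial in
theorem exists_isBackprojectionKernel_log (j : ℕ) : ∃ Q : ℝ[X],
    IsBackprojectionKernel (2 * j) log log Q ∧
    (1 ≤ j → Q.coeff (2 * j) = -(π / (2 * j : ℕ)) * (-1) ^ j) ∧
    (j = 0 → Q = C (-(π * log 2))) := by
  obtain ⟨Q, h1, h2, h3, h4⟩ := exists_polynomial_log_potential (2 * j) _
    (natDegree_one_sub_X_sq_pow_le j)
  refine ⟨Q, ?_, fun hj => ?_, fun hj => ?_⟩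
  · refine ⟨measurable_log, ?_, fun T => intervalIntegral.intervalIntegrable_log', ?_, h1,
      fun z => intervalIntegrable_log_sub_cos z 0 π, fun z hz => ?_, ?_⟩
    · refine locallyIntegrable_iff.2 fun K hK => ?_
      obtain ⟨T, hT⟩ := hK.isBounded.subset_closedBall 0
      refine IntegrableOn.mono_set (t := uIcc (-|T|) |T|) ?_ fun x hx => ?_
      · rw [← intervalIntegrable_iff']
        exact intervalIntegral.intervalIntegrable_log'
      · have := hT hx
        rw [mem_closedBall_zero_iff, norm_eq_abs] at this
        rw [uIcc_of_le (by linarith [abs_nonneg T])]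
        exact abs_le.1 (this.trans (le_abs_self T))
    · exact fun b hb z hz => log_mul hb.ne' hz
    · rw [← h4 z (abs_le.1 hz.le)]
      refine intervalIntegral.integral_congr fun β _ => ?_
      simp only [sin_even_pow]; ring
    · have hi : ∀ z : ℝ, IntervalIntegrable
          (fun β => |z| + |log (2⁻¹ * (sin β * sin β))|) volume 0 π := fun z =>
        (intervalIntegrable_const).add
          (intervalIntegrable_log_of_analytic (fun x => by fun_prop) 0 π).norm
      have hi0 : IntervalIntegrable
          (fun β => |log (2⁻¹ * (sin β * sin β))|) volume 0 π :=
          (intervalIntegrable_log_of_analytic (fun x => by fun_prop) 0 π).norm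
      set C0 := ∫ β in (0 : ℝ)..π, |log (2⁻¹ * (sin β * sin β))| with hC0
      have hC00 : 0 ≤ C0 := intervalIntegral.integral_nonneg pi_pos.le fun _ _ => abs_nonneg _
      refine ⟨π + C0, by positivity, fun z hz => ?_⟩
      refine (norm_integral_sin_pow_mul_le _ (hi z) fun β hβ => abs_log_sub_cos_le hz hβ).trans ?_
      rw [intervalIntegral.integral_add intervalIntegrable_const hi0,
        intervalIntegral.integral_const, ← hC0, smul_eq_mul, sub_zero, pow_succ]
      have h5 : 1 ≤ |z| ^ (2 * j) := one_le_pow₀ hz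
      have h6 := pi_pos
      calc π * |z| + C0 ≤ π * |z| + C0 * |z| := by nlinarith
        _ = (π + C0) * (1 * |z|) := by ring
        _ ≤ _ := by gcongr
  · rw [h2 (by omega), coeff_one_sub_X_sq_pow]
  · subst hj
    simpa using h3 rfl

/-- The sign function with value `1` at the origin. -/
noncomputable def sgn (x : ℝ) : ℝ := if x < 0 then -1 else 1

theorem measurable_sgn : Measurable sgn :=
  Measurable.ite measurableSet_Iio measurable_const measurable_const

theorem abs_sgn (x : ℝ) : |sgn x| = 1 := by unfold sgn; split_ifs <;> simp

-- An odd power of the sine makes sin^(2j+1) β dβ an exact differential in cos β, and the kernel has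
-- a single jump, at β = arccos z. The scaling term is zero because the sign is homogeneous of
-- degree zero.
open Polynomial in
theorem exists_isBackprojectionKernel_sgn (j : ℕ) : ∃ Q : ℝ[X],
    IsBackprojectionKernel (2 * j + 1) sgn 0 Q ∧
    Q.coeff (2 * j + 1) = 2 * (-1) ^ j / (2 * j + 1 : ℕ) := by
  obtain ⟨P, h1, h2, h3⟩ := exists_antiderivative (2 * j) _ (natDegree_one_sub_X_sq_pow_le j)
  -- The interval before the jump contributes P(z) - P(1), the one after it P(z) - P(-1).
  refine ⟨C 2 * P - C (P.eval 1 + P.eval (-1)), ?_, ?_⟩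
  · have hint : ∀ z, IntervalIntegrable (fun β => sgn (z - cos β)) volume 0 π := fun z => by
      refine (intervalIntegrable_const (c := (1 : ℝ))).mono_fun ?_ ?_
      · exact (measurable_sgn.comp (by fun_prop)).aestronglyMeasurable
      · exact .of_forall fun β => by simp [abs_sgn]
    refine ⟨measurable_sgn, ?_, fun T => intervalIntegrable_const (c := (0 : ℝ)), fun b hb z _ => ?_,
      ?_, hint, fun z hz => ?_, π, pi_pos.le, fun z hz => ?_⟩
    · exact (locallyIntegrable_const (1 : ℝ)).mono measurable_sgn.aestronglyMeasurable
        (.of_forall fun x => by simp [abs_sgn])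
    · simp [sgn, mul_neg_iff, hb, hb.not_gt]
    · rw [natDegree_sub_C]
      exact (natDegree_C_mul_le _ _).trans h1
    · obtain ⟨hz1, hz2⟩ := abs_lt.1 hz
      set γ := arccos z with hγ
      have hcγ : cos γ = z := cos_arccos hz1.le hz2.le
      have hγ0 : 0 ≤ γ := arccos_nonneg z
      have hγπ : γ ≤ π := arccos_le_pi z
      have hd : ∀ β, HasDerivAt (fun β => -P.eval (cos β)) (sin β ^ (2 * j + 1)) β := fun β => by
        refine ((P.hasDerivAt (cos β)).comp β (hasDerivAt_cos β)).neg.congr_deriv ?_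
        rw [h2, ← sin_even_pow, pow_succ]; ring
      have hI : ∀ a b, ∫ β in a..b, sin β ^ (2 * j + 1) = P.eval (cos a) - P.eval (cos b) :=
        fun a b => by
        rw [intervalIntegral.integral_eq_sub_of_hasDerivAt (fun β _ => hd β)
          (Continuous.intervalIntegrable (by fun_prop) _ _)]
        ring
      have hii : ∀ a b, a ∈ Icc 0 π → b ∈ Icc 0 π → IntervalIntegrable
          (fun β => sin β ^ (2 * j + 1) * sgn (z - cos β)) volume a b := fun a b ha hb => by
        refine IntervalIntegrable.mono_set (a := 0) (b := π) ?_ ?_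
        · exact (hint z).continuousOn_mul (by fun_prop)
        · rw [uIcc_of_le pi_pos.le]
          exact uIcc_subset_Icc ha hb
      rw [← intervalIntegral.integral_add_adjacent_intervals (b := γ)
        (hii 0 γ ⟨le_rfl, pi_pos.le⟩ ⟨hγ0, hγπ⟩) (hii γ π ⟨hγ0, hγπ⟩ ⟨pi_pos.le, le_rfl⟩)]
      have e1 : ∫ β in (0 : ℝ)..γ, sin β ^ (2 * j + 1) * sgn (z - cos β) =
          ∫ β in (0 : ℝ)..γ, -sin β ^ (2 * j + 1) := by
        refine intervalIntegral.integral_congr_ae ?_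
        have : ∀ᵐ x : ℝ, x ≠ γ := by simp [ae_iff]
        filter_upwards [this] with β h4 h5
        rw [uIoc_of_le hγ0] at h5
        have h6 : cos γ < cos β := cos_lt_cos_of_nonneg_of_le_pi h5.1.le hγπ
          (lt_of_le_of_ne h5.2 h4)
        rw [sgn, if_pos (by linarith)]; ring
      have e2 : ∫ β in γ..π, sin β ^ (2 * j + 1) * sgn (z - cos β) =
          ∫ β in γ..π, sin β ^ (2 * j + 1) := by
        refine intervalIntegral.integral_congr fun β hβ => ?_
        rw [uIcc_of_le hγπ] at hβ
        have h6 : cos β ≤ cos γ := cos_le_cos_of_nonneg_of_le_pi hγ0 hβ.2 hβ.1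
        simp only [sgn]
        rw [if_neg (by linarith)]; ring
      rw [e1, e2, intervalIntegral.integral_neg, hI, hI, hcγ]
      simp; ring
    · refine (norm_integral_sin_pow_mul_le _ (B := fun _ => 1) intervalIntegrable_const
        fun β _ => (abs_sgn _).le).trans ?_
      have : 1 ≤ |z| ^ (2 * j + 1 + 1) := one_le_pow₀ hz
      simp only [intervalIntegral.integral_const, sub_zero, smul_eq_mul, mul_one]
      nlinarith [pi_pos]
  · rw [coeff_sub, coeff_C_mul, h3, coeff_one_sub_X_sq_pow, coeff_C, if_neg (by omega)]
    push_cast; ring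

/-! ### Partial derivatives and the Laplacian of parameter integrals. -/

/-- The partial derivative in the `i`-th coordinate direction. -/
noncomputable def pd {n : ℕ} {F : Type*} [NormedAddCommGroup F] [NormedSpace ℝ F] (i : Fin n)
    (f : EuclideanSpace ℝ (Fin n) → F) (x : EuclideanSpace ℝ (Fin n)) : F :=
  fderiv ℝ f x (EuclideanSpace.single i 1)

section
variable {n : ℕ} {F : Type*} [NormedAddCommGroup F] [NormedSpace ℝ F]

theorem ContDiff.pd {f : EuclideanSpace ℝ (Fin n) → F} (hf : ContDiff ℝ ∞ f) (i : Fin n) :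
    ContDiff ℝ ∞ (pd i f) := by
  unfold _root_.pd
  exact (hf.fderiv_right (by simp)).clm_apply contDiff_const

theorem tsupport_pd_subset (f : EuclideanSpace ℝ (Fin n) → F) (i : Fin n) :
    tsupport (pd i f) ⊆ tsupport f :=
  tsupport_fderiv_apply_subset ℝ _

theorem laplacian_eq_sum {f : EuclideanSpace ℝ (Fin n) → F} {x : EuclideanSpace ℝ (Fin n)}
    (hf : ContDiffAt ℝ 2 f x) : Laplacian.laplacian f x = ∑ i, pd i (pd i f) x := by
  rw [congrFun (InnerProductSpace.laplacian_eq_iteratedFDeriv_orthonormalBasis f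
    (EuclideanSpace.basisFun (Fin n) ℝ)) x]
  refine Finset.sum_congr rfl fun i _ => ?_
  rw [iteratedFDeriv_two_apply]
  have h : DifferentiableAt ℝ (fderiv ℝ f) x :=
    (hf.fderiv_right (m := 1) (by norm_num)).differentiableAt one_ne_zero
  unfold pd
  rw [fderiv_clm_apply h (differentiableAt_const _)]
  simp

theorem laplacian_eq_sum_fun {f : EuclideanSpace ℝ (Fin n) → F} (hf : ContDiff ℝ ∞ f) :
    Laplacian.laplacian f = fun x => ∑ i, pd i (pd i f) x :=
  funext fun _ => laplacian_eq_sum (hf.contDiffAt.of_le (by norm_cast))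

theorem ContDiff.laplacian_infty {f : EuclideanSpace ℝ (Fin n) → F} (hf : ContDiff ℝ ∞ f) :
    ContDiff ℝ ∞ (Laplacian.laplacian f) := by
  rw [laplacian_eq_sum_fun hf]
  exact ContDiff.sum fun i _ => (hf.pd i).pd i

theorem tsupport_laplacian_subset {f : EuclideanSpace ℝ (Fin n) → F} (hf : ContDiff ℝ ∞ f) :
    tsupport (Laplacian.laplacian f) ⊆ tsupport f := by
  refine closure_minimal (fun x hx => ?_) (isClosed_tsupport f)
  by_contra h
  refine hx ?_
  rw [laplacian_eq_sum_fun hf]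
  refine Finset.sum_eq_zero fun i _ => ?_
  exact image_eq_zero_of_notMem_tsupport fun h' =>
    h (tsupport_pd_subset _ _ (tsupport_pd_subset _ _ h'))

variable {X : Type*} [TopologicalSpace X] [T2Space X] [MeasurableSpace X] [OpensMeasurableSpace X]
  {μ : Measure X} {K : Set X} {w : X → ℝ} {ι : X → EuclideanSpace ℝ (Fin n)}

theorem contDiff_setIntegral_comp_add (hK : IsCompact K) (hw : IntegrableOn w K μ)
    (hι : Continuous ι) {f : EuclideanSpace ℝ (Fin n) → F} (hf : ContDiff ℝ ∞ f) :
    ContDiff ℝ ∞ fun x => ∫ y in K, w y • f (x + ι y) ∂μ :=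
  contDiff_setIntegral_smul (Φ := fun p : EuclideanSpace ℝ (Fin n) × EuclideanSpace ℝ (Fin n) =>
    f (p.1 + p.2)) hK hw hι (by fun_prop)

theorem pd_setIntegral_comp_add [CompleteSpace F] (hK : IsCompact K) (hw : IntegrableOn w K μ)
    (hι : Continuous ι) {f : EuclideanSpace ℝ (Fin n) → F} (hf : ContDiff ℝ ∞ f) (i : Fin n) :
    pd i (fun x => ∫ y in K, w y • f (x + ι y) ∂μ) =
      fun x => ∫ y in K, w y • pd i f (x + ι y) ∂μ := by
  funext x
  have hf' := hf.continuous_fderiv (by simp)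
  have h := hasFDerivAt_setIntegral_smul (μ := μ) (Φ := fun x y => f (x + ι y))
    (Φ' := fun x y => fderiv ℝ f (x + ι y)) hK hw isOpen_univ
    ((hf.continuous.comp (by fun_prop : Continuous fun z : EuclideanSpace ℝ (Fin n) × X =>
      z.1 + ι z.2)).continuousOn)
    ((hf'.comp (by fun_prop : Continuous fun z : EuclideanSpace ℝ (Fin n) × X =>
      z.1 + ι z.2)).continuousOn)
    (fun p _ y _ => by
      have := ((hf.differentiable (by simp)) (p + ι y)).hasFDerivAt
      exact this.comp p ((hasFDerivAt_id p).add_const (ι y))) (mem_univ x)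
  rw [pd, h.fderiv, ContinuousLinearMap.integral_apply]
  · rfl
  · have hc : Continuous fun y => fderiv ℝ f (x + ι y) := hf'.comp (by fun_prop)
    obtain ⟨C, hC⟩ := hK.exists_bound_of_continuousOn hc.continuousOn
    exact Integrable.smul_bdd hw C
      (hc.continuousOn.aestronglyMeasurable_of_isCompact hK hK.isClosed.measurableSet)
      ((ae_restrict_iff' hK.isClosed.measurableSet).2 (.of_forall hC))

theorem integrableOn_smul_comp_add (hK : IsCompact K) (hw : IntegrableOn w K μ)
    (hι : Continuous ι) {f : EuclideanSpace ℝ (Fin n) → F} (hf : Continuous f)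
    (x : EuclideanSpace ℝ (Fin n)) :
    IntegrableOn (fun y => w y • f (x + ι y)) K μ := by
  have hc : Continuous fun y => f (x + ι y) := hf.comp (by fun_prop)
  obtain ⟨C, hC⟩ := hK.exists_bound_of_continuousOn hc.continuousOn
  exact Integrable.smul_bdd hw C
    (hc.continuousOn.aestronglyMeasurable_of_isCompact hK hK.isClosed.measurableSet)
    ((ae_restrict_iff' hK.isClosed.measurableSet).2 (.of_forall hC))

/-- All derivatives fall on f, so the weight may be singular as long as it is integrable. This
serves both for Newtonian potentials and for averages of translates of f. -/
theorem laplacian_setIntegral_comp_add [CompleteSpace F] (hK : IsCompact K)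
    (hw : IntegrableOn w K μ) (hι : Continuous ι) {f : EuclideanSpace ℝ (Fin n) → F}
    (hf : ContDiff ℝ ∞ f) (x : EuclideanSpace ℝ (Fin n)) :
    Laplacian.laplacian (fun x => ∫ y in K, w y • f (x + ι y) ∂μ) x =
      ∫ y in K, w y • Laplacian.laplacian f (x + ι y) ∂μ := by
  rw [laplacian_eq_sum_fun (contDiff_setIntegral_comp_add hK hw hι hf), laplacian_eq_sum_fun hf]
  simp only [Finset.smul_sum]
  rw [integral_finsetSum _ fun i _ =>
    integrableOn_smul_comp_add hK hw hι ((hf.pd i).pd i).continuous x]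
  refine Finset.sum_congr rfl fun i _ => ?_
  rw [pd_setIntegral_comp_add hK hw hι hf, pd_setIntegral_comp_add hK hw hι (hf.pd i)]

theorem pd_comp_sub {f : EuclideanSpace ℝ (Fin n) → F} (hf : ContDiff ℝ ∞ f) (i : Fin n)
    (x : EuclideanSpace ℝ (Fin n)) :
    pd i (fun y => f (x - y)) = fun y => -pd i f (x - y) := by
  funext y
  have h1 : HasFDerivAt (fun y => x - y)
      (-ContinuousLinearMap.id ℝ (EuclideanSpace ℝ (Fin n))) y :=
    (hasFDerivAt_id y).const_sub x
  have := (((hf.differentiable (by simp)) (x - y)).hasFDerivAt).comp y h1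
  rw [pd, show (fun y => f (x - y)) = f ∘ (fun y => x - y) from rfl, this.fderiv]
  simp [pd]

theorem pd_neg (f : EuclideanSpace ℝ (Fin n) → F) (i : Fin n) :
    pd i (fun y => -f y) = fun y => -pd i f y := by
  funext y
  simp [pd, fderiv_fun_neg]

theorem laplacian_comp_sub {f : EuclideanSpace ℝ (Fin n) → F} (hf : ContDiff ℝ ∞ f)
    (x y : EuclideanSpace ℝ (Fin n)) :
    Laplacian.laplacian (fun y => f (x - y)) y = Laplacian.laplacian f (x - y) := by
  rw [laplacian_eq_sum_fun hf, laplacian_eq_sum_fun (f := fun y => f (x - y)) (hf.comp (by fun_prop))]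
  refine Finset.sum_congr rfl fun i _ => ?_
  rw [pd_comp_sub hf, pd_neg, pd_comp_sub (hf.pd i)]
  simp

theorem sum_smul_pd (f : EuclideanSpace ℝ (Fin n) → F) (x y : EuclideanSpace ℝ (Fin n)) :
    ∑ i, y i • pd i f x = fderiv ℝ f x y := by
  have hy : y = ∑ i, y i • EuclideanSpace.single i (1 : ℝ) := by
    ext j; simp [Pi.single_apply]
  conv_rhs => rw [hy]
  simp [pd]

end

/-! ### The fundamental solution of the Laplacian. -/

section
variable {n : ℕ} {F : Type*} [NormedAddCommGroup F]

theorem integrable_of_bound_on_ball {f : EuclideanSpace ℝ (Fin n) → F} {φ : ℝ → ℝ} {T C : ℝ}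
    (hn : 1 ≤ n) (hf : AEStronglyMeasurable f) (hφ : IntegrableOn (fun r => r ^ (n - 1) * φ r) (Ioo 0 T))
    (hs : ∀ y, T ≤ ‖y‖ → f y = 0) (hb : ∀ y, y ≠ 0 → ‖f y‖ ≤ C * |φ ‖y‖|) :
    Integrable f := by
  have : Nonempty (Fin n) := ⟨⟨0, hn⟩⟩
  have h1 : IntegrableOn (fun y : EuclideanSpace ℝ (Fin n) => φ ‖y‖) (ball 0 T) := by
    rw [integrableOn_fun_norm_addHaar]
    simpa using hφ
  have h2 : IntegrableOn f (ball (0 : EuclideanSpace ℝ (Fin n)) T) := by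
    refine (h1.norm.const_mul C).mono' hf.restrict ?_
    have h0 : ∀ᵐ y : EuclideanSpace ℝ (Fin n), y ≠ 0 := by simp [ae_iff]
    filter_upwards [ae_restrict_of_ae h0] with y hy using hb y hy
  refine (integrableOn_iff_integrable_of_support_subset fun y hy => ?_).1 h2
  rw [mem_ball_zero_iff]
  by_contra h
  exact hy (hs y (not_lt.1 h))

variable [NormedSpace ℝ F]

/-- Along the ray through θ the Jacobian r^(n-1), the kernel r^(-n) and the factor r of the radial
vector cancel. What remains is the derivative of g(rθ), with integral -g(0) on every ray. -/
theorem integral_pow_neg_smul_fderiv [CompleteSpace F] (hn : 1 ≤ n)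
    {g : EuclideanSpace ℝ (Fin n) → F}
    (hg : ContDiff ℝ 1 g) (hgs : HasCompactSupport g) :
    Integrable (fun y => (‖y‖ ^ 2) ^ (-(n : ℝ) / 2) • fderiv ℝ g y y) ∧
    ∫ y, (‖y‖ ^ 2) ^ (-(n : ℝ) / 2) • fderiv ℝ g y y =
      -((volume : Measure (EuclideanSpace ℝ (Fin n))).toSphere.real univ • g 0) := by
  have : Nonempty (Fin n) := ⟨⟨0, hn⟩⟩
  obtain ⟨T, hT⟩ := hgs.isCompact.isBounded.subset_ball 0
  have hg' := hg.continuous_fderiv one_ne_zero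
  obtain ⟨C, hC⟩ := hg'.bounded_above_of_compact_support (hgs.fderiv ℝ)
  have hpow : ∀ r : ℝ, 0 < r → r ^ (n - 1) * ((r ^ 2) ^ (-(n : ℝ) / 2) * r) = 1 := fun r hr => by
    rw [← rpow_natCast r 2, ← rpow_mul hr.le]
    have : ((2 : ℕ) : ℝ) * (-(n : ℝ) / 2) = -(n : ℝ) := by push_cast; ring
    rw [this, rpow_neg hr.le, rpow_natCast]
    obtain ⟨k, rfl⟩ : ∃ k, n = k + 1 := ⟨n - 1, by omega⟩
    simp only [Nat.add_sub_cancel]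
    field_simp
    rw [pow_succ]
  have hz : ∀ y, T ≤ ‖y‖ → g y = 0 := fun y hy => image_eq_zero_of_notMem_tsupport fun h => by
    have := hT h
    rw [mem_ball_zero_iff] at this
    linarith
  have hz' : ∀ y, T ≤ ‖y‖ → fderiv ℝ g y = 0 := fun y hy => by
    by_contra h
    have := hT (support_fderiv_subset ℝ h)
    rw [mem_ball_zero_iff] at this
    linarith
  have hint : Integrable (fun y => (‖y‖ ^ 2) ^ (-(n : ℝ) / 2) • fderiv ℝ g y y) := by
    refine integrable_of_bound_on_ball (φ := fun r => (r ^ 2) ^ (-(n : ℝ) / 2) * r) (T := T)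
      (C := C) hn ?_ ?_ ?_ ?_
    · have h1 : Measurable fun y : EuclideanSpace ℝ (Fin n) => (‖y‖ ^ 2) ^ (-(n : ℝ) / 2) := by
        fun_prop
      have h2 : Continuous fun y => fderiv ℝ g y y := hg'.clm_apply continuous_id
      exact h1.aestronglyMeasurable.smul h2.aestronglyMeasurable
    · refine (integrableOn_const (C := (1 : ℝ)) (by simp)).congr_fun (fun r hr => ?_)
        measurableSet_Ioo
      exact (hpow r hr.1).symm
    · intro y hy
      rw [hz' y hy]; simp
    · intro y _
      rw [norm_smul, abs_mul, abs_norm, norm_eq_abs]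
      calc _ ≤ |(‖y‖ ^ 2) ^ (-(n : ℝ) / 2)| * (C * ‖y‖) := by
            gcongr
            exact ((fderiv ℝ g y).le_opNorm y).trans (by gcongr; exact hC y)
        _ = _ := by ring
  refine ⟨hint, ?_⟩
  rw [integral_eq_sphere_integral _ hint]
  have key : ∀ θ : sphere (0 : EuclideanSpace ℝ (Fin n)) 1,
      ∫ r in Ioi (0 : ℝ), r ^ (Module.finrank ℝ (EuclideanSpace ℝ (Fin n)) - 1) •
        ((‖r • (θ : EuclideanSpace ℝ (Fin n))‖ ^ 2) ^ (-(n : ℝ) / 2) •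
        fderiv ℝ g (r • (θ : EuclideanSpace ℝ (Fin n))) (r • (θ : EuclideanSpace ℝ (Fin n)))) =
      -g 0 := fun θ => by
    have hθ : ‖(θ : EuclideanSpace ℝ (Fin n))‖ = 1 := norm_eq_of_mem_sphere θ
    have hd : ∀ r : ℝ, HasDerivAt (fun r : ℝ => g (r • (θ : EuclideanSpace ℝ (Fin n))))
        (fderiv ℝ g (r • (θ : EuclideanSpace ℝ (Fin n))) θ) r := fun r => by
      have h1 := (hg.differentiable one_ne_zero (r • (θ : EuclideanSpace ℝ (Fin n)))).hasFDerivAt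
      have h2 : HasDerivAt (fun r : ℝ => r • (θ : EuclideanSpace ℝ (Fin n)))
        ((1 : ℝ) • (θ : EuclideanSpace ℝ (Fin n))) r := (hasDerivAt_id r).smul_const _
      have h3 := h1.comp_hasDerivAt r h2
      rw [one_smul] at h3
      exact h3
    have hc : Continuous fun r : ℝ => fderiv ℝ g (r • (θ : EuclideanSpace ℝ (Fin n))) θ :=
      (hg'.comp (by fun_prop)).clm_apply continuous_const
    have hnr : ∀ r : ℝ, 0 < r → ‖r • (θ : EuclideanSpace ℝ (Fin n))‖ = r := fun r hr => by
      rw [norm_smul, hθ, mul_one, norm_of_nonneg hr.le]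
    have h1 : ∀ r ∈ Ioi (0 : ℝ), r ^ (Module.finrank ℝ (EuclideanSpace ℝ (Fin n)) - 1) •
        ((‖r • (θ : EuclideanSpace ℝ (Fin n))‖ ^ 2) ^ (-(n : ℝ) / 2) •
        fderiv ℝ g (r • (θ : EuclideanSpace ℝ (Fin n))) (r • (θ : EuclideanSpace ℝ (Fin n)))) =
        fderiv ℝ g (r • (θ : EuclideanSpace ℝ (Fin n))) θ := fun r hr => by
      rw [hnr r hr, map_smul, smul_smul, smul_smul, finrank_euclideanSpace_fin, mul_assoc,
        hpow r hr, one_smul]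
    rw [setIntegral_congr_fun measurableSet_Ioi h1]
    have hfin : IntegrableOn (fun r : ℝ => fderiv ℝ g (r • (θ : EuclideanSpace ℝ (Fin n))) θ)
        (Ioi 0) := by
      have hK : IntegrableOn (fun r : ℝ => fderiv ℝ g (r • (θ : EuclideanSpace ℝ (Fin n))) θ)
        (Ioc 0 (max T 0)) := hc.integrableOn_Ioc
      refine hK.of_forall_sdiff_eq_zero measurableSet_Ioi fun r hr => ?_
      have hr0 : 0 < r := hr.1
      have : T ≤ r := by
        by_contra h
        exact hr.2 ⟨hr0, (not_le.1 h).le.trans (le_max_left _ _)⟩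
      rw [hz' _ (by rw [hnr r hr0]; exact this)]
      simp
    have := integral_Ioi_of_hasDerivAt_of_tendsto' (a := 0) (m := 0) (fun r _ => hd r) hfin ?_
    · rw [this]; simp
    · refine tendsto_const_nhds.congr' ?_
      filter_upwards [Filter.eventually_ge_atTop T, Filter.eventually_gt_atTop 0] with r hr hr0
      rw [hz _ (by rw [hnr r hr0]; exact hr)]
  simp_rw [key]
  simp

/-- Green's formula with a radial weight. -/
theorem integral_comp_norm_sq_smul_laplacian [CompleteSpace F] {W W' : ℝ → ℝ}
    (hW : ∀ s, 0 ≤ s → HasDerivAt W (W' s) s) (hW' : ContinuousOn W' (Ici 0))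
    {g : EuclideanSpace ℝ (Fin n) → F} (hg : ContDiff ℝ ∞ g) (hgs : HasCompactSupport g) :
    ∫ y, W (‖y‖ ^ 2) • Laplacian.laplacian g y =
      -∫ y, (2 * W' (‖y‖ ^ 2)) • fderiv ℝ g y y := by
  have hw : ∀ y : EuclideanSpace ℝ (Fin n), HasFDerivAt (fun y => W (‖y‖ ^ 2))
      ((W' (‖y‖ ^ 2)) • (2 • innerSL ℝ y)) y := fun y =>
    (hW _ (by positivity)).comp_hasFDerivAt y (hasStrictFDerivAt_norm_sq y).hasFDerivAt
  have hwe : ∀ (i : Fin n) (y : EuclideanSpace ℝ (Fin n)),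
      fderiv ℝ (fun y => W (‖y‖ ^ 2)) y (EuclideanSpace.single i 1) =
      2 * W' (‖y‖ ^ 2) * y i := fun i y => by
    rw [(hw y).fderiv]
    simp [EuclideanSpace.inner_single_right]
    ring
  have hwc : Continuous fun y : EuclideanSpace ℝ (Fin n) => W (‖y‖ ^ 2) :=
    continuous_iff_continuousAt.2 fun y => (hw y).continuousAt
  have hpc : Continuous fun y : EuclideanSpace ℝ (Fin n) => W' (‖y‖ ^ 2) :=
    hW'.comp_continuous (by fun_prop) fun y => by rw [mem_Ici]; positivity
  have hci : ∀ i : Fin n, Continuous (pd i g) := fun i => (hg.pd i).continuous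
  have hsi : ∀ i : Fin n, HasCompactSupport (pd i g) := fun i =>
    hgs.of_isClosed_subset (isClosed_tsupport _) (tsupport_pd_subset g i)
  have hsii : ∀ i : Fin n, HasCompactSupport (pd i (pd i g)) := fun i =>
    (hsi i).of_isClosed_subset (isClosed_tsupport _) (tsupport_pd_subset _ i)
  have hI3 : ∀ i : Fin n, Integrable fun y : EuclideanSpace ℝ (Fin n) =>
      (2 * W' (‖y‖ ^ 2) * y i) • pd i g y := fun i =>
    Continuous.integrable_of_hasCompactSupport (((continuous_const.mul hpc).mul
      (by fun_prop : Continuous fun y : EuclideanSpace ℝ (Fin n) => y i)).smul (hci i))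
      (hsi i).smul_left
  have hI2 : ∀ i : Fin n, Integrable fun y => W (‖y‖ ^ 2) • pd i (pd i g) y := fun i =>
    Continuous.integrable_of_hasCompactSupport
      (hwc.smul ((hg.pd i).pd i).continuous) (hsii i).smul_left
  have h1 : ∀ i : Fin n, ∫ y, W (‖y‖ ^ 2) • pd i (pd i g) y =
      -(∫ y, (2 * W' (‖y‖ ^ 2) * y i) • pd i g y) := fun i => by
    have := integral_smul_fderiv_eq_neg_fderiv_smul_of_integrable (μ := volume)
      (f := fun y : EuclideanSpace ℝ (Fin n) => W (‖y‖ ^ 2)) (g := pd i g)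
      (v := EuclideanSpace.single i 1) ?_ (hI2 i) ?_ ?_ ?_
    · simp_rw [hwe] at this
      exact this
    · simp_rw [hwe]
      exact hI3 i
    · exact Continuous.integrable_of_hasCompactSupport (hwc.smul (hci i)) (hsi i).smul_left
    · exact fun y _ => (hw y).differentiableAt
    · exact fun y _ => ((hg.pd i).differentiable (by simp)) y
  rw [laplacian_eq_sum_fun hg]
  simp only [Finset.smul_sum]
  rw [integral_finsetSum _ fun i _ => hI2 i]
  simp_rw [h1]
  rw [Finset.sum_neg_distrib, ← integral_finsetSum _ fun i _ => hI3 i]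
  congr 2
  funext y
  rw [← sum_smul_pd, Finset.smul_sum]
  refine Finset.sum_congr rfl fun i _ => ?_
  rw [smul_smul]

/-- A radial function with derivative `c r ^ (1 - n)` inverts the Laplacian. -/
theorem integral_radial_smul_laplacian [CompleteSpace F] (hn : 1 ≤ n) {c : ℝ} {φ : ℝ → ℝ}
    (hφ : ∀ s, 0 < s → HasDerivAt φ (c / 2 * s ^ (-(n : ℝ) / 2)) s)
    (hφm : Measurable φ)
    (hφi : ∀ T, IntegrableOn (fun r => r ^ (n - 1) * φ (r ^ 2)) (Ioo 0 T))
    (hφb : ∀ s, 0 < s → ∀ δ ∈ Ioc (0 : ℝ) 1, |φ (s + δ)| ≤ |φ s| + |φ (s + 1)|)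
    {g : EuclideanSpace ℝ (Fin n) → F} (hg : ContDiff ℝ ∞ g) (hgs : HasCompactSupport g) :
    ∫ y, φ (‖y‖ ^ 2) • Laplacian.laplacian g y =
      (c * (volume : Measure (EuclideanSpace ℝ (Fin n))).toSphere.real univ) • g 0 := by
  have : Nonempty (Fin n) := ⟨⟨0, hn⟩⟩
  obtain ⟨T, hT⟩ := hgs.isCompact.isBounded.subset_ball 0
  have hg1 : ContDiff ℝ 1 g := hg.of_le (by simp)
  obtain ⟨hI, hval⟩ := integral_pow_neg_smul_fderiv hn hg1 hgs
  have hL := hg.laplacian_infty.continuous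
  have hLs : HasCompactSupport (Laplacian.laplacian g) :=
    hgs.of_isClosed_subset (isClosed_tsupport _) (tsupport_laplacian_subset hg)
  have hg' := hg1.continuous_fderiv one_ne_zero
  obtain ⟨C, hC⟩ := hg'.bounded_above_of_compact_support (hgs.fderiv ℝ)
  obtain ⟨C', hC'⟩ := hL.bounded_above_of_compact_support hLs
  have hφc : ContinuousOn φ (Ioi 0) := fun s hs => (hφ s hs).continuousAt.continuousWithinAt
  have hEi : Continuous fun y : EuclideanSpace ℝ (Fin n) => ‖y‖ ^ 2 := by fun_prop
  -- integration by parts with a regularized kernel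
  have parts : ∀ δ : ℝ, 0 < δ → ∫ y, φ (‖y‖ ^ 2 + δ) • Laplacian.laplacian g y =
      -(c • ∫ y, (‖y‖ ^ 2 + δ) ^ (-(n : ℝ) / 2) • fderiv ℝ g y y) := fun δ hδ => by
    rw [integral_comp_norm_sq_smul_laplacian (W := fun s => φ (s + δ))
      (W' := fun s => c / 2 * (s + δ) ^ (-(n : ℝ) / 2))
      (fun s hs => (hφ (s + δ) (by positivity)).comp_add_const s δ) ?_ hg hgs, ← integral_smul]
    · congr 2
      funext y
      rw [smul_smul]
      congr 1
      ring
    · refine continuousOn_const.mul (ContinuousOn.rpow_const (by fun_prop) fun s hs => Or.inl ?_)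
      have : (0 : ℝ) ≤ s := hs
      positivity
  have hz : ∀ y, T ≤ ‖y‖ → g =ᶠ[nhds y] 0 := fun y hy =>
    notMem_tsupport_iff_eventuallyEq.1 fun h => by
    have := hT h
    rw [mem_ball_zero_iff] at this
    linarith
  have hzL : ∀ y, T ≤ ‖y‖ → Laplacian.laplacian g y = 0 := fun y hy =>
    image_eq_zero_of_notMem_tsupport fun h =>
      (notMem_tsupport_iff_eventuallyEq.2 (hz y hy)) (tsupport_laplacian_subset hg h)
  -- The shifts stay in (0, 1], so `hφb` gives a majorant that does not depend on k. In the gradient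
  -- term the unshifted kernel is itself a majorant, the exponent being nonpositive.
  let δ : ℕ → ℝ := fun k => 1 / ((k : ℝ) + 1)
  have hδ0 : ∀ k, 0 < δ k := fun k => by positivity
  have hδ1 : ∀ k, δ k ∈ Ioc (0 : ℝ) 1 := fun k =>
    ⟨hδ0 k, by rw [div_le_one (by positivity)]; linarith [(Nat.cast_nonneg k : (0 : ℝ) ≤ k)]⟩
  have hδt : Filter.Tendsto δ Filter.atTop (nhds 0) := tendsto_one_div_add_atTop_nhds_zero_nat
  have hne : ∀ᵐ y : EuclideanSpace ℝ (Fin n), y ≠ 0 := by simp [ae_iff]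
  have lim1 : Filter.Tendsto (fun k => ∫ y, φ (‖y‖ ^ 2 + δ k) • Laplacian.laplacian g y)
      Filter.atTop (nhds (∫ y, φ (‖y‖ ^ 2) • Laplacian.laplacian g y)) := by
    refine tendsto_integral_of_dominated_convergence
      (fun y => (|φ (‖y‖ ^ 2)| + |φ (‖y‖ ^ 2 + 1)|) * ‖Laplacian.laplacian g y‖) ?_ ?_ ?_ ?_
    · exact fun k => (by fun_prop : Measurable fun y : EuclideanSpace ℝ (Fin n) =>
        φ (‖y‖ ^ 2 + δ k)).aestronglyMeasurable.smul hL.aestronglyMeasurable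
    · refine integrable_of_bound_on_ball (φ := fun r => |φ (r ^ 2)| + |φ (r ^ 2 + 1)|) (T := T)
        (C := C') hn ?_ ?_ ?_ ?_
      · exact Measurable.aestronglyMeasurable (by
          have := hL.norm.measurable
          fun_prop)
      · have h1 : IntegrableOn (fun r : ℝ => r ^ (n - 1) * |φ (r ^ 2)|) (Ioo 0 T) := by
          refine IntegrableOn.congr_fun (f := fun r => ‖r ^ (n - 1) * φ (r ^ 2)‖) (hφi T).norm (fun r hr => ?_) measurableSet_Ioo
          simp only [norm_mul, norm_pow, norm_eq_abs, abs_of_pos hr.1]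
        have h2 : IntegrableOn (fun r : ℝ => r ^ (n - 1) * |φ (r ^ 2 + 1)|) (Ioo 0 T) := by
          refine IntegrableOn.mono_set (t := Icc 0 T) ?_ Ioo_subset_Icc_self
          refine ContinuousOn.integrableOn_Icc ?_
          refine (continuous_pow _).continuousOn.mul (ContinuousOn.abs ?_)
          exact hφc.comp (by fun_prop) (fun r _ => by simp only [mem_Ioi]; positivity)
        refine (h1.add h2).congr_fun (fun r _ => ?_) measurableSet_Ioo
        simp only [Pi.add_apply]; ring
      · intro y hy
        rw [hzL y hy]; simp
      · intro y _
        rw [norm_mul, norm_norm, norm_eq_abs, mul_comm]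
        gcongr
        exact hC' y
    · intro k
      filter_upwards [hne] with y hy
      rw [norm_smul, norm_eq_abs]
      gcongr
      exact hφb _ (by positivity) _ (hδ1 k)
    · filter_upwards [hne] with y hy
      refine Filter.Tendsto.smul_const ?_ _
      have := (hφ (‖y‖ ^ 2) (by positivity)).continuousAt.tendsto
      refine this.comp ?_
      simpa using hδt.const_add (‖y‖ ^ 2)
  have lim2 : Filter.Tendsto (fun k => ∫ y, (‖y‖ ^ 2 + δ k) ^ (-(n : ℝ) / 2) • fderiv ℝ g y y)
      Filter.atTop (nhds (∫ y, (‖y‖ ^ 2) ^ (-(n : ℝ) / 2) • fderiv ℝ g y y)) := by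
    refine tendsto_integral_of_dominated_convergence _ ?_ hI.norm ?_ ?_
    · exact fun k => (by fun_prop : Measurable fun y : EuclideanSpace ℝ (Fin n) =>
        (‖y‖ ^ 2 + δ k) ^ (-(n : ℝ) / 2)).aestronglyMeasurable.smul
          (hg'.clm_apply continuous_id).aestronglyMeasurable
    · intro k
      filter_upwards [hne] with y hy
      have hy2 : 0 < ‖y‖ ^ 2 := by positivity
      rw [norm_smul, norm_smul]
      gcongr ?_ * _
      rw [norm_of_nonneg (by have := (hδ0 k).le; positivity), norm_of_nonneg (by positivity)]
      refine rpow_le_rpow_of_nonpos hy2 (by linarith [hδ0 k]) ?_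
      have : (0 : ℝ) ≤ n := Nat.cast_nonneg n
      linarith
    · filter_upwards [hne] with y hy
      have hy2 : 0 < ‖y‖ ^ 2 := by positivity
      refine Filter.Tendsto.smul_const ?_ _
      refine Filter.Tendsto.rpow_const ?_ (Or.inl hy2.ne')
      simpa using hδt.const_add (‖y‖ ^ 2)
  have lim3 := (lim2.const_smul c).neg
  have := tendsto_nhds_unique lim1 (lim3.congr fun k => (parts (δ k) (hδ0 k)).symm)
  rw [this, hval, smul_neg, neg_neg, smul_smul]

end

/-! ### Spherical means, their profiles in s = t², and Newtonian potentials. -/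

section
variable {n : ℕ} {F : Type*} [NormedAddCommGroup F] [NormedSpace ℝ F]

/-- The mean of `f` over the sphere of radius `t` around `x`. -/
noncomputable def sphMean (f : EuclideanSpace ℝ (Fin n) → F) (x : EuclideanSpace ℝ (Fin n)) (t : ℝ) : F :=
  ((volume : Measure (EuclideanSpace ℝ (Fin n))).toSphere.real univ)⁻¹ •
    ∫ θ : sphere (0 : EuclideanSpace ℝ (Fin n)) 1, f (x + t • (θ : EuclideanSpace ℝ (Fin n)))
      ∂(volume : Measure (EuclideanSpace ℝ (Fin n))).toSphere

theorem toSphere_real_univ_pos (hn : 1 ≤ n) :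
    0 < (volume : Measure (EuclideanSpace ℝ (Fin n))).toSphere.real univ := by
  rw [toSphere_real_univ hn]
  have : (0 : ℝ) < (n : ℝ) / 2 := by positivity
  have := Gamma_pos_of_pos this
  positivity

theorem contDiff_sphMean {f : EuclideanSpace ℝ (Fin n) → F} (hf : ContDiff ℝ ∞ f) :
    ContDiff ℝ ∞ fun p : EuclideanSpace ℝ (Fin n) × ℝ => sphMean f p.1 p.2 := by
  unfold sphMean
  refine contDiff_const.smul ?_
  have := contDiff_setIntegral_smul (H := EuclideanSpace ℝ (Fin n) × ℝ)
    (μ := (volume : Measure (EuclideanSpace ℝ (Fin n))).toSphere)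
    (K := univ) (w := fun _ => 1) (ι := fun θ : sphere (0 : EuclideanSpace ℝ (Fin n)) 1 =>
      (θ : EuclideanSpace ℝ (Fin n)))
    (Φ := fun q : (EuclideanSpace ℝ (Fin n) × ℝ) × EuclideanSpace ℝ (Fin n) =>
      f (q.1.1 + q.1.2 • q.2)) isCompact_univ (by simp) continuous_subtype_val
      (by fun_prop)
  simpa using this

theorem sphMean_zero (hn : 1 ≤ n) [CompleteSpace F] (f : EuclideanSpace ℝ (Fin n) → F)
    (x : EuclideanSpace ℝ (Fin n)) : sphMean f x 0 = f x := by
  simp only [sphMean, zero_smul, add_zero, integral_const, smul_smul]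
  rw [inv_mul_cancel₀ (toSphere_real_univ_pos hn).ne', one_smul]

theorem sphMean_eq_zero {f : EuclideanSpace ℝ (Fin n) → F} {x : EuclideanSpace ℝ (Fin n)} {t : ℝ}
    (h : ∀ y, ‖y - x‖ = |t| → f y = 0) : sphMean f x t = 0 := by
  have : ∀ θ : sphere (0 : EuclideanSpace ℝ (Fin n)) 1,
      f (x + t • (θ : EuclideanSpace ℝ (Fin n))) = 0 := fun θ => h _ (by
    rw [add_sub_cancel_left, norm_smul, norm_eq_of_mem_sphere, mul_one, norm_eq_abs])
  simp [sphMean, this]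

/-- Compactness of the support leaves a gap between it and the sphere of radius R. The gap makes the
spherical means centred on that sphere vanish for small radii. -/
theorem exists_radius_lt {G : Type*} [NormedAddCommGroup G]
    {f : EuclideanSpace ℝ (Fin n) → G} {R : ℝ} (hR : 0 < R)
    (hs : tsupport f ⊆ ball 0 R) : ∃ r, 0 ≤ r ∧ r < R ∧ ∀ y, r < ‖y‖ → f y = 0 := by
  have hc : IsCompact (tsupport f) :=
    isCompact_of_isClosed_isBounded (isClosed_tsupport f) (isBounded_ball.subset hs)
  rcases (tsupport f).eq_empty_or_nonempty with h | h
  · exact ⟨0, le_rfl, hR, fun y _ => image_eq_zero_of_notMem_tsupport (by simp [h])⟩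
  · obtain ⟨x, hx, hm⟩ := hc.exists_isMaxOn h continuous_norm.continuousOn
    refine ⟨‖x‖, norm_nonneg _, by simpa using hs hx, fun y hy => ?_⟩
    exact image_eq_zero_of_notMem_tsupport fun h => not_lt.2 (hm h) hy

/-- `t ^ (n - 2)` times the spherical mean of radius `t`, as a function of `s = t²`. -/
noncomputable def sphProfile (f : EuclideanSpace ℝ (Fin n) → F) (x : EuclideanSpace ℝ (Fin n)) (s : ℝ) :
    F := √s ^ (n - 2) • sphMean f x (√s)

theorem sphProfile_eq_zero {f : EuclideanSpace ℝ (Fin n) → F} {r : ℝ}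
    (hr : ∀ y, r < ‖y‖ → f y = 0) {x : EuclideanSpace ℝ (Fin n)} {s : ℝ} (h : √s < ‖x‖ - r) :
    sphProfile f x s = 0 := by
  rw [sphProfile, sphMean_eq_zero, smul_zero]
  intro y hy
  refine hr y ?_
  rw [abs_of_nonneg (sqrt_nonneg s)] at hy
  have := norm_sub_norm_le x (x - y)
  rw [sub_sub_cancel, norm_sub_rev, hy] at this
  linarith

theorem sphProfile_eq_zero' {f : EuclideanSpace ℝ (Fin n) → F} {R : ℝ}
    (hr : ∀ y, R ≤ ‖y‖ → f y = 0) {x : EuclideanSpace ℝ (Fin n)} {s : ℝ} (h : R + ‖x‖ ≤ √s) :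
    sphProfile f x s = 0 := by
  rw [sphProfile, sphMean_eq_zero, smul_zero]
  intro y hy
  refine hr y ?_
  rw [abs_of_nonneg (sqrt_nonneg s)] at hy
  have := norm_sub_le y x
  linarith

/-- The square root is smooth only for s > 0. Near a point with s ≤ 0 the profile is identically
zero, since small spheres about a centre outside the ball of radius r miss the support. -/
theorem contDiffOn_sphProfile {f : EuclideanSpace ℝ (Fin n) → F} (hf : ContDiff ℝ ∞ f) {r : ℝ}
    (hr : ∀ y, r < ‖y‖ → f y = 0) :
    ContDiffOn ℝ ∞ (fun p : EuclideanSpace ℝ (Fin n) × ℝ => sphProfile f p.1 p.2)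
      ({x | r < ‖x‖} ×ˢ univ) := by
  rintro ⟨x, s⟩ ⟨hx, -⟩
  refine ContDiffAt.contDiffWithinAt ?_
  rcases lt_or_ge 0 s with h | h
  · have hsq : ContDiffAt ℝ ∞ (fun p : EuclideanSpace ℝ (Fin n) × ℝ => √p.2) (x, s) :=
      contDiffAt_snd.sqrt h.ne'
    refine (hsq.pow _).smul ?_
    exact (contDiff_sphMean hf).contDiffAt.comp (x, s) (contDiffAt_fst.prodMk hsq)
  · have : (fun p : EuclideanSpace ℝ (Fin n) × ℝ => sphProfile f p.1 p.2) =ᶠ[nhds (x, s)]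
        fun _ => 0 := by
      have hc : ContinuousAt (fun p : EuclideanSpace ℝ (Fin n) × ℝ => ‖p.1‖ - r - √p.2) (x, s) := by
        fun_prop
      have h0 : 0 < ‖x‖ - r - √s := by
        rw [sqrt_eq_zero'.2 h]; simpa using hx
      filter_upwards [hc.eventually (lt_mem_nhds h0)] with p hp
      exact sphProfile_eq_zero hr (by linarith)
    exact contDiffAt_const.congr_of_eventuallyEq this

/-- Iterated partial derivatives in the last variable of a jointly smooth function. -/
theorem contDiffOn_iteratedDeriv_snd {E : Type*} [NormedAddCommGroup E] [NormedSpace ℝ E]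
    {U : Set E} (hU : IsOpen U) {Φ : E → ℝ → F}
    (hΦ : ContDiffOn ℝ ∞ (fun p : E × ℝ => Φ p.1 p.2) (U ×ˢ univ)) (j : ℕ) :
    ContDiffOn ℝ ∞ (fun p : E × ℝ => iteratedDeriv j (Φ p.1) p.2) (U ×ˢ univ) := by
  have ho : IsOpen (U ×ˢ (univ : Set ℝ)) := hU.prod isOpen_univ
  induction j with
  | zero => simpa using hΦ
  | succ j ih =>
    have h1 : ContDiffOn ℝ ∞ (fun p : E × ℝ =>
        fderiv ℝ (fun p : E × ℝ => iteratedDeriv j (Φ p.1) p.2) p (0, 1)) (U ×ˢ univ) :=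
      (ih.fderiv_of_isOpen ho (by simp)).clm_apply contDiffOn_const
    refine h1.congr fun p hp => ?_
    have hd := ((ih.differentiableOn (by simp)).differentiableAt (ho.mem_nhds hp)).hasFDerivAt
    have h2 : HasDerivAt (fun s : ℝ => (p.1, s)) ((0 : E), (1 : ℝ)) p.2 :=
      (hasDerivAt_const _ _).prodMk (hasDerivAt_id _)
    have := hd.comp_hasDerivAt p.2 h2
    rw [iteratedDeriv_succ]
    exact this.deriv

theorem hasDerivAt_iteratedDeriv_of_contDiff {g : ℝ → F} (hg : ContDiff ℝ ∞ g) (j : ℕ) (s : ℝ) :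
    HasDerivAt (iteratedDeriv j g) (iteratedDeriv (j + 1) g s) s := by
  rw [iteratedDeriv_succ]
  exact ((hg.differentiable_iteratedDeriv j (by norm_cast; simp)) s).hasDerivAt

theorem iteratedDeriv_eq_zero_of_eqOn {g : ℝ → F} {V : Set ℝ} (hV : IsOpen V)
    (h : ∀ s ∈ V, g s = 0) (j : ℕ) {s : ℝ} (hs : s ∈ V) : iteratedDeriv j g s = 0 := by
  have : g =ᶠ[nhds s] fun _ => 0 := by
    filter_upwards [hV.mem_nhds hs] with x hx using h x hx
  rw [this.iteratedDeriv_eq]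
  simp

/-- Newtonian potentials with a kernel `φ (|x - y|²)`. -/
theorem laplacian_radial_potential [CompleteSpace F] (hn : 1 ≤ n) {c : ℝ} {φ : ℝ → ℝ}
    (hφ : ∀ s, 0 < s → HasDerivAt φ (c / 2 * s ^ (-(n : ℝ) / 2)) s)
    (hφm : Measurable φ)
    (hφi : ∀ T, IntegrableOn (fun r => r ^ (n - 1) * φ (r ^ 2)) (Ioo 0 T))
    (hφb : ∀ s, 0 < s → ∀ δ ∈ Ioc (0 : ℝ) 1, |φ (s + δ)| ≤ |φ s| + |φ (s + 1)|)
    {f : EuclideanSpace ℝ (Fin n) → F} (hf : ContDiff ℝ ∞ f) {R : ℝ}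
    (hs : tsupport f ⊆ ball 0 R) :
    ContDiffOn ℝ ∞ (fun x => ∫ y, φ (‖x - y‖ ^ 2) • f y) (ball 0 R) ∧
    ∀ x ∈ ball (0 : EuclideanSpace ℝ (Fin n)) R,
      Laplacian.laplacian (fun x : EuclideanSpace ℝ (Fin n) => ∫ y, φ (‖x - y‖ ^ 2) • f y) x =
        (c * (volume : Measure (EuclideanSpace ℝ (Fin n))).toSphere.real univ) • f x := by
  have : Nonempty (Fin n) := ⟨⟨0, hn⟩⟩
  -- For x in the ball and z in the support of f the difference x - z lies in K. The domain of
  -- integration is thus compact and does not move with x.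
  set K : Set (EuclideanSpace ℝ (Fin n)) := closedBall 0 (2 * R)
  have hK : IsCompact K := isCompact_closedBall _ _
  have hw : IntegrableOn (fun y : EuclideanSpace ℝ (Fin n) => φ (‖y‖ ^ 2)) K := by
    have h1 : IntegrableOn (fun y : EuclideanSpace ℝ (Fin n) => φ (‖y‖ ^ 2)) (ball 0 (2 * R + 1)) :=
      (integrableOn_fun_norm_addHaar volume (f := fun r => φ (r ^ 2))).2 (by simpa using hφi _)
    exact h1.mono_set (closedBall_subset_ball (by linarith))
  have hι : Continuous fun y : EuclideanSpace ℝ (Fin n) => -y := continuous_neg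
  have hfs : HasCompactSupport f :=
    isCompact_of_isClosed_isBounded (isClosed_tsupport f) (isBounded_ball.subset hs)
  have hzero : ∀ (g : EuclideanSpace ℝ (Fin n) → F), tsupport g ⊆ ball 0 R →
      ∀ x ∈ ball (0 : EuclideanSpace ℝ (Fin n)) R, ∀ y ∉ K, φ (‖y‖ ^ 2) • g (x + -y) = 0 :=
    fun g hg x hx y hy => by
    rw [image_eq_zero_of_notMem_tsupport (f := g), smul_zero]
    intro h
    have h1 := hg h
    rw [mem_ball_zero_iff] at h1 hx
    refine hy (mem_closedBall_zero_iff.2 ?_)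
    have := norm_sub_le x (x + -y)
    rw [show x - (x + -y) = y by abel] at this
    linarith
  have heq : EqOn (fun x => ∫ y, φ (‖x - y‖ ^ 2) • f y)
      (fun x => ∫ y in K, φ (‖y‖ ^ 2) • f (x + -y)) (ball 0 R) := fun x hx => by
    simp only
    rw [setIntegral_eq_integral_of_forall_compl_eq_zero (hzero f hs x hx),
      ← integral_sub_left_eq_self _ volume x]
    simp [sub_eq_add_neg]
  refine ⟨(contDiff_setIntegral_comp_add hK hw hι hf).contDiffOn.congr heq, fun x hx => ?_⟩
  have hev : (fun x => ∫ y, φ (‖x - y‖ ^ 2) • f y) =ᶠ[nhds x]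
      (fun x => ∫ y in K, φ (‖y‖ ^ 2) • f (x + -y)) := by
    filter_upwards [isOpen_ball.mem_nhds hx] with z hz using heq hz
  rw [(InnerProductSpace.laplacian_congr_nhds hev).eq_of_nhds,
    laplacian_setIntegral_comp_add hK hw hι hf,
    setIntegral_eq_integral_of_forall_compl_eq_zero
      (hzero _ ((tsupport_laplacian_subset hf).trans hs) x hx)]
  have hg : ContDiff ℝ ∞ fun y => f (x - y) := hf.comp (by fun_prop)
  have hgs : HasCompactSupport fun y => f (x - y) :=
    hfs.comp_homeomorph (Homeomorph.subLeft x)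
  have := integral_radial_smul_laplacian hn hφ hφm hφi hφb hg hgs
  simp only [laplacian_comp_sub hf, sub_zero] at this
  simpa only [sub_eq_add_neg] using this

end

/-! ### Kernels evaluated at squared distances: integrability and Fubini. -/

section
variable {n : ℕ}

/-- In polar coordinates r^(n-1) dr is at most T^(n-2) · 2r dr for r < T, and s = r² turns 2r dr
into ds. Local integrability of k on the line thus controls the integral over the ball; this is
where n ≥ 2 enters. -/
theorem lintegral_kernel_comp_norm_sq_le (hn : 2 ≤ n) {k : ℝ → ℝ} (hk : Measurable k) {c T L : ℝ}
    (hT : 0 ≤ T) (hL : |c| + T ^ 2 ≤ L) :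
    ∫⁻ z in ball (0 : EuclideanSpace ℝ (Fin n)) T, ‖k (c - ‖z‖ ^ 2)‖ₑ ≤
      (volume : Measure (EuclideanSpace ℝ (Fin n))).toSphere univ *
        (ENNReal.ofReal (T ^ (n - 2)) * ∫⁻ u in Icc (-L) L, ‖k u‖ₑ) := by
  have : Nonempty (Fin n) := ⟨⟨0, by omega⟩⟩
  have h1 : ∫⁻ z in ball (0 : EuclideanSpace ℝ (Fin n)) T, ‖k (c - ‖z‖ ^ 2)‖ₑ =
      ∫⁻ z : EuclideanSpace ℝ (Fin n), (Iio T).indicator (fun r => ‖k (c - r ^ 2)‖ₑ) ‖z‖ := by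
    rw [← lintegral_indicator measurableSet_ball]
    refine lintegral_congr fun z => ?_
    simp [indicator]
  have hm : Measurable fun r => ‖k (c - r ^ 2)‖ₑ := by fun_prop
  rw [h1, lintegral_radial _ (hm.indicator measurableSet_Iio)]
  gcongr
  have hsub : ∫⁻ s in Ioo 0 (T ^ 2), ‖k (c - s)‖ₑ ≤ ∫⁻ u in Icc (-L) L, ‖k u‖ₑ := by
    rw [← lintegral_indicator measurableSet_Icc, ← lintegral_indicator measurableSet_Ioo,
      ← lintegral_sub_left_eq_self ((Icc (-L) L).indicator fun u => ‖k u‖ₑ) c]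
    refine lintegral_mono fun s => ?_
    by_cases hs : s ∈ Ioo 0 (T ^ 2)
    · rw [indicator_of_mem hs, indicator_of_mem]
      have := abs_le.1 (le_refl |c|)
      exact ⟨by linarith [hs.2, hs.1], by linarith [hs.1, hs.2, sq_nonneg T]⟩
    · rw [indicator_of_notMem hs]; exact zero_le
  have hsubst : ∫⁻ s in Ioo 0 (T ^ 2), ‖k (c - s)‖ₑ =
      ∫⁻ r in Ioo 0 T, ENNReal.ofReal |2 * r| * ‖k (c - r ^ 2)‖ₑ := by
    have himg : (fun r : ℝ => r ^ 2) '' Ioo 0 T = Ioo 0 (T ^ 2) := by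
      ext s
      constructor
      · rintro ⟨r, hr, rfl⟩
        exact ⟨by have := hr.1; positivity, by have := hr.1; have := hr.2; simp only; gcongr⟩
      · intro hs
        exact ⟨√s, ⟨sqrt_pos.2 hs.1, (sqrt_lt' (lt_of_le_of_ne hT (by
          rintro rfl; simpa using hs.1.trans hs.2))).2 hs.2⟩, sq_sqrt hs.1.le⟩
    rw [← himg, lintegral_image_eq_lintegral_abs_deriv_mul measurableSet_Ioo
      (f' := fun r => 2 * r) (fun r _ => by
        simpa using (hasDerivAt_pow 2 r).hasDerivWithinAt)]
    exact fun r hr s hs h => (pow_left_inj₀ hr.1.le hs.1.le two_ne_zero).1 h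
  calc _ ≤ ENNReal.ofReal (T ^ (n - 2)) * ∫⁻ s in Ioo 0 (T ^ 2), ‖k (c - s)‖ₑ := by
        rw [hsubst, ← lintegral_const_mul _ (by fun_prop), ← lintegral_indicator measurableSet_Ioi,
          ← lintegral_indicator measurableSet_Ioo]
        refine lintegral_mono fun r => ?_
        by_cases hr : r ∈ Ioo 0 T
        · rw [indicator_of_mem hr, indicator_of_mem (show r ∈ Ioi (0 : ℝ) from hr.1),
            indicator_of_mem (show r ∈ Iio T from hr.2), ← mul_assoc,
            ← ENNReal.ofReal_mul (by positivity)]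
          gcongr
          rw [finrank_euclideanSpace_fin, abs_of_pos (by linarith [hr.1])]
          obtain ⟨j, rfl⟩ : ∃ j, n = j + 2 := ⟨n - 2, by omega⟩
          simp only [Nat.add_sub_cancel]
          rw [show j + 2 - 1 = j + 1 by omega, pow_succ]
          have hr0 := hr.1.le
          have : r ^ j ≤ T ^ j := by gcongr; exact hr.2.le
          nlinarith [pow_nonneg hr0 j, pow_nonneg hT j, mul_le_mul_of_nonneg_right this hr0,
            mul_nonneg (pow_nonneg hT j) hr0]
        · rw [indicator_of_notMem hr]
          by_cases h0 : r ∈ Ioi (0 : ℝ)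
          · rw [indicator_of_mem h0, indicator_of_notMem (fun h : r ∈ Iio T => hr ⟨h0, h⟩)]; simp
          · rw [indicator_of_notMem h0]
    _ ≤ _ := by gcongr

theorem lintegral_kernel_lt_top {k : ℝ → ℝ} (hk : LocallyIntegrable k) (L : ℝ) :
    ∫⁻ u in Icc (-L) L, ‖k u‖ₑ < ⊤ :=
  (hk.integrableOn_isCompact isCompact_Icc).2

variable {F : Type*} [NormedAddCommGroup F] [NormedSpace ℝ F]

/-- The bound depends on ξ and c only through T and L, hence is uniform over a sphere of centres.
This uniformity yields joint integrability. -/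
theorem lintegral_kernel_smul_le (hn : 2 ≤ n) {k : ℝ → ℝ} (hk : Measurable k)
    {f : EuclideanSpace ℝ (Fin n) → F} {R C : ℝ}
    (hC : ∀ y, ‖f y‖ ≤ C) (hz : ∀ y, R ≤ ‖y‖ → f y = 0)
    {ξ : EuclideanSpace ℝ (Fin n)} {c T L : ℝ} (hT : 0 ≤ T) (hRT : R + ‖ξ‖ ≤ T)
    (hL : |c| + T ^ 2 ≤ L) :
    ∫⁻ y, ‖k (c - ‖y - ξ‖ ^ 2) • f y‖ₑ ≤ ENNReal.ofReal C *
      ((volume : Measure (EuclideanSpace ℝ (Fin n))).toSphere univ *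
        (ENNReal.ofReal (T ^ (n - 2)) * ∫⁻ u in Icc (-L) L, ‖k u‖ₑ)) := by
  refine le_trans ?_ (mul_le_mul_right (lintegral_kernel_comp_norm_sq_le hn hk hT hL) _)
  rw [← lintegral_add_right_eq_self _ ξ, ← lintegral_const_mul _ (by fun_prop),
    ← lintegral_indicator measurableSet_ball]
  refine lintegral_mono fun y => ?_
  by_cases hy : y ∈ ball (0 : EuclideanSpace ℝ (Fin n)) T
  · rw [indicator_of_mem hy, add_sub_cancel_right, enorm_smul, mul_comm]
    gcongr
    rw [← ofReal_norm]
    exact ENNReal.ofReal_le_ofReal (hC _)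
  · rw [indicator_of_notMem hy, hz, smul_zero, enorm_zero]
    rw [mem_ball_zero_iff, not_lt] at hy
    have := norm_sub_le (y + ξ) ξ
    rw [add_sub_cancel_right] at this
    linarith

theorem exists_norm_bound {G : Type*} [NormedAddCommGroup G]
    {f : EuclideanSpace ℝ (Fin n) → G} (hf : Continuous f) {R : ℝ}
    (hz : ∀ y, R ≤ ‖y‖ → f y = 0) : ∃ C, ∀ y, ‖f y‖ ≤ C := by
  refine hf.bounded_above_of_compact_support ?_
  refine HasCompactSupport.intro (isCompact_closedBall (0 : EuclideanSpace ℝ (Fin n)) R) fun y hy => ?_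
  rw [mem_closedBall_zero_iff, not_le] at hy
  exact hz y hy.le

theorem integrable_kernel_smul (hn : 2 ≤ n) {k : ℝ → ℝ} (hk : Measurable k)
    (hkl : LocallyIntegrable k) {f : EuclideanSpace ℝ (Fin n) → F} (hf : Continuous f) {R : ℝ}
    (hz : ∀ y, R ≤ ‖y‖ → f y = 0) (ξ : EuclideanSpace ℝ (Fin n)) (c : ℝ) :
    Integrable fun y => k (c - ‖y - ξ‖ ^ 2) • f y := by
  obtain ⟨C, hC⟩ := exists_norm_bound hf hz
  refine ⟨?_, (lintegral_kernel_smul_le hn hk hC hz (T := |R| + ‖ξ‖) (by positivity)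
    (by gcongr; exact le_abs_self R) le_rfl).trans_lt ?_⟩
  · exact (by fun_prop : Measurable fun y : EuclideanSpace ℝ (Fin n) =>
      k (c - ‖y - ξ‖ ^ 2)).aestronglyMeasurable.smul hf.aestronglyMeasurable
  · exact ENNReal.mul_lt_top ENNReal.ofReal_lt_top (ENNReal.mul_lt_top (measure_lt_top _ _)
      (ENNReal.mul_lt_top ENNReal.ofReal_lt_top (lintegral_kernel_lt_top hkl _)))

/-- Integration of a function of the squared distance to `ξ` by means of spherical means. -/
theorem integral_kernel_smul_eq (hn : 2 ≤ n) {k : ℝ → ℝ} (hk : Measurable k)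
    (hkl : LocallyIntegrable k) {f : EuclideanSpace ℝ (Fin n) → F} (hf : Continuous f) {R : ℝ}
    (hz : ∀ y, R ≤ ‖y‖ → f y = 0) (ξ : EuclideanSpace ℝ (Fin n)) (c : ℝ) :
    ∫ y, k (c - ‖y - ξ‖ ^ 2) • f y =
      ((volume : Measure (EuclideanSpace ℝ (Fin n))).toSphere.real univ / 2) •
        ∫ s in Ioi (0 : ℝ), k (c - s) • sphProfile f ξ s := by
  have : Nonempty (Fin n) := ⟨⟨0, by omega⟩⟩
  have hσ := (toSphere_real_univ_pos (show 1 ≤ n by omega)).ne'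
  have hi := integrable_kernel_smul hn hk hkl hf hz ξ c
  rw [← integral_add_right_eq_self _ ξ, integral_eq_integral_sphere _
    (by simpa using hi.comp_add_right ξ)]
  have h2 := integral_comp_rpow_Ioi_of_pos (g := fun s => k (c - s) • sphProfile f ξ s)
    (p := 2) two_pos
  rw [← h2, ← integral_smul]
  refine setIntegral_congr_fun measurableSet_Ioi fun r hr => ?_
  have hr' : 0 < r := hr
  have hnr : ∀ θ : sphere (0 : EuclideanSpace ℝ (Fin n)) 1,
      ‖r • (θ : EuclideanSpace ℝ (Fin n)) + ξ - ξ‖ = r := fun θ => by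
    rw [add_sub_cancel_right, norm_smul, norm_eq_of_mem_sphere, mul_one, norm_of_nonneg hr'.le]
  simp only [hnr, integral_smul, rpow_two, sphProfile, sqrt_sq hr'.le, sphMean, smul_smul,
    finrank_euclideanSpace_fin]
  rw [show ((2 : ℝ) - 1) = 1 by norm_num, rpow_one]
  obtain ⟨j, rfl⟩ : ∃ j, n = j + 2 := ⟨n - 2, by omega⟩
  simp only [Nat.add_sub_cancel, show j + 2 - 1 = j + 1 by omega]
  simp only [add_comm ξ]
  congr 1
  field_simp
  ring

/-- Joint integrability over the sphere of centres and the space. -/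
theorem integrable_prod_kernel_smul (hn : 2 ≤ n) {k : ℝ → ℝ} (hk : Measurable k)
    (hkl : LocallyIntegrable k) {f : EuclideanSpace ℝ (Fin n) → F} (hf : Continuous f) {R : ℝ}
    (hR : 0 ≤ R) (hz : ∀ y, R ≤ ‖y‖ → f y = 0)
    {c : sphere (0 : EuclideanSpace ℝ (Fin n)) 1 → ℝ} (hc : Continuous c) :
    Integrable (fun p : sphere (0 : EuclideanSpace ℝ (Fin n)) 1 × EuclideanSpace ℝ (Fin n) =>
      k (c p.1 - ‖p.2 - R • (p.1 : EuclideanSpace ℝ (Fin n))‖ ^ 2) • f p.2)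
      ((volume : Measure (EuclideanSpace ℝ (Fin n))).toSphere.prod volume) := by
  obtain ⟨C, hC⟩ := exists_norm_bound hf hz
  obtain ⟨B, hB⟩ := isCompact_univ.exists_bound_of_continuousOn hc.continuousOn
  have hm : AEStronglyMeasurable
      (fun p : sphere (0 : EuclideanSpace ℝ (Fin n)) 1 × EuclideanSpace ℝ (Fin n) =>
      k (c p.1 - ‖p.2 - R • (p.1 : EuclideanSpace ℝ (Fin n))‖ ^ 2) • f p.2)
      ((volume : Measure (EuclideanSpace ℝ (Fin n))).toSphere.prod volume) := by
    have h1 : Continuous fun p : sphere (0 : EuclideanSpace ℝ (Fin n)) 1 ×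
        EuclideanSpace ℝ (Fin n) =>
        c p.1 - ‖p.2 - R • (p.1 : EuclideanSpace ℝ (Fin n))‖ ^ 2 := by fun_prop
    exact (hk.comp h1.measurable).aestronglyMeasurable.smul
      (hf.comp continuous_snd).aestronglyMeasurable
  refine ⟨hm, ?_⟩
  rw [HasFiniteIntegral, lintegral_prod _ hm.enorm]
  have hb : ∀ θ : sphere (0 : EuclideanSpace ℝ (Fin n)) 1,
      ∫⁻ y, ‖k (c θ - ‖y - R • (θ : EuclideanSpace ℝ (Fin n))‖ ^ 2) • f y‖ₑ ≤
      ENNReal.ofReal C *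
      ((volume : Measure (EuclideanSpace ℝ (Fin n))).toSphere univ *
        (ENNReal.ofReal ((R + R) ^ (n - 2)) *
          ∫⁻ u in Icc (-(B + (R + R) ^ 2)) (B + (R + R) ^ 2), ‖k u‖ₑ)) := fun θ => by
    refine lintegral_kernel_smul_le hn hk hC hz (by positivity) ?_ ?_
    · rw [norm_smul, norm_eq_of_mem_sphere, mul_one, norm_of_nonneg hR]
    · have := hB θ (mem_univ _)
      rw [norm_eq_abs] at this
      linarith
  refine (lintegral_mono hb).trans_lt ?_
  rw [lintegral_const]
  exact ENNReal.mul_lt_top (ENNReal.mul_lt_top ENNReal.ofReal_lt_top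
    (ENNReal.mul_lt_top (measure_lt_top _ _)
      (ENNReal.mul_lt_top ENNReal.ofReal_lt_top (lintegral_kernel_lt_top hkl _))))
    (measure_lt_top _ _)

end

open Polynomial in
/-- The average of a backprojection kernel over the sphere of centres. -/
theorem integral_sphere_kernel {m : ℕ} (hm : 1 ≤ m) {k lam : ℝ → ℝ} {Q : ℝ[X]}
    (hk : IsBackprojectionKernel (m - 1) k lam Q) {R : ℝ} (hR : 0 < R) (ε : ℝ)
    {x y : EuclideanSpace ℝ (Fin (m + 1))} (hxy : x ≠ y) :
    ∫ θ : sphere (0 : EuclideanSpace ℝ (Fin (m + 1))) 1,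
      k (‖x - R • (θ : EuclideanSpace ℝ (Fin (m + 1)))‖ ^ 2 + ε -
        ‖y - R • (θ : EuclideanSpace ℝ (Fin (m + 1)))‖ ^ 2)
      ∂(volume : Measure (EuclideanSpace ℝ (Fin (m + 1)))).toSphere =
    (volume : Measure (EuclideanSpace ℝ (Fin m))).toSphere.real univ *
      (lam (2 * R * ‖x - y‖) * (∫ β in (0 : ℝ)..π, sin β ^ (m - 1)) +
        ∫ β in (0 : ℝ)..π, sin β ^ (m - 1) *
          k ((‖x‖ ^ 2 - ‖y‖ ^ 2 + ε) / (2 * R * ‖x - y‖) - cos β)) := by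
  have hd : 0 < ‖x - y‖ := norm_pos_iff.2 (sub_ne_zero.2 hxy)
  set b := 2 * R * ‖x - y‖ with hb
  have hb0 : 0 < b := by positivity
  set e := ‖x - y‖⁻¹ • (x - y) with he
  have he1 : ‖e‖ = 1 := by
    rw [he, norm_smul, norm_inv, norm_norm, inv_mul_cancel₀ hd.ne']
  set z := (‖x‖ ^ 2 - ‖y‖ ^ 2 + ε) / b with hz
  -- The terms R² of the two squared distances cancel, so the argument of k is affine in θ.
  have h1 : ∀ θ : sphere (0 : EuclideanSpace ℝ (Fin (m + 1))) 1,
      k (‖x - R • (θ : EuclideanSpace ℝ (Fin (m + 1)))‖ ^ 2 + ε -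
        ‖y - R • (θ : EuclideanSpace ℝ (Fin (m + 1)))‖ ^ 2) =
      k (b * (z - inner ℝ e (θ : EuclideanSpace ℝ (Fin (m + 1))))) := fun θ => by
    congr 1
    rw [norm_sub_sq_real, norm_sub_sq_real, mul_sub, hz, mul_div_cancel₀ _ hb0.ne', he,
      inner_smul_left, inner_sub_left, inner_smul_right, inner_smul_right, hb]
    simp only [conj_trivial]
    field_simp
    ring
  simp_rw [h1]
  rw [integral_sphere_inner hm he1 (φ := fun s => k (b * (z - s)))
    (hk.measurable.comp (by fun_prop))]
  congr 1
  have hi1 : IntervalIntegrable (fun β : ℝ => lam b * sin β ^ (m - 1)) volume 0 π :=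
    Continuous.intervalIntegrable (by fun_prop) _ _
  have hi2 : IntervalIntegrable (fun β : ℝ => sin β ^ (m - 1) * k (z - cos β)) volume 0 π :=
    (hk.intervalIntegrable z).continuousOn_mul (by fun_prop)
  rw [← intervalIntegral.integral_const_mul, ← intervalIntegral.integral_add hi1 hi2]
  refine intervalIntegral.integral_congr_ae ?_
  -- The scaling rule is not available at the zero of z - cos β; in [0, π] this is at most one
  -- angle.
  have : ∀ᵐ β : ℝ, β ≠ arccos z := by simp [ae_iff]
  filter_upwards [this] with β h2 h3
  rw [uIoc_of_le pi_pos.le] at h3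
  rw [hk.scaling b hb0 _ fun h => h2 ?_]
  · ring
  · rw [sub_eq_zero.1 h, arccos_cos h3.1.le h3.2]

/-! ### Taylor coefficients and the shifted backprojection. -/

section
variable {F : Type*} [NormedAddCommGroup F] [NormedSpace ℝ F]

/-- The limit at zero forces the constant coefficient to vanish; then one factor ε can be divided
out, and induction applies. -/
theorem eq_zero_of_sum_pow_smul_isLittleO (N : ℕ) (c : ℕ → F)
    (h : (fun ε : ℝ => ∑ i ∈ Finset.range (N + 1), ε ^ i • c i) =o[nhdsWithin 0 {0}ᶜ]
      fun ε => ε ^ N) : c N = 0 := by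
  induction N generalizing c with
  | zero =>
    simp only [zero_add, Finset.range_one, Finset.sum_singleton, pow_zero, one_smul,
      Asymptotics.isLittleO_one_iff] at h
    exact tendsto_nhds_unique tendsto_const_nhds h
  | succ N ih =>
    have e : ∀ ε : ℝ, ∑ i ∈ Finset.range (N + 1 + 1), ε ^ i • c i =
        ε • (∑ i ∈ Finset.range (N + 1), ε ^ i • c (i + 1)) + c 0 := fun ε => by
      rw [Finset.sum_range_succ', Finset.smul_sum]
      simp [pow_succ', mul_smul]
    have hc : Continuous fun ε : ℝ => ∑ i ∈ Finset.range (N + 1), ε ^ i • c (i + 1) := by fun_prop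
    have h0 : c 0 = 0 := by
      have t1 : Filter.Tendsto (fun ε : ℝ => ∑ i ∈ Finset.range (N + 1 + 1), ε ^ i • c i)
          (nhdsWithin 0 {0}ᶜ) (nhds (c 0)) := by
        simp_rw [e]
        have : Continuous fun ε : ℝ =>
          ε • (∑ i ∈ Finset.range (N + 1), ε ^ i • c (i + 1)) + c 0 := by fun_prop
        have := this.tendsto 0
        simp only [zero_smul, zero_add] at this
        exact this.mono_left nhdsWithin_le_nhds
      have t2 : Filter.Tendsto (fun ε : ℝ => ε ^ (N + 1)) (nhdsWithin 0 {0}ᶜ) (nhds 0) := by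
        have := (continuous_pow (M := ℝ) (N + 1)).tendsto 0
        simp only [ne_eq, Nat.add_eq_zero_iff, one_ne_zero, and_false, not_false_eq_true,
          zero_pow] at this
        exact this.mono_left nhdsWithin_le_nhds
      exact tendsto_nhds_unique t1 (h.trans_tendsto t2)
    refine ih (fun i => c (i + 1)) ?_
    simp_rw [e, h0, add_zero] at h
    rw [Asymptotics.isLittleO_iff] at h ⊢
    intro η hη
    filter_upwards [h hη, self_mem_nhdsWithin] with ε h1 h2
    have hε : 0 < ‖ε‖ := norm_pos_iff.2 h2
    rw [norm_smul, pow_succ', norm_mul] at h1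
    refine le_of_mul_le_mul_left ?_ hε
    linarith

/-- The Taylor coefficients of a smooth function are determined by any polynomial expansion. -/
theorem iteratedDeriv_eq_of_expansion {J : ℝ → F} (hJ : ContDiff ℝ ∞ J) (N : ℕ) (c : ℕ → F) {C : ℝ}
    (h : ∀ ε : ℝ, |ε| ≤ 1 →
      ‖J ε - ∑ i ∈ Finset.range (N + 1), ε ^ i • c i‖ ≤ C * |ε| ^ (N + 1)) :
    iteratedDeriv N J 0 = (N.factorial : ℝ) • c N := by
  have h1 := taylor_isLittleO_univ (x₀ := 0) (n := N) (hJ.of_le (by norm_cast; simp))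
  simp only [sub_zero] at h1
  have h2 : (fun ε => J ε - ∑ i ∈ Finset.range (N + 1), ε ^ i • c i) =o[nhds 0]
      fun ε : ℝ => ε ^ N := by
    have : (fun ε => J ε - ∑ i ∈ Finset.range (N + 1), ε ^ i • c i) =O[nhds 0]
        fun ε : ℝ => ε ^ (N + 1) := by
      refine Asymptotics.IsBigO.of_bound C ?_
      filter_upwards [closedBall_mem_nhds (0 : ℝ) one_pos] with ε hε
      rw [norm_pow, norm_eq_abs]
      exact h ε (by simpa using hε)
    refine this.trans_isLittleO ?_
    exact Asymptotics.isLittleO_pow_pow (Nat.lt_succ_self N)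
  have h3 := (h2.sub h1).mono (nhdsWithin_le_nhds (s := {0}ᶜ))
  have h4 := eq_zero_of_sum_pow_smul_isLittleO N
    (fun i => ((i.factorial : ℝ)⁻¹) • iteratedDeriv i J 0 - c i) (by
      refine h3.congr' ?_ (by rfl)
      refine .of_forall fun ε => ?_
      simp only [taylor_within_apply, sub_zero, iteratedDerivWithin_univ, sub_sub_sub_cancel_left]
      rw [← Finset.sum_sub_distrib]
      refine Finset.sum_congr rfl fun i _ => ?_
      rw [smul_sub, smul_smul, mul_comm])
  rw [sub_eq_zero] at h4
  rw [← h4, smul_smul, mul_inv_cancel₀ (by positivity), one_smul]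

theorem integrableOn_smul_of_continuousOn {X : Type*} [TopologicalSpace X] [T2Space X]
    [MeasurableSpace X] [OpensMeasurableSpace X] {μ : Measure X} {K : Set X} (hK : IsCompact K)
    {w : X → ℝ} (hw : IntegrableOn w K μ) {Φ : X → F} (hΦ : ContinuousOn Φ K) :
    IntegrableOn (fun y => w y • Φ y) K μ := by
  obtain ⟨C, hC⟩ := hK.exists_bound_of_continuousOn hΦ
  exact Integrable.smul_bdd hw C (hΦ.aestronglyMeasurable_of_isCompact hK hK.isClosed.measurableSet)
    ((ae_restrict_iff' hK.isClosed.measurableSet).2 (.of_forall hC))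

/-- The backprojection with a kernel `k`, shifted by `ε`. -/
noncomputable def shiftedBackprojection {n : ℕ} (k : ℝ → ℝ)
    (G : sphere (0 : EuclideanSpace ℝ (Fin n)) 1 → ℝ → F)
    (p : sphere (0 : EuclideanSpace ℝ (Fin n)) 1 → ℝ) (T ε : ℝ) : F :=
  ∫ q in univ ×ˢ Icc (-T) T, k q.2 • G q.1 (p q.1 + ε - q.2)
    ∂((volume : Measure (EuclideanSpace ℝ (Fin n))).toSphere.prod volume)

variable {n : ℕ} {k : ℝ → ℝ} {G : sphere (0 : EuclideanSpace ℝ (Fin n)) 1 → ℝ → F}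
  {p : sphere (0 : EuclideanSpace ℝ (Fin n)) 1 → ℝ}

theorem integrableOn_kernel_snd (hk : LocallyIntegrable k) (T : ℝ) :
    IntegrableOn (fun q : sphere (0 : EuclideanSpace ℝ (Fin n)) 1 × ℝ => k q.2)
      (univ ×ˢ Icc (-T) T)
      ((volume : Measure (EuclideanSpace ℝ (Fin n))).toSphere.prod volume) := by
  rw [IntegrableOn, ← Measure.prod_restrict, Measure.restrict_univ]
  exact Integrable.comp_snd (hk.integrableOn_isCompact isCompact_Icc) _

/-- The shift ε has been moved by a change of variable from the kernel into G. Hence only the smooth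
profiles are differentiated, never the singular k. -/
theorem contDiff_shiftedBackprojection (hk : LocallyIntegrable k) (hp : Continuous p)
    (hG : ∀ θ, ContDiff ℝ ∞ (G θ))
    (hGc : ∀ j, Continuous fun q : sphere (0 : EuclideanSpace ℝ (Fin n)) 1 × ℝ =>
      iteratedDeriv j (G q.1) q.2) (T : ℝ) :
    ContDiff ℝ ∞ (shiftedBackprojection k G p T) ∧
    ∀ j, iteratedDeriv j (shiftedBackprojection k G p T) =
      shiftedBackprojection k (fun θ => iteratedDeriv j (G θ)) p T := by
  have hK : IsCompact ((univ : Set (sphere (0 : EuclideanSpace ℝ (Fin n)) 1)) ×ˢ Icc (-T) T) :=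
    isCompact_univ.prod isCompact_Icc
  have hd : ∀ j ε, HasDerivAt (shiftedBackprojection k (fun θ => iteratedDeriv j (G θ)) p T)
      (shiftedBackprojection k (fun θ => iteratedDeriv (j + 1) (G θ)) p T ε) ε := fun j ε => by
    have hcont : ∀ j, Continuous fun z : ℝ × (sphere (0 : EuclideanSpace ℝ (Fin n)) 1 × ℝ) =>
        iteratedDeriv j (G z.2.1) (p z.2.1 + z.1 - z.2.2) := fun j =>
      (hGc j).comp (by fun_prop : Continuous
        fun z : ℝ × (sphere (0 : EuclideanSpace ℝ (Fin n)) 1 × ℝ) =>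
          (z.2.1, p z.2.1 + z.1 - z.2.2))
    refine hasDerivAt_setIntegral_smul
      (Φ := fun ε q => iteratedDeriv j (G q.1) (p q.1 + ε - q.2))
      (Φ' := fun ε q => iteratedDeriv (j + 1) (G q.1) (p q.1 + ε - q.2)) hK
      (integrableOn_kernel_snd hk T) isOpen_univ (hcont j).continuousOn (hcont (j + 1)).continuousOn
      (fun δ _ q _ => ?_) (mem_univ ε)
    have h1 := hasDerivAt_iteratedDeriv_of_contDiff (hG q.1) j (p q.1 + δ - q.2)
    have h2 : HasDerivAt (fun δ => p q.1 + δ - q.2) 1 δ :=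
      ((hasDerivAt_id δ).const_add _).sub_const _
    have h3 := h1.scomp δ h2
    rw [one_smul] at h3
    exact h3
  have hit : ∀ j, iteratedDeriv j (shiftedBackprojection k G p T) =
      shiftedBackprojection k (fun θ => iteratedDeriv j (G θ)) p T := fun j => by
    induction j with
    | zero => simp
    | succ j ih =>
      rw [iteratedDeriv_succ, ih]
      funext ε
      exact (hd j ε).deriv
  refine ⟨contDiff_of_differentiable_iteratedDeriv fun j _ => ?_, hit⟩
  rw [hit]
  exact fun ε => (hd j ε).differentiableAt

/-- The substitution of p θ + ε - s for the integration variable returns the shift to the kernel.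
The hypothesis on G says that the truncation to [-T, T] loses nothing. -/
theorem shiftedBackprojection_eq [CompleteSpace F] (hk : LocallyIntegrable k) (hp : Continuous p)
    (hGc : Continuous fun q : sphere (0 : EuclideanSpace ℝ (Fin n)) 1 × ℝ => G q.1 q.2) {T ε : ℝ}
    (hz : ∀ θ s, T < |p θ + ε - s| → G θ s = 0) :
    Integrable (fun θ => ∫ s, k (p θ + ε - s) • G θ s)
      (volume : Measure (EuclideanSpace ℝ (Fin n))).toSphere ∧
    shiftedBackprojection k G p T ε =
      ∫ θ, (∫ s, k (p θ + ε - s) • G θ s)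
        ∂(volume : Measure (EuclideanSpace ℝ (Fin n))).toSphere := by
  have hK : IsCompact ((univ : Set (sphere (0 : EuclideanSpace ℝ (Fin n)) 1)) ×ˢ Icc (-T) T) :=
    isCompact_univ.prod isCompact_Icc
  have hi : IntegrableOn (fun q : sphere (0 : EuclideanSpace ℝ (Fin n)) 1 × ℝ =>
      k q.2 • G q.1 (p q.1 + ε - q.2)) (univ ×ˢ Icc (-T) T)
      ((volume : Measure (EuclideanSpace ℝ (Fin n))).toSphere.prod volume) := by
    refine integrableOn_smul_of_continuousOn hK (integrableOn_kernel_snd hk T) ?_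
    exact (hGc.comp (by fun_prop : Continuous
        fun q : sphere (0 : EuclideanSpace ℝ (Fin n)) 1 × ℝ =>
          (q.1, p q.1 + ε - q.2))).continuousOn
  have heq : ∀ θ, ∫ τ in Icc (-T) T, k τ • G θ (p θ + ε - τ) = ∫ s, k (p θ + ε - s) • G θ s :=
    fun θ => by
    rw [setIntegral_eq_integral_of_forall_compl_eq_zero,
      ← integral_sub_left_eq_self _ volume (p θ + ε)]
    · simp
    · intro τ hτ
      rw [hz θ _ ?_, smul_zero]
      rw [sub_sub_cancel]
      by_contra h
      exact hτ (abs_le.1 (not_lt.1 h))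
  have hi' := hi
  rw [IntegrableOn, ← Measure.prod_restrict, Measure.restrict_univ] at hi'
  refine ⟨hi'.integral_prod_left.congr (.of_forall heq), ?_⟩
  rw [shiftedBackprojection, setIntegral_prod _ hi, Measure.restrict_univ]
  exact integral_congr_ae (.of_forall heq)

end

/-! ### Expansion of the backprojection in the shift. -/

section
variable {F : Type*} [NormedAddCommGroup F] [NormedSpace ℝ F] {n : ℕ}

theorem integrable_radial_smul (hn : 1 ≤ n) {W : ℝ → ℝ} (hW : Measurable W)
    (hWi : ∀ T, IntegrableOn (fun r => r ^ (n - 1) * W r) (Ioo 0 T))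
    {f : EuclideanSpace ℝ (Fin n) → F} (hf : Continuous f) {R : ℝ}
    (hz : ∀ y, R ≤ ‖y‖ → f y = 0) (x : EuclideanSpace ℝ (Fin n)) :
    Integrable fun y => W ‖x - y‖ • f y := by
  obtain ⟨C, hC⟩ := exists_norm_bound hf hz
  have h : Integrable fun y => W ‖y‖ • f (x - y) := by
    refine integrable_of_bound_on_ball (φ := W) (T := R + ‖x‖) (C := C) hn ?_ (hWi _)
      (fun y hy => ?_) (fun y _ => ?_)
    · exact (hW.comp measurable_norm).aestronglyMeasurable.smul
        (hf.comp (by fun_prop)).aestronglyMeasurable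
    · rw [hz, smul_zero]
      have := norm_sub_norm_le y x
      rw [norm_sub_rev] at this
      linarith
    · rw [norm_smul, mul_comm, norm_eq_abs]
      gcongr
      exact hC _
  have h2 := h.comp_sub_left x
  simpa using h2

open Polynomial in
theorem eval_add_eq_sum_hasseDeriv {Q : ℝ[X]} {N : ℕ} (hQ : Q.natDegree ≤ N) (z h : ℝ) :
    Q.eval (z + h) = ∑ i ∈ Finset.range (N + 1), h ^ i * (hasseDeriv i Q).eval z := by
  rw [add_comm, ← taylor_eval, eval_eq_sum_range' (n := N + 1)
    (by rw [natDegree_taylor]; omega)]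
  refine Finset.sum_congr rfl fun i _ => ?_
  rw [taylor_coeff, mul_comm]

-- For |z| ≥ 1 a polynomial of degree at most N is itself O(|z|^(N+1)). Replacing the average by Q
-- therefore costs no more than the bound on the average.
open Polynomial in
theorem IsBackprojectionKernel.exists_error_bound {N : ℕ} {k lam : ℝ → ℝ} {Q : ℝ[X]}
    (hk : IsBackprojectionKernel N k lam Q) : ∃ C, 0 ≤ C ∧ ∀ z,
      (|z| < 1 → ∫ β in (0 : ℝ)..π, sin β ^ N * k (z - cos β) = Q.eval z) ∧
      (1 ≤ |z| → |(∫ β in (0 : ℝ)..π, sin β ^ N * k (z - cos β)) - Q.eval z| ≤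
        C * |z| ^ (N + 1)) := by
  obtain ⟨C, hC, h⟩ := hk.outer
  refine ⟨C + ∑ i ∈ Finset.range (N + 1), |Q.coeff i|, by positivity, fun z =>
    ⟨hk.inner z, fun hz => (abs_sub _ _).trans ?_⟩⟩
  rw [add_mul]
  refine add_le_add (h z hz) ?_
  rw [eval_eq_sum_range' (n := N + 1) (by have := hk.natDegree_le; omega), Finset.sum_mul]
  refine (Finset.abs_sum_le_sum_abs _ _).trans (Finset.sum_le_sum fun i hi => ?_)
  rw [abs_mul, abs_pow]
  gcongr
  exact (Finset.mem_range.1 hi).le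

/-- For a fixed centre the integral in s is an integral of f over space. Exchanging it with the
integral over centres leaves an average over the sphere for each y, valid off the null set y = x. -/
theorem integral_integral_kernel [CompleteSpace F] {m : ℕ} (hm : 1 ≤ m) {k lam : ℝ → ℝ}
    {Q : Polynomial ℝ} (hk : IsBackprojectionKernel (m - 1) k lam Q) {R : ℝ} (hR : 0 < R)
    {f : EuclideanSpace ℝ (Fin (m + 1)) → F} (hf : Continuous f) {r : ℝ} (hrR : r < R)
    (hr : ∀ y, r < ‖y‖ → f y = 0)
    (x : EuclideanSpace ℝ (Fin (m + 1))) (ε : ℝ) :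
    Integrable (fun y => (lam (2 * R * ‖x - y‖) * (∫ β in (0 : ℝ)..π, sin β ^ (m - 1)) +
        ∫ β in (0 : ℝ)..π, sin β ^ (m - 1) *
          k ((‖x‖ ^ 2 - ‖y‖ ^ 2 + ε) / (2 * R * ‖x - y‖) - cos β)) • f y) ∧
    ∫ θ, (∫ s, k (‖x - R • (θ : EuclideanSpace ℝ (Fin (m + 1)))‖ ^ 2 + ε - s) •
        sphProfile f (R • (θ : EuclideanSpace ℝ (Fin (m + 1)))) s)
        ∂(volume : Measure (EuclideanSpace ℝ (Fin (m + 1)))).toSphere =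
      (2 / (volume : Measure (EuclideanSpace ℝ (Fin (m + 1)))).toSphere.real univ *
        (volume : Measure (EuclideanSpace ℝ (Fin m))).toSphere.real univ) •
      ∫ y, (lam (2 * R * ‖x - y‖) * (∫ β in (0 : ℝ)..π, sin β ^ (m - 1)) +
        ∫ β in (0 : ℝ)..π, sin β ^ (m - 1) *
          k ((‖x‖ ^ 2 - ‖y‖ ^ 2 + ε) / (2 * R * ‖x - y‖) - cos β)) • f y := by
  have hz : ∀ y, R ≤ ‖y‖ → f y = 0 := fun y hy => hr y (hrR.trans_le hy)
  have hσ := (toSphere_real_univ_pos (show 1 ≤ m + 1 by omega)).ne'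
  have hσ' := (toSphere_real_univ_pos hm).ne'
  have hP := integrable_prod_kernel_smul (show 2 ≤ m + 1 by omega) hk.measurable
    hk.locallyIntegrable hf hR.le hz
    (c := fun θ => ‖x - R • (θ : EuclideanSpace ℝ (Fin (m + 1)))‖ ^ 2 + ε) (by fun_prop)
  have hae : ∀ᵐ y : EuclideanSpace ℝ (Fin (m + 1)), x ≠ y := by
    rw [ae_iff]
    have : {a : EuclideanSpace ℝ (Fin (m + 1)) | ¬x ≠ a} = {x} := by ext; simp [eq_comm]
    rw [this, measure_singleton]
  have hcongr : (fun y => ∫ θ : sphere (0 : EuclideanSpace ℝ (Fin (m + 1))) 1,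
      k (‖x - R • (θ : EuclideanSpace ℝ (Fin (m + 1)))‖ ^ 2 + ε -
        ‖y - R • (θ : EuclideanSpace ℝ (Fin (m + 1)))‖ ^ 2) • f y
      ∂(volume : Measure (EuclideanSpace ℝ (Fin (m + 1)))).toSphere) =ᵐ[volume]
      fun y => (volume : Measure (EuclideanSpace ℝ (Fin m))).toSphere.real univ •
        ((lam (2 * R * ‖x - y‖) * (∫ β in (0 : ℝ)..π, sin β ^ (m - 1)) +
        ∫ β in (0 : ℝ)..π, sin β ^ (m - 1) *
          k ((‖x‖ ^ 2 - ‖y‖ ^ 2 + ε) / (2 * R * ‖x - y‖) - cos β)) • f y) := by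
    filter_upwards [hae] with y hy
    rw [integral_smul_const, integral_sphere_kernel hm hk hR ε hy, smul_smul]
  constructor
  · have h1 := hP.integral_prod_right.congr hcongr
    exact (integrable_smul_iff hσ' _).1 h1
  · have h2 : ∀ θ : sphere (0 : EuclideanSpace ℝ (Fin (m + 1))) 1,
        ∫ s, k (‖x - R • (θ : EuclideanSpace ℝ (Fin (m + 1)))‖ ^ 2 + ε - s) •
        sphProfile f (R • (θ : EuclideanSpace ℝ (Fin (m + 1)))) s =
        (2 / (volume : Measure (EuclideanSpace ℝ (Fin (m + 1)))).toSphere.real univ) •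
        ∫ y, k (‖x - R • (θ : EuclideanSpace ℝ (Fin (m + 1)))‖ ^ 2 + ε -
          ‖y - R • (θ : EuclideanSpace ℝ (Fin (m + 1)))‖ ^ 2) • f y := fun θ => by
      rw [integral_kernel_smul_eq (show 2 ≤ m + 1 by omega) hk.measurable hk.locallyIntegrable
        hf hz, smul_smul, div_mul_div_cancel₀ hσ, div_self two_ne_zero, one_smul,
        setIntegral_eq_integral_of_forall_compl_eq_zero]
      intro s hs
      rw [sphProfile_eq_zero hr, smul_zero]
      rw [sqrt_eq_zero_of_nonpos (not_lt.1 hs), norm_smul, norm_eq_of_mem_sphere,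
        norm_of_nonneg hR.le]
      linarith
    simp_rw [h2]
    rw [integral_smul, mul_smul, integral_integral_swap hP, integral_congr_ae hcongr, integral_smul]

end

section
variable {F : Type*} [NormedAddCommGroup F] [NormedSpace ℝ F] {n : ℕ}

theorem pow_mul_inv_pow_le {m i : ℕ} (hi : i ≤ m) (r : ℝ) (hr : 0 < r) :
    r ^ m * (r ^ i)⁻¹ = r ^ (m - i) := by
  rw [← div_eq_mul_inv, pow_sub₀ _ hr.ne' hi, div_eq_mul_inv]

theorem integrable_inv_pow_smul {m i : ℕ} (hi : i ≤ m)
    {f : EuclideanSpace ℝ (Fin (m + 1)) → F} (hf : Continuous f) {R : ℝ}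
    (hz : ∀ y, R ≤ ‖y‖ → f y = 0) (x : EuclideanSpace ℝ (Fin (m + 1))) :
    Integrable fun y => (‖x - y‖ ^ i)⁻¹ • f y := by
  refine integrable_radial_smul (W := fun r => (r ^ i)⁻¹) (by omega) (by fun_prop) (fun T => ?_)
    hf hz x
  have : IntegrableOn (fun r : ℝ => r ^ (m - i)) (Ioo 0 T) :=
    ((continuous_pow (m - i)).integrableOn_Icc (a := 0) (b := T)).mono_set Ioo_subset_Icc_self
  exact this.congr_fun (fun r hr => by simp [pow_mul_inv_pow_le hi r hr.1]) measurableSet_Ioo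

/-- Since ||x|² - |y|²| ≤ (|x| + R)|x-y|, the quotient without ε stays below 1 by a margin
proportional to R - |x|. Reaching |z| ≥ 1 needs |ε| ≥ (R - |x|)|x-y|, and then |z| itself is at most
a multiple of |ε|/|x-y|. -/
theorem abs_div_le_of_ne_zero {E : Type*} [NormedAddCommGroup E] {x y : E} {R ε : ℝ} (hR : 0 < R)
    (hx : ‖x‖ < R) (hy : ‖y‖ < R) :
    (|‖x‖ ^ 2 - ‖y‖ ^ 2| ≤ 2 * R * ‖x - y‖) ∧
    (x ≠ y → 1 ≤ |(‖x‖ ^ 2 - ‖y‖ ^ 2 + ε) / (2 * R * ‖x - y‖)| →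
      |(‖x‖ ^ 2 - ‖y‖ ^ 2 + ε) / (2 * R * ‖x - y‖)| ≤
        ((R - ‖x‖)⁻¹ + (2 * R)⁻¹) * (|ε| * ‖x - y‖⁻¹)) := by
  have h0 : |‖x‖ ^ 2 - ‖y‖ ^ 2| ≤ (‖x‖ + R) * ‖x - y‖ := by
    rw [sq_sub_sq, abs_mul, abs_of_nonneg (by positivity)]
    gcongr
    exact abs_norm_sub_norm_le x y
  refine ⟨h0.trans (by gcongr; linarith), fun hxy h1 => ?_⟩
  have hd : 0 < ‖x - y‖ := norm_pos_iff.2 (sub_ne_zero.2 hxy)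
  have hb : 0 < 2 * R * ‖x - y‖ := by positivity
  have hRx : 0 < R - ‖x‖ := sub_pos.2 hx
  rw [abs_div, abs_of_pos hb] at h1 ⊢
  rw [one_le_div hb] at h1
  have h2 : |‖x‖ ^ 2 - ‖y‖ ^ 2 + ε| ≤ |‖x‖ ^ 2 - ‖y‖ ^ 2| + |ε| := abs_add_le _ _
  have h3 : (R - ‖x‖) * ‖x - y‖ ≤ |ε| := by linarith
  have h4 : 1 ≤ (R - ‖x‖)⁻¹ * (|ε| * ‖x - y‖⁻¹) := by
    rw [← div_eq_mul_inv, inv_mul_eq_div, le_div_iff₀ hRx, one_mul, le_div_iff₀ hd]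
    exact h3
  have h5 : |‖x‖ ^ 2 - ‖y‖ ^ 2 + ε| / (2 * R * ‖x - y‖) ≤ 1 + (2 * R)⁻¹ * (|ε| * ‖x - y‖⁻¹) := by
    rw [div_le_iff₀ hb]
    have : (1 + (2 * R)⁻¹ * (|ε| * ‖x - y‖⁻¹)) * (2 * R * ‖x - y‖) = 2 * R * ‖x - y‖ + |ε| := by
      field_simp
    rw [this]
    have : (‖x‖ + R) * ‖x - y‖ ≤ 2 * R * ‖x - y‖ := by gcongr; linarith
    linarith
  linarith

open Polynomial in
theorem hasseDeriv_natDegree_le {Q : ℝ[X]} {N : ℕ} (hQ : Q.natDegree ≤ N) :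
    hasseDeriv N Q = C (Q.coeff N) := by
  ext i
  rw [hasseDeriv_coeff, coeff_C]
  rcases eq_or_ne i 0 with rfl | hi
  · simp
  · rw [if_neg hi, coeff_eq_zero_of_natDegree_lt (by omega), mul_zero]

/-- The expansion in powers of `ε` of the backprojection with a shifted kernel. -/
theorem exists_backprojection_expansion [CompleteSpace F] {m : ℕ} (hm : 1 ≤ m) {k lam : ℝ → ℝ}
    {Q : Polynomial ℝ} (hk : IsBackprojectionKernel (m - 1) k lam Q) (hlm : Measurable lam)
    {R : ℝ} (hR : 0 < R)
    {f : EuclideanSpace ℝ (Fin (m + 1)) → F} (hf : Continuous f) {r : ℝ} (hrR : r < R)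
    (hr : ∀ y, r < ‖y‖ → f y = 0)
    {x : EuclideanSpace ℝ (Fin (m + 1))} (hx : x ∈ ball (0 : EuclideanSpace ℝ (Fin (m + 1))) R) :
    ∃ C : ℝ, ∀ ε : ℝ, ‖(∫ y, (lam (2 * R * ‖x - y‖) * (∫ β in (0 : ℝ)..π, sin β ^ (m - 1)) +
        ∫ β in (0 : ℝ)..π, sin β ^ (m - 1) *
          k ((‖x‖ ^ 2 - ‖y‖ ^ 2 + ε) / (2 * R * ‖x - y‖) - cos β)) • f y) -
      ∑ i ∈ Finset.range (m - 1 + 1), ε ^ i •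
        ∫ y, ((if i = 0 then lam (2 * R * ‖x - y‖) * (∫ β in (0 : ℝ)..π, sin β ^ (m - 1)) else 0) +
          (Polynomial.hasseDeriv i Q).eval ((‖x‖ ^ 2 - ‖y‖ ^ 2) / (2 * R * ‖x - y‖)) *
            ((2 * R * ‖x - y‖) ^ i)⁻¹) • f y‖ ≤ C * |ε| ^ (m - 1 + 1) := by
  have hz : ∀ y, R ≤ ‖y‖ → f y = 0 := fun y hy => hr y (hrR.trans_le hy)
  have hx' : ‖x‖ < R := mem_ball_zero_iff.1 hx
  obtain ⟨C, hC, hE⟩ := hk.exists_error_bound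
  have hlam : Integrable fun y => lam (2 * R * ‖x - y‖) • f y := by
    refine integrable_radial_smul (W := fun r => lam (2 * R * r)) (by omega) (by fun_prop)
      (fun T => ?_) hf hz x
    rcases le_or_gt T 0 with hT | hT
    · simp [Ioo_eq_empty_of_le hT]
    have h1 := (hk.lam_intervalIntegrable (2 * R * T)).comp_mul_left (c := 2 * R)
    rw [zero_div, mul_div_cancel_left₀ _ (by positivity)] at h1
    have h2 := h1.continuousOn_mul (continuous_pow (m + 1 - 1)).continuousOn
    rw [intervalIntegrable_iff_integrableOn_Ioo_of_le hT.le] at h2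
    exact h2
  have hterm : ∀ i ∈ Finset.range (m - 1 + 1), Integrable fun y =>
      ((if i = 0 then lam (2 * R * ‖x - y‖) * (∫ β in (0 : ℝ)..π, sin β ^ (m - 1)) else 0) +
          (Polynomial.hasseDeriv i Q).eval ((‖x‖ ^ 2 - ‖y‖ ^ 2) / (2 * R * ‖x - y‖)) *
            ((2 * R * ‖x - y‖) ^ i)⁻¹) • f y := fun i hi => by
    have hi' : i ≤ m := by have := Finset.mem_range.1 hi; omega
    simp_rw [add_smul]
    refine Integrable.add ?_ ?_
    · split_ifs
      · refine (hlam.smul (∫ β in (0 : ℝ)..π, sin β ^ (m - 1))).congr (.of_forall fun y => ?_)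
        rw [Pi.smul_apply, smul_smul, mul_comm]
      · simp
    · obtain ⟨B, hB⟩ := (isCompact_Icc (a := (-1 : ℝ)) (b := 1)).exists_bound_of_continuousOn
        (Polynomial.hasseDeriv i Q).continuous.continuousOn
      refine ((integrable_inv_pow_smul hi' hf hz x).norm.const_mul (B * ((2 * R) ^ i)⁻¹)).mono'
        ?_ (.of_forall fun y => ?_)
      · refine Measurable.aestronglyMeasurable ?_ |>.smul hf.aestronglyMeasurable
        exact ((Polynomial.hasseDeriv i Q).continuous.measurable.comp (by fun_prop)).mul
          (by fun_prop)
      · rcases eq_or_ne (f y) 0 with h0 | h0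
        · simp [h0]
        have hy : ‖y‖ < R := by by_contra h; exact h0 (hz y (not_lt.1 h))
        -- On the support of f the quotient lies in [-1, 1], where the Hasse derivative is bounded.
        have hq : |(‖x‖ ^ 2 - ‖y‖ ^ 2) / (2 * R * ‖x - y‖)| ≤ 1 := by
          rw [abs_div, abs_of_nonneg (show 0 ≤ 2 * R * ‖x - y‖ by positivity)]
          exact div_le_one_of_le₀ (abs_div_le_of_ne_zero (ε := 0) hR hx' hy).1 (by positivity)
        have := hB _ (abs_le.1 hq)
        rw [norm_smul, norm_smul, norm_mul, mul_pow, mul_inv, norm_mul]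
        rw [norm_of_nonneg (show 0 ≤ ((2 * R) ^ i)⁻¹ by positivity)]
        calc _ ≤ B * (((2 * R) ^ i)⁻¹ * ‖(‖x - y‖ ^ i)⁻¹‖) * ‖f y‖ := by gcongr
          _ = _ := by ring
  set C1 := (R - ‖x‖)⁻¹ + (2 * R)⁻¹ with hC1
  have hC10 : 0 ≤ C1 := by have := sub_pos.2 hx'; positivity
  have hm1 : m - 1 + 1 = m := by omega
  -- The space has dimension m + 1, so |x-y|^(-m) is the strongest integer singularity that is still
  -- integrable. It is also just what an error of order ε^m requires.
  refine ⟨C * C1 ^ m * ∫ y, ‖(‖x - y‖ ^ m)⁻¹ • f y‖, fun ε => ?_⟩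
  have hI := (integral_integral_kernel hm hk hR hf hrR hr x ε).1
  have hsum : ∑ i ∈ Finset.range (m - 1 + 1), ε ^ i •
        ∫ y, ((if i = 0 then lam (2 * R * ‖x - y‖) * (∫ β in (0 : ℝ)..π, sin β ^ (m - 1)) else 0) +
          (Polynomial.hasseDeriv i Q).eval ((‖x‖ ^ 2 - ‖y‖ ^ 2) / (2 * R * ‖x - y‖)) *
            ((2 * R * ‖x - y‖) ^ i)⁻¹) • f y =
      ∫ y, (lam (2 * R * ‖x - y‖) * (∫ β in (0 : ℝ)..π, sin β ^ (m - 1)) +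
        Q.eval ((‖x‖ ^ 2 - ‖y‖ ^ 2 + ε) / (2 * R * ‖x - y‖))) • f y := by
    simp_rw [← integral_smul]
    have hterm' : ∀ i ∈ Finset.range (m - 1 + 1), Integrable fun y => ε ^ i •
        (((if i = 0 then lam (2 * R * ‖x - y‖) * (∫ β in (0 : ℝ)..π, sin β ^ (m - 1)) else 0) +
          (Polynomial.hasseDeriv i Q).eval ((‖x‖ ^ 2 - ‖y‖ ^ 2) / (2 * R * ‖x - y‖)) *
            ((2 * R * ‖x - y‖) ^ i)⁻¹) • f y) := fun i hi => (hterm i hi).smul (ε ^ i)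
    rw [← integral_finsetSum _ hterm']
    refine integral_congr_ae (.of_forall fun y => ?_)
    simp only [smul_smul]
    rw [← Finset.sum_smul, add_div, eval_add_eq_sum_hasseDeriv hk.natDegree_le]
    congr 1
    simp only [mul_add]
    rw [Finset.sum_add_distrib]
    congr 1
    · simp
    · refine Finset.sum_congr rfl fun i _ => ?_
      rw [div_pow, div_eq_mul_inv]; ring
  have hI2 : Integrable fun y => (lam (2 * R * ‖x - y‖) * (∫ β in (0 : ℝ)..π, sin β ^ (m - 1)) +
        Q.eval ((‖x‖ ^ 2 - ‖y‖ ^ 2 + ε) / (2 * R * ‖x - y‖))) • f y := by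
    refine (integrable_finsetSum _ fun i hi => (hterm i hi).smul (ε ^ i)).congr
      (.of_forall fun y => ?_)
    simp only [Pi.smul_apply, smul_smul]
    rw [← Finset.sum_smul, add_div, eval_add_eq_sum_hasseDeriv hk.natDegree_le]
    congr 1
    simp only [mul_add]
    rw [Finset.sum_add_distrib]
    congr 1
    · simp
    · refine Finset.sum_congr rfl fun i _ => ?_
      rw [div_pow, div_eq_mul_inv]; ring
  rw [hsum, ← integral_sub hI hI2, hm1, mul_assoc, mul_comm (∫ y, _), ← mul_assoc,
    ← integral_const_mul]
  have hae : ∀ᵐ y : EuclideanSpace ℝ (Fin (m + 1)), x ≠ y := by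
    rw [ae_iff]
    have : {a : EuclideanSpace ℝ (Fin (m + 1)) | ¬x ≠ a} = {x} := by ext; simp [eq_comm]
    rw [this, measure_singleton]
  refine norm_integral_le_of_norm_le
    ((integrable_inv_pow_smul le_rfl hf hz x).norm.const_mul _) ?_
  filter_upwards [hae] with y hxy
  rw [← sub_smul, add_sub_add_left_eq_sub, norm_smul, norm_smul, norm_eq_abs]
  rcases eq_or_ne (f y) 0 with h0 | h0
  · simp [h0]
  have hy : ‖y‖ < R := by by_contra h; exact h0 (hz y (not_lt.1 h))
  have hb := (abs_div_le_of_ne_zero (ε := ε) hR hx' hy).2 hxy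
  set z := (‖x‖ ^ 2 - ‖y‖ ^ 2 + ε) / (2 * R * ‖x - y‖) with hzdef
  rw [← mul_assoc]
  gcongr
  -- For |z| < 1 the polynomial is exact; only |z| ≥ 1, hence y close to x, produces an error.
  rcases lt_or_ge |z| 1 with h1 | h1
  · rw [(hE z).1 h1, sub_self, abs_zero]
    positivity
  · refine ((hE z).2 h1).trans ?_
    rw [hm1, norm_of_nonneg (show 0 ≤ (‖x - y‖ ^ m)⁻¹ by positivity)]
    calc C * |z| ^ m ≤ C * (C1 * (|ε| * ‖x - y‖⁻¹)) ^ m := by gcongr; exact hb h1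
      _ = _ := by rw [mul_pow, mul_pow, inv_pow]; ring

theorem smul_mem_sphere {R : ℝ} (hR : 0 < R) (θ : sphere (0 : EuclideanSpace ℝ (Fin n)) 1) :
    R • (θ : EuclideanSpace ℝ (Fin n)) ∈ sphere (0 : EuclideanSpace ℝ (Fin n)) R := by
  rw [mem_sphere_zero_iff_norm, norm_smul, norm_eq_of_mem_sphere, mul_one, norm_of_nonneg hR.le]

/-- Regularity, joint continuity and support of the profiles with centre on the sphere. -/
theorem sphProfile_smul_sphere {R : ℝ} (hR : 0 < R) {f : EuclideanSpace ℝ (Fin n) → F}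
    (hf : ContDiff ℝ ∞ f) (hs : tsupport f ⊆ ball 0 R) :
    (∀ ξ ∈ sphere (0 : EuclideanSpace ℝ (Fin n)) R, ContDiff ℝ ∞ (sphProfile f ξ)) ∧
    (∀ j, Continuous fun q : sphere (0 : EuclideanSpace ℝ (Fin n)) 1 × ℝ =>
      iteratedDeriv j (sphProfile f (R • (q.1 : EuclideanSpace ℝ (Fin n)))) q.2) ∧
    ∀ j, ∀ ξ ∈ sphere (0 : EuclideanSpace ℝ (Fin n)) R, ∀ s ∈ Iio (0 : ℝ) ∪ Ioi (4 * R ^ 2),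
      iteratedDeriv j (sphProfile f ξ) s = 0 := by
  obtain ⟨r, hr0, hrR, hr⟩ := exists_radius_lt hR hs
  have hz : ∀ y, R ≤ ‖y‖ → f y = 0 := fun y hy => hr y (hrR.trans_le hy)
  refine ⟨fun ξ hξ => ?_, fun j => ?_, fun j ξ hξ s hs =>
    iteratedDeriv_eq_zero_of_eqOn (isOpen_Iio.union isOpen_Ioi) (fun s hs => ?_) j hs⟩
  · rw [← contDiffOn_univ]
    exact (contDiffOn_sphProfile hf hr).comp (f := fun s : ℝ => (ξ, s)) (by fun_prop)
      fun s _ => ⟨by rw [mem_ofPred_eq, mem_sphere_zero_iff_norm.1 hξ]; exact hrR, mem_univ _⟩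
  · rw [← continuousOn_univ]
    have ho : IsOpen {x : EuclideanSpace ℝ (Fin n) | r < ‖x‖} :=
      isOpen_lt continuous_const continuous_norm
    exact (contDiffOn_iteratedDeriv_snd (Φ := sphProfile f) ho
      (contDiffOn_sphProfile hf hr) j).continuousOn.comp
      (f := fun q : sphere (0 : EuclideanSpace ℝ (Fin n)) 1 × ℝ =>
        (R • (q.1 : EuclideanSpace ℝ (Fin n)), q.2)) (by fun_prop)
      fun q _ => ⟨by rw [mem_ofPred_eq, mem_sphere_zero_iff_norm.1 (smul_mem_sphere hR q.1)]; exact hrR, mem_univ _⟩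
  · rw [mem_sphere_zero_iff_norm] at hξ
    rcases hs with hs | hs
    · refine sphProfile_eq_zero hr ?_
      rw [sqrt_eq_zero_of_nonpos (mem_Iio.1 hs).le, hξ]
      linarith
    · refine sphProfile_eq_zero' hz ?_
      rw [hξ]
      refine le_sqrt_of_sq_le ?_
      have := mem_Ioi.1 hs
      linarith

/-- The derivative of order m - 1 at ε = 0 is computed twice. Under the integral it falls on the
profiles; by the expansion it is (m-1)! times the coefficient of ε^(m-1), where only the top
coefficient of Q and, for m = 1, the scaling term survive. -/
theorem integral_backprojection [CompleteSpace F] {m : ℕ} (hm : 1 ≤ m) {k lam : ℝ → ℝ}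
    {Q : Polynomial ℝ} (hk : IsBackprojectionKernel (m - 1) k lam Q) (hlm : Measurable lam)
    {R : ℝ} (hR : 0 < R)
    {f : EuclideanSpace ℝ (Fin (m + 1)) → F} (hf : ContDiff ℝ ∞ f) (hs : tsupport f ⊆ ball 0 R)
    {x : EuclideanSpace ℝ (Fin (m + 1))} (hx : x ∈ ball (0 : EuclideanSpace ℝ (Fin (m + 1))) R) :
    Integrable (fun θ : sphere (0 : EuclideanSpace ℝ (Fin (m + 1))) 1 =>
      ∫ s, k (‖x - R • (θ : EuclideanSpace ℝ (Fin (m + 1)))‖ ^ 2 - s) •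
        iteratedDeriv (m - 1) (sphProfile f (R • (θ : EuclideanSpace ℝ (Fin (m + 1))))) s)
      (volume : Measure (EuclideanSpace ℝ (Fin (m + 1)))).toSphere ∧
    ∫ θ, (∫ s, k (‖x - R • (θ : EuclideanSpace ℝ (Fin (m + 1)))‖ ^ 2 - s) •
        iteratedDeriv (m - 1) (sphProfile f (R • (θ : EuclideanSpace ℝ (Fin (m + 1))))) s)
        ∂(volume : Measure (EuclideanSpace ℝ (Fin (m + 1)))).toSphere =
      ((m - 1).factorial *
        (2 / (volume : Measure (EuclideanSpace ℝ (Fin (m + 1)))).toSphere.real univ *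
        (volume : Measure (EuclideanSpace ℝ (Fin m))).toSphere.real univ)) •
      ∫ y, ((if m - 1 = 0 then
          lam (2 * R * ‖x - y‖) * (∫ β in (0 : ℝ)..π, sin β ^ (m - 1)) else 0) +
        Q.coeff (m - 1) * ((2 * R * ‖x - y‖) ^ (m - 1))⁻¹) • f y := by
  obtain ⟨r, hr0, hrR, hr⟩ := exists_radius_lt hR hs
  have hx' : ‖x‖ < R := mem_ball_zero_iff.1 hx
  have hmem : ∀ θ : sphere (0 : EuclideanSpace ℝ (Fin (m + 1))) 1,
      R • (θ : EuclideanSpace ℝ (Fin (m + 1))) ∈ sphere (0 : EuclideanSpace ℝ (Fin (m + 1))) R :=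
    smul_mem_sphere hR
  obtain ⟨hG, hGc, hG0⟩ := sphProfile_smul_sphere hR hf hs
  set G : sphere (0 : EuclideanSpace ℝ (Fin (m + 1))) 1 → ℝ → F :=
    fun θ => sphProfile f (R • (θ : EuclideanSpace ℝ (Fin (m + 1)))) with hGdef
  set p : sphere (0 : EuclideanSpace ℝ (Fin (m + 1))) 1 → ℝ :=
    fun θ => ‖x - R • (θ : EuclideanSpace ℝ (Fin (m + 1)))‖ ^ 2 with hpdef
  have hp : Continuous p := by fun_prop
  have hp1 : ∀ θ, p θ ≤ 4 * R ^ 2 := fun θ => by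
    have := norm_sub_le x (R • (θ : EuclideanSpace ℝ (Fin (m + 1))))
    rw [mem_sphere_zero_iff_norm.1 (hmem θ)] at this
    calc p θ ≤ (2 * R) ^ 2 := by
          simp only [hpdef]; gcongr; linarith
      _ = _ := by ring
  have hGj : ∀ j θ ε s, |ε| ≤ 1 → 4 * R ^ 2 + 1 < |p θ + ε - s| →
      iteratedDeriv j (G θ) s = 0 := fun j θ ε s hε h => by
    refine hG0 j _ (hmem θ) s ?_
    by_contra hn
    rw [mem_union, not_or, mem_Iio, mem_Ioi, not_lt, not_lt] at hn
    obtain ⟨e1, e2⟩ := abs_le.1 hε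
    have h3 := hp1 θ
    have h4 : 0 ≤ p θ := by positivity
    exact absurd h (not_lt.2 (abs_le.2 ⟨by linarith, by linarith⟩))
  -- Both p θ and the support of the profiles lie in [0, 4R²], so the half-width 4R² + 1 suffices
  -- for |ε| ≤ 1.
  obtain ⟨hJ1, hJ2⟩ := contDiff_shiftedBackprojection hk.locallyIntegrable hp
    (fun θ => hG _ (hmem θ)) hGc (4 * R ^ 2 + 1)
  have hJeq : ∀ j ε, |ε| ≤ 1 →
      Integrable (fun θ => ∫ s, k (p θ + ε - s) • iteratedDeriv j (G θ) s)
        (volume : Measure (EuclideanSpace ℝ (Fin (m + 1)))).toSphere ∧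
      shiftedBackprojection k (fun θ => iteratedDeriv j (G θ)) p (4 * R ^ 2 + 1) ε =
      ∫ θ, (∫ s, k (p θ + ε - s) • iteratedDeriv j (G θ) s)
        ∂(volume : Measure (EuclideanSpace ℝ (Fin (m + 1)))).toSphere := fun j ε hε =>
    shiftedBackprojection_eq hk.locallyIntegrable hp (hGc j) fun θ s h => hGj j θ ε s hε h
  set κ := 2 / (volume : Measure (EuclideanSpace ℝ (Fin (m + 1)))).toSphere.real univ *
        (volume : Measure (EuclideanSpace ℝ (Fin m))).toSphere.real univ with hκ
  obtain ⟨C, hC⟩ := exists_backprojection_expansion hm hk hlm hR hf.continuous hrR hr hx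
  have hexp := iteratedDeriv_eq_of_expansion hJ1 (m - 1) (fun i => κ •
    ∫ y, ((if i = 0 then lam (2 * R * ‖x - y‖) * (∫ β in (0 : ℝ)..π, sin β ^ (m - 1)) else 0) +
          (Polynomial.hasseDeriv i Q).eval ((‖x‖ ^ 2 - ‖y‖ ^ 2) / (2 * R * ‖x - y‖)) *
            ((2 * R * ‖x - y‖) ^ i)⁻¹) • f y) (C := |κ| * C) (fun ε hε => by
    have h1 := (hJeq 0 ε hε).2
    simp only [iteratedDeriv_zero] at h1
    rw [h1, (integral_integral_kernel hm hk hR hf.continuous hrR hr x ε).2]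
    simp_rw [smul_comm (ε ^ _) κ]
    rw [← Finset.smul_sum, ← smul_sub, norm_smul, norm_eq_abs, mul_assoc]
    gcongr
    exact hC ε)
  have h0 := hJeq (m - 1) 0 (by simp)
  rw [hJ2, h0.2] at hexp
  have h01 := h0.1
  simp only [add_zero] at hexp h01
  refine ⟨h01, ?_⟩
  rw [hexp, smul_smul, hasseDeriv_natDegree_le hk.natDegree_le]
  simp only [Polynomial.eval_C]

end

/-! ### The operator D in the variable t², and the potentials in each dimension. -/

section
variable {F : Type*} [NormedAddCommGroup F] [NormedSpace ℝ F] {n : ℕ}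

theorem measurableEmbedding_smul_sphere {R : ℝ} (hR : 0 < R) :
    MeasurableEmbedding (fun θ : sphere (0 : EuclideanSpace ℝ (Fin n)) 1 =>
      R • (θ : EuclideanSpace ℝ (Fin n))) := by
  refine (Continuous.isClosedEmbedding (by fun_prop) fun a b h => ?_).measurableEmbedding
  exact Subtype.ext (smul_right_injective _ hR.ne' h)

theorem integral_sphereMeasure {R : ℝ} (hR : 0 < R) (h : EuclideanSpace ℝ (Fin n) → F) :
    ∫ ξ, h ξ ∂(sphereMeasure n R) = R ^ (n - 1) •
      ∫ θ : sphere (0 : EuclideanSpace ℝ (Fin n)) 1, h (R • (θ : EuclideanSpace ℝ (Fin n)))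
        ∂(volume : Measure (EuclideanSpace ℝ (Fin n))).toSphere := by
  rw [sphereMeasure, integral_smul_measure, (measurableEmbedding_smul_sphere hR).integral_map,
    ENNReal.toReal_ofReal (by positivity)]

theorem integrable_sphereMeasure {R : ℝ} (hR : 0 < R) {h : EuclideanSpace ℝ (Fin n) → F}
    (hi : Integrable (fun θ : sphere (0 : EuclideanSpace ℝ (Fin n)) 1 =>
      h (R • (θ : EuclideanSpace ℝ (Fin n))))
        (volume : Measure (EuclideanSpace ℝ (Fin n))).toSphere) :
    Integrable h (sphereMeasure n R) := by
  refine Integrable.smul_measure ?_ ENNReal.ofReal_ne_top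
  exact (measurableEmbedding_smul_sphere hR).integrable_map_iff.2 hi

/-- Under s = t² the operator D is d/ds. -/
theorem opD_iterate_eq {h H : ℝ → F} (hH : ContDiff ℝ ∞ H) (hh : ∀ t, 0 < t → h t = H (t ^ 2))
    (j : ℕ) {t : ℝ} (ht : 0 < t) : (opD^[j] h) t = iteratedDeriv j H (t ^ 2) := by
  induction j generalizing t with
  | zero => simpa using hh t ht
  | succ j ih =>
    rw [Function.iterate_succ_apply', opD]
    have h1 : opD^[j] h =ᶠ[nhds t] fun t => iteratedDeriv j H (t ^ 2) := by
      filter_upwards [Ioi_mem_nhds ht] with s hs using ih hs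
    have h2 := (hasDerivAt_iteratedDeriv_of_contDiff hH j (t ^ 2)).scomp t (hasDerivAt_pow 2 t)
    rw [h1.deriv_eq]
    have h3 := h2.deriv
    rw [show (iteratedDeriv j H ∘ fun t => t ^ 2) = fun t => iteratedDeriv j H (t ^ 2) from rfl]
      at h3
    rw [h3, smul_smul]
    have : 1 / (2 * t) * (((2 : ℕ) : ℝ) * t ^ (2 - 1)) = 1 := by
      field_simp; norm_num
    rw [this, one_smul]

theorem sphProfile_sq (f : EuclideanSpace ℝ (Fin n) → F) (x : EuclideanSpace ℝ (Fin n)) {t : ℝ}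
    (ht : 0 ≤ t) : sphProfile f x (t ^ 2) = t ^ (n - 2) • sphMean f x t := by
  rw [sphProfile, sqrt_sq ht]

theorem abs_le_add_of_mem_uIcc {a b c : ℝ} (h : a ∈ uIcc b c) : |a| ≤ |b| + |c| := by
  rw [mem_uIcc] at h
  have := neg_abs_le b
  have := neg_abs_le c
  have := le_abs_self b
  have := le_abs_self c
  have := abs_nonneg b
  have := abs_nonneg c
  rcases h with ⟨h1, h2⟩ | ⟨h1, h2⟩ <;> exact abs_le.2 ⟨by linarith, by linarith⟩

/-- In dimension m + 1 the exponent m - 1 is the dimension minus two: this is the Newtonian kernel.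
The power of s decreases, which gives the domination required of φ. -/
theorem laplacian_pow_potential [CompleteSpace F] {m : ℕ} (hm : 2 ≤ m) (A : ℝ)
    {f : EuclideanSpace ℝ (Fin (m + 1)) → F} (hf : ContDiff ℝ ∞ f) {R : ℝ}
    (hs : tsupport f ⊆ ball 0 R) :
    ContDiffOn ℝ ∞ (fun x => ∫ y, (A * (‖x - y‖ ^ (m - 1))⁻¹) • f y) (ball 0 R) ∧
    ∀ x ∈ ball (0 : EuclideanSpace ℝ (Fin (m + 1))) R,
      Laplacian.laplacian (fun x : EuclideanSpace ℝ (Fin (m + 1)) =>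
        ∫ y, (A * (‖x - y‖ ^ (m - 1))⁻¹) • f y) x =
        (-(A * (m - 1 : ℕ)) *
          (volume : Measure (EuclideanSpace ℝ (Fin (m + 1)))).toSphere.real univ) • f x := by
  have hφ : ∀ r : ℝ, 0 ≤ r → A * (r ^ 2) ^ (-((m - 1 : ℕ) : ℝ) / 2) = A * (r ^ (m - 1))⁻¹ :=
    fun r hr => by
    rw [← rpow_natCast_mul hr, ← rpow_natCast, ← rpow_neg hr]
    congr 2; push_cast; ring
  have hanti : ∀ s : ℝ, 0 < s → ∀ δ : ℝ, 0 ≤ δ → (s + δ) ^ (-((m - 1 : ℕ) : ℝ) / 2) ≤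
      s ^ (-((m - 1 : ℕ) : ℝ) / 2) := fun s hs δ hδ => by
    refine rpow_le_rpow_of_nonpos hs (by linarith) ?_
    rw [neg_div]
    exact neg_nonpos.2 (by positivity)
  have := laplacian_radial_potential (n := m + 1) (by omega) (c := -(A * (m - 1 : ℕ)))
    (φ := fun s => A * s ^ (-((m - 1 : ℕ) : ℝ) / 2)) (fun s hs => ?_) (by fun_prop) (fun T => ?_)
    (fun s hs δ hδ => ?_) hf hs
  · simp only [hφ _ (norm_nonneg _)] at this
    exact this
  · refine ((hasDerivAt_rpow_const (Or.inl hs.ne')).const_mul A).congr_deriv ?_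
    have : (-((m - 1 : ℕ) : ℝ) / 2 - 1) = (-((m + 1 : ℕ) : ℝ) / 2) := by
      push_cast [Nat.cast_sub (show 1 ≤ m by omega)]; ring
    rw [this]; ring
  · have h1 : IntegrableOn (fun r : ℝ => A * r) (Ioo 0 T) :=
      ((by fun_prop : Continuous fun r : ℝ => A * r).integrableOn_Icc (a := 0) (b := T)).mono_set
        Ioo_subset_Icc_self
    refine h1.congr_fun (fun r hr => ?_) measurableSet_Ioo
    simp only
    rw [hφ r hr.1.le]
    have h2 : r ^ (m + 1 - 1) = r ^ (m - 1) * r := by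
      rw [← pow_succ]; congr 1; omega
    have := hr.1.ne'
    rw [h2]; field_simp
  · simp only [abs_mul, ← mul_add]
    gcongr
    refine abs_le_add_of_mem_uIcc (mem_uIcc.2 (Or.inr ⟨?_, hanti s hs δ hδ.1.le⟩))
    have := hanti (s + δ) (by linarith [hδ.1]) (1 - δ) (by linarith [hδ.2])
    rwa [add_add_sub_cancel] at this

/-- The constant B does not affect the derivative of the kernel; it absorbs the terms that come from
the radius and from the constant polynomial. -/
theorem laplacian_log_potential [CompleteSpace F] (A B : ℝ)
    {f : EuclideanSpace ℝ (Fin (1 + 1)) → F} (hf : ContDiff ℝ ∞ f) {R : ℝ}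
    (hs : tsupport f ⊆ ball 0 R) :
    ContDiffOn ℝ ∞ (fun x => ∫ y, (A * (log ‖x - y‖ + B)) • f y) (ball 0 R) ∧
    ∀ x ∈ ball (0 : EuclideanSpace ℝ (Fin (1 + 1))) R,
      Laplacian.laplacian (fun x : EuclideanSpace ℝ (Fin (1 + 1)) =>
        ∫ y, (A * (log ‖x - y‖ + B)) • f y) x =
        (A * (volume : Measure (EuclideanSpace ℝ (Fin (1 + 1)))).toSphere.real univ) • f x := by
  have hφ : ∀ r : ℝ, A * (2⁻¹ * log (r ^ 2) + B) = A * (log r + B) := fun r => by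
    rw [log_pow]; push_cast; ring
  have := laplacian_radial_potential (n := 1 + 1) (by omega) (c := A)
    (φ := fun s => A * (2⁻¹ * log s + B)) (fun s hs => ?_) (by fun_prop) (fun T => ?_)
    (fun s hs δ hδ => ?_) hf hs
  · simp only [hφ] at this
    exact this
  · refine ((((hasDerivAt_log hs.ne').const_mul 2⁻¹).add_const B).const_mul A).congr_deriv ?_
    rw [show -((1 + 1 : ℕ) : ℝ) / 2 = -1 by norm_num, rpow_neg_one]
    ring
  · have h0 : Continuous fun r : ℝ => A * (r * log r + B * r) :=
      continuous_const.mul (continuous_mul_log.add (by fun_prop))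
    have h1 : IntegrableOn (fun r : ℝ => A * (r * log r + B * r)) (Ioo 0 T) :=
      h0.integrableOn_Icc.mono_set Ioo_subset_Icc_self
    refine h1.congr_fun (fun r hr => ?_) measurableSet_Ioo
    simp only [hφ, add_tsub_cancel_left, pow_one]
    ring
  · simp only [abs_mul, ← mul_add]
    gcongr
    have h1 := log_le_log hs (show s ≤ s + δ by linarith [hδ.1])
    have h2 := log_le_log (show 0 < s + δ by linarith [hδ.1]) (show s + δ ≤ s + 1 by linarith [hδ.2])
    exact abs_le_add_of_mem_uIcc (mem_uIcc.2 (Or.inl ⟨by linarith, by linarith⟩))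

/-- The constant of the inversion formulas, by the duplication formula. -/
theorem two_pow_mul_factorial_mul_toSphere {m : ℕ} (hm : 1 ≤ m) :
    √π * (m - 1).factorial / (2 ^ (m - 1) * (Gamma (((m + 1 : ℕ) : ℝ) / 2) * Gamma ((m : ℝ) / 2)))
      = 1 := by
  have h := Gamma_mul_Gamma_add_half ((m : ℝ) / 2)
  have hm0 : (0 : ℝ) < (m : ℝ) / 2 := by positivity
  have h1 := (Gamma_pos_of_pos hm0).ne'
  have h2 := (Gamma_pos_of_pos (show (0 : ℝ) < ((m + 1 : ℕ) : ℝ) / 2 by positivity)).ne'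
  have e1 : (m : ℝ) / 2 + 1 / 2 = ((m + 1 : ℕ) : ℝ) / 2 := by push_cast; ring
  have e2 : 2 * ((m : ℝ) / 2) = ((m - 1 : ℕ) : ℝ) + 1 := by
    push_cast [Nat.cast_sub hm]; ring
  rw [e1, e2, Gamma_nat_eq_factorial, show (1 : ℝ) - (((m - 1 : ℕ) : ℝ) + 1) = -((m - 1 : ℕ) : ℝ) by
    ring, rpow_neg two_pos.le, rpow_natCast] at h
  rw [mul_comm (Gamma _), h]
  have : √π ≠ 0 := by positivity
  have : ((m - 1).factorial : ℝ) ≠ 0 := by positivity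
  field_simp

end

/-! ### Inversion of spherical means with centres on a sphere. -/

section
variable {F : Type*} [NormedAddCommGroup F] [NormedSpace ℝ F] {n : ℕ}

/-- Integration against the sign undoes one derivative. This is why the odd formula is local and
contains n - 3 derivatives instead of n - 2. -/
theorem integral_sgn_smul_deriv [CompleteSpace F] {g : ℝ → F} (hg : ContDiff ℝ 1 g) (hc : HasCompactSupport g)
    (p : ℝ) : ∫ s, sgn (p - s) • deriv g s = (2 : ℝ) • g p := by
  have hi : Integrable (deriv g) :=
    (hg.continuous_deriv le_rfl).integrable_of_hasCompactSupport hc.deriv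
  have hi2 : Integrable fun s => sgn (p - s) • deriv g s := by
    refine Integrable.bdd_smul (𝕜 := ℝ) hi 1 ?_ (.of_forall fun s => ?_)
    · exact (measurable_sgn.comp (by fun_prop)).aestronglyMeasurable
    · rw [norm_eq_abs, abs_sgn]
  rw [← integral_add_compl (measurableSet_Iic (a := p)) hi2, compl_Iic]
  have h1 : ∫ s in Iic p, sgn (p - s) • deriv g s = ∫ s in Iic p, deriv g s :=
    setIntegral_congr_fun measurableSet_Iic fun s hs => by
      simp only [sgn]
      rw [if_neg (by rw [not_lt, sub_nonneg]; exact hs), one_smul]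
  have h2 : ∫ s in Ioi p, sgn (p - s) • deriv g s = ∫ s in Ioi p, -deriv g s :=
    setIntegral_congr_fun measurableSet_Ioi fun s hs => by
      simp only [sgn]
      rw [if_pos (by rw [sub_neg]; exact hs), neg_one_smul]
  rw [h1, h2, integral_neg, hc.integral_Iic_deriv_eq hg, hc.integral_Ioi_deriv_eq hg, two_smul,
    neg_neg]

theorem opD_iterate_of_eq_sphMean {R : ℝ} (hR : 0 < R) {f : EuclideanSpace ℝ (Fin n) → F}
    (hf : ContDiff ℝ ∞ f) (hs : tsupport f ⊆ ball 0 R) {c : ℝ}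
    {g : EuclideanSpace ℝ (Fin n) → ℝ → F}
    (hg : ∀ ξ ∈ sphere (0 : EuclideanSpace ℝ (Fin n)) R, ∀ t, 0 < t → g ξ t = c • sphMean f ξ t)
    (j : ℕ) {ξ : EuclideanSpace ℝ (Fin n)} (hξ : ξ ∈ sphere (0 : EuclideanSpace ℝ (Fin n)) R)
    {t : ℝ} (ht : 0 < t) :
    (opD^[j] fun t : ℝ => t ^ (n - 2) • g ξ t) t =
      c • iteratedDeriv j (sphProfile f ξ) (t ^ 2) := by
  have hG := (sphProfile_smul_sphere hR hf hs).1 ξ hξ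
  have h1 := opD_iterate_eq (H := fun s => c • sphProfile f ξ s) (hG.const_smul c)
    (h := fun t : ℝ => t ^ (n - 2) • g ξ t) (fun t ht => by
      rw [hg ξ hξ t ht, sphProfile_sq f ξ ht.le, smul_comm]) j ht
  rw [h1]
  exact iteratedDeriv_fun_const_smul (hG.contDiffAt.of_le (by norm_cast; simp)) c

theorem norm_sub_pos_of_mem {R : ℝ} {x ξ : EuclideanSpace ℝ (Fin n)}
    (hx : x ∈ ball (0 : EuclideanSpace ℝ (Fin n)) R)
    (hξ : ξ ∈ sphere (0 : EuclideanSpace ℝ (Fin n)) R) : 0 < ‖x - ξ‖ := by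
  refine norm_pos_iff.2 (sub_ne_zero.2 fun h => ?_)
  rw [h, mem_ball_zero_iff, mem_sphere_zero_iff_norm.1 hξ] at hx
  exact lt_irrefl _ hx

/-- Inversion of the spherical mean transform with centres on a sphere, in odd dimensions. -/
theorem sphMean_inversion_odd [CompleteSpace F] {m j : ℕ} (hj : m - 1 = 2 * j + 1) {R : ℝ} (hR : 0 < R)
    {f : EuclideanSpace ℝ (Fin (m + 1)) → F}
    (hf : ContDiff ℝ ∞ f) (hs : tsupport f ⊆ ball 0 R) {c : ℝ}
    {g : EuclideanSpace ℝ (Fin (m + 1)) → ℝ → F}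
    (hg : ∀ ξ ∈ sphere (0 : EuclideanSpace ℝ (Fin (m + 1))) R, ∀ t, 0 < t →
      g ξ t = c • sphMean f ξ t) :
    (∀ x ∈ ball (0 : EuclideanSpace ℝ (Fin (m + 1))) R,
      Integrable (fun ξ => (opD^[m + 1 - 3] fun t : ℝ => t ^ (m + 1 - 2) • g ξ t) ‖x - ξ‖)
        (sphereMeasure (m + 1) R)) ∧
    ContDiffOn ℝ ∞ (fun x => ∫ ξ, (opD^[m + 1 - 3] fun t : ℝ => t ^ (m + 1 - 2) • g ξ t) ‖x - ξ‖
      ∂(sphereMeasure (m + 1) R)) (ball (0 : EuclideanSpace ℝ (Fin (m + 1))) R) ∧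
    ∀ x ∈ ball (0 : EuclideanSpace ℝ (Fin (m + 1))) R,
      Laplacian.laplacian (fun x => ∫ ξ,
        (opD^[m + 1 - 3] fun t : ℝ => t ^ (m + 1 - 2) • g ξ t) ‖x - ξ‖
        ∂(sphereMeasure (m + 1) R)) x =
      (c * ((-1) ^ (j + 1) * (2 * (2 ^ (m - 1))⁻¹) * R * (m - 1).factorial *
        (volume : Measure (EuclideanSpace ℝ (Fin m))).toSphere.real univ)) • f x := by
  have hm : 2 ≤ m := by omega
  have hmem := smul_mem_sphere (n := m + 1) hR
  have hσ := (toSphere_real_univ_pos (show 1 ≤ m + 1 by omega)).ne'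
  obtain ⟨hG, hGc, hG0⟩ := sphProfile_smul_sphere hR hf hs
  obtain ⟨Q, hQ, hQc⟩ := exists_isBackprojectionKernel_sgn j
  rw [← hj] at hQ hQc
  have hval : ∀ x ∈ ball (0 : EuclideanSpace ℝ (Fin (m + 1))) R,
      ∀ θ : sphere (0 : EuclideanSpace ℝ (Fin (m + 1))) 1,
      (opD^[m + 1 - 3] fun t : ℝ => t ^ (m + 1 - 2) •
        g (R • (θ : EuclideanSpace ℝ (Fin (m + 1)))) t)
        ‖x - R • (θ : EuclideanSpace ℝ (Fin (m + 1)))‖ =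
      (c / 2) • ∫ s, sgn (‖x - R • (θ : EuclideanSpace ℝ (Fin (m + 1)))‖ ^ 2 - s) •
        iteratedDeriv (m - 1) (sphProfile f (R • (θ : EuclideanSpace ℝ (Fin (m + 1))))) s :=
    fun x hx θ => by
    rw [opD_iterate_of_eq_sphMean hR hf hs hg _ (hmem θ) (norm_sub_pos_of_mem hx (hmem θ))]
    -- Of the m - 1 = n - 2 derivatives one is consumed by the sign kernel.
    have e : m - 1 = m + 1 - 3 + 1 := by omega
    rw [e, iteratedDeriv_succ, integral_sgn_smul_deriv, smul_smul, div_mul_cancel₀ _ two_ne_zero]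
    · rw [iteratedDeriv_eq_iterate]
      exact (contDiff_infty.1 (hG _ (hmem θ)) _).iterate_deriv' 1 (m + 1 - 3)
    · refine HasCompactSupport.intro (isCompact_Icc (a := 0) (b := 4 * R ^ 2)) fun s hs => ?_
      refine hG0 _ _ (hmem θ) s ?_
      rw [mem_Icc, not_and_or, not_le, not_le] at hs
      exact hs
  have hint := fun (x : EuclideanSpace ℝ (Fin (m + 1)))
    (hx : x ∈ ball (0 : EuclideanSpace ℝ (Fin (m + 1))) R) =>
    integral_backprojection (by omega) hQ measurable_const hR hf hs hx
  -- R^m is the surface factor and c/2 comes from the sign identity. The factorial and the sphere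
  -- areas come from `integral_backprojection`, and the last factor is the top coefficient of Q with
  -- the scale (2R)^(1-m).
  set A : ℝ := R ^ m * (c / 2) * ((m - 1).factorial *
        (2 / (volume : Measure (EuclideanSpace ℝ (Fin (m + 1)))).toSphere.real univ *
        (volume : Measure (EuclideanSpace ℝ (Fin m))).toSphere.real univ)) *
        (2 * (-1) ^ j / (m - 1 : ℕ) * ((2 * R) ^ (m - 1))⁻¹) with hA
  have heq : EqOn (fun x => ∫ ξ,
      (opD^[m + 1 - 3] fun t : ℝ => t ^ (m + 1 - 2) • g ξ t) ‖x - ξ‖ ∂(sphereMeasure (m + 1) R))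
      (fun x => ∫ y, (A * (‖x - y‖ ^ (m - 1))⁻¹) • f y) (ball 0 R) := fun x hx => by
    simp only
    rw [integral_sphereMeasure hR]
    simp_rw [hval x hx]
    rw [integral_smul, (hint x hx).2, smul_smul, smul_smul, add_tsub_cancel_right, ← integral_smul]
    refine integral_congr_ae (.of_forall fun y => ?_)
    simp only
    rw [if_neg (by omega), zero_add, smul_smul, hQc, mul_pow, mul_inv, hA, mul_pow, mul_inv]
    congr 1
    ring
  obtain ⟨hP1, hP2⟩ := laplacian_pow_potential hm A hf hs
  refine ⟨fun x hx => ?_, hP1.congr heq, fun x hx => ?_⟩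
  · refine integrable_sphereMeasure hR ?_
    simp_rw [hval x hx]
    exact (hint x hx).1.smul _
  · rw [InnerProductSpace.laplacian_congr_nhds
      (heq.eventuallyEq_of_mem (isOpen_ball.mem_nhds hx)) |>.eq_of_nhds, hP2 x hx, hA]
    congr 1
    have h1 : ((m - 1 : ℕ) : ℝ) ≠ 0 := by
      have : m - 1 ≠ 0 := by omega
      exact_mod_cast this
    have h2 : R ^ m = R * R ^ (m - 1) := by rw [← pow_succ']; congr 1; omega
    rw [h2, mul_pow]
    field_simp
    ring

theorem intervalIntegrable_log_sq_sub_smul {g : ℝ → F} (hg : Continuous g) (p T : ℝ) :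
    IntervalIntegrable (fun t : ℝ => (t * log |t ^ 2 - p|) • g t) volume 0 T := by
  have h1 : IntervalIntegrable (fun t : ℝ => log (t ^ 2 - p)) volume 0 T :=
    intervalIntegrable_log_of_analytic (fun x => by fun_prop) 0 T
  have h2 := h1.smul_continuousOn (f := fun t => log (t ^ 2 - p)) (g := fun t : ℝ => t • g t)
    (by fun_prop : Continuous fun t : ℝ => t • g t).continuousOn
  refine h2.congr fun t _ => ?_
  simp only [log_abs, smul_smul, mul_comm]

/-- The substitution s = t² turns t dt into ds/2. Since g vanishes outside [0, T²], the range
becomes the whole line. -/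
theorem integral_log_sq_sub_smul {g : ℝ → F} {T : ℝ} (hT : 0 ≤ T)
    (hg : ∀ s ∈ Iio (0 : ℝ) ∪ Ioi (T ^ 2), g s = 0) (p : ℝ) :
    ∫ t in (0 : ℝ)..T, (t * log |t ^ 2 - p|) • g (t ^ 2) =
      (2⁻¹ : ℝ) • ∫ s, log (p - s) • g s := by
  have h := integral_comp_rpow_Ioi_of_pos (g := fun s => log (p - s) • g s) two_pos
  have h0 : ∫ s, log (p - s) • g s = ∫ s in Ioi 0, log (p - s) • g s := by
    rw [← integral_Ici_eq_integral_Ioi, setIntegral_eq_integral_of_forall_compl_eq_zero]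
    intro s hs
    rw [hg s (Or.inl (mem_Iio.2 (not_le.1 fun h => hs h))), smul_zero]
  rw [h0, ← h, ← integral_smul, intervalIntegral.integral_of_le hT]
  have h1 : ∫ t in Ioc 0 T, (t * log |t ^ 2 - p|) • g (t ^ 2) =
      ∫ t in Ioi 0, (t * log |t ^ 2 - p|) • g (t ^ 2) := by
    refine (setIntegral_eq_of_subset_of_forall_sdiff_eq_zero measurableSet_Ioi
      Ioc_subset_Ioi_self fun t ht => ?_).symm
    rw [hg, smul_zero]
    right
    have h3 := ht.1
    have h4 : T < t := by
      by_contra h; exact ht.2 ⟨h3, not_lt.1 h⟩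
    exact pow_lt_pow_left₀ h4 hT two_ne_zero
  rw [h1]
  refine setIntegral_congr_fun measurableSet_Ioi fun t _ => ?_
  simp only [rpow_two, smul_smul]
  rw [log_abs, ← neg_sub, log_neg_eq_log]
  norm_num
  congr 1
  ring

/-- Inversion of the spherical mean transform with centres on a sphere, in even dimensions. -/
theorem sphMean_inversion_even [CompleteSpace F] {m j : ℕ} (hm : 1 ≤ m) (hj : m - 1 = 2 * j) {R : ℝ} (hR : 0 < R)
    {f : EuclideanSpace ℝ (Fin (m + 1)) → F}
    (hf : ContDiff ℝ ∞ f) (hs : tsupport f ⊆ ball 0 R) {c : ℝ}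
    {g : EuclideanSpace ℝ (Fin (m + 1)) → ℝ → F}
    (hg : ∀ ξ ∈ sphere (0 : EuclideanSpace ℝ (Fin (m + 1))) R, ∀ t, 0 < t →
      g ξ t = c • sphMean f ξ t) :
    (∀ x ∈ ball (0 : EuclideanSpace ℝ (Fin (m + 1))) R,
      ∀ ξ ∈ sphere (0 : EuclideanSpace ℝ (Fin (m + 1))) R,
      IntervalIntegrable (fun t : ℝ => (t * log |t ^ 2 - ‖x - ξ‖ ^ 2|) •
        (opD^[m + 1 - 2] fun s : ℝ => s ^ (m + 1 - 2) • g ξ s) t) volume 0 (2 * R)) ∧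
    (∀ x ∈ ball (0 : EuclideanSpace ℝ (Fin (m + 1))) R,
      Integrable (fun ξ => ∫ t in (0 : ℝ)..(2 * R), (t * log |t ^ 2 - ‖x - ξ‖ ^ 2|) •
        (opD^[m + 1 - 2] fun s : ℝ => s ^ (m + 1 - 2) • g ξ s) t) (sphereMeasure (m + 1) R)) ∧
    ContDiffOn ℝ ∞ (fun x => ∫ ξ, (∫ t in (0 : ℝ)..(2 * R), (t * log |t ^ 2 - ‖x - ξ‖ ^ 2|) •
        (opD^[m + 1 - 2] fun s : ℝ => s ^ (m + 1 - 2) • g ξ s) t) ∂(sphereMeasure (m + 1) R))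
      (ball (0 : EuclideanSpace ℝ (Fin (m + 1))) R) ∧
    ∀ x ∈ ball (0 : EuclideanSpace ℝ (Fin (m + 1))) R,
      Laplacian.laplacian (fun x => ∫ ξ, (∫ t in (0 : ℝ)..(2 * R),
        (t * log |t ^ 2 - ‖x - ξ‖ ^ 2|) •
        (opD^[m + 1 - 2] fun s : ℝ => s ^ (m + 1 - 2) • g ξ s) t) ∂(sphereMeasure (m + 1) R)) x =
      (c * ((-1) ^ j * (2 ^ (m - 1))⁻¹ * R * (m - 1).factorial * π *
        (volume : Measure (EuclideanSpace ℝ (Fin m))).toSphere.real univ)) • f x := by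
  have hmem := smul_mem_sphere (n := m + 1) hR
  have hσ := (toSphere_real_univ_pos (show 1 ≤ m + 1 by omega)).ne'
  obtain ⟨hG, hGc, hG0⟩ := sphProfile_smul_sphere hR hf hs
  obtain ⟨Q, hQ, hQc, hQ0⟩ := exists_isBackprojectionKernel_log j
  rw [← hj] at hQ hQc
  have e2 : m + 1 - 2 = m - 1 := by omega
  have hT : (2 * R) ^ 2 = 4 * R ^ 2 := by ring
  have hcont : ∀ ξ ∈ sphere (0 : EuclideanSpace ℝ (Fin (m + 1))) R,
      Continuous fun t : ℝ => c • iteratedDeriv (m - 1) (sphProfile f ξ) (t ^ 2) := fun ξ hξ => by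
    have := (contDiff_infty.1 (hG ξ hξ) (m - 1)).continuous_iteratedDeriv (m - 1) le_rfl
    fun_prop
  have hopD : ∀ ξ ∈ sphere (0 : EuclideanSpace ℝ (Fin (m + 1))) R, ∀ t ∈ Ioc 0 (2 * R),
      (opD^[m + 1 - 2] fun s : ℝ => s ^ (m + 1 - 2) • g ξ s) t =
        c • iteratedDeriv (m - 1) (sphProfile f ξ) (t ^ 2) := fun ξ hξ t ht => by
    rw [opD_iterate_of_eq_sphMean hR hf hs hg _ hξ ht.1, e2]
  have h2R : (0 : ℝ) ≤ 2 * R := by positivity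
  have hval : ∀ x ∈ ball (0 : EuclideanSpace ℝ (Fin (m + 1))) R,
      ∀ ξ ∈ sphere (0 : EuclideanSpace ℝ (Fin (m + 1))) R,
      ∫ t in (0 : ℝ)..(2 * R), (t * log |t ^ 2 - ‖x - ξ‖ ^ 2|) •
        (opD^[m + 1 - 2] fun s : ℝ => s ^ (m + 1 - 2) • g ξ s) t =
      (c / 2) • ∫ s, log (‖x - ξ‖ ^ 2 - s) • iteratedDeriv (m - 1) (sphProfile f ξ) s :=
    fun x hx ξ hξ => by
    have h1 := integral_log_sq_sub_smul (g := iteratedDeriv (m - 1) (sphProfile f ξ))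
      h2R (fun s hs => hG0 _ ξ hξ s (by rwa [hT] at hs)) (‖x - ξ‖ ^ 2)
    rw [div_eq_mul_inv, mul_smul, ← h1, ← intervalIntegral.integral_smul,
      intervalIntegral.integral_of_le h2R, intervalIntegral.integral_of_le h2R]
    refine setIntegral_congr_fun measurableSet_Ioc fun t ht => ?_
    rw [hopD ξ hξ t ht, smul_comm]
  have hint := fun (x : EuclideanSpace ℝ (Fin (m + 1)))
    (hx : x ∈ ball (0 : EuclideanSpace ℝ (Fin (m + 1))) R) =>
    integral_backprojection hm hQ measurable_log hR hf hs hx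
  set A : ℝ := R ^ m * (c / 2) * ((m - 1).factorial *
        (2 / (volume : Measure (EuclideanSpace ℝ (Fin (m + 1)))).toSphere.real univ *
        (volume : Measure (EuclideanSpace ℝ (Fin m))).toSphere.real univ)) with hA
  have heq : EqOn (fun x => ∫ ξ, (∫ t in (0 : ℝ)..(2 * R), (t * log |t ^ 2 - ‖x - ξ‖ ^ 2|) •
        (opD^[m + 1 - 2] fun s : ℝ => s ^ (m + 1 - 2) • g ξ s) t) ∂(sphereMeasure (m + 1) R))
      (fun x => ∫ y, (A * ((if m - 1 = 0 then
          log (2 * R * ‖x - y‖) * (∫ β in (0 : ℝ)..π, sin β ^ (m - 1)) else 0) +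
        Q.coeff (m - 1) * ((2 * R * ‖x - y‖) ^ (m - 1))⁻¹)) • f y) (ball 0 R) := fun x hx => by
    simp only
    rw [integral_sphereMeasure hR]
    rw [integral_congr_ae (.of_forall fun θ => hval x hx _ (hmem θ)), integral_smul, (hint x hx).2, smul_smul, smul_smul, add_tsub_cancel_right, ← integral_smul]
    refine integral_congr_ae (.of_forall fun y => ?_)
    simp only
    rw [smul_smul, hA]
  -- The kernel may be rewritten off the diagonal only, where the logarithm of the product splits;
  -- the diagonal is a null set.
  have hlap : ∀ φ : EuclideanSpace ℝ (Fin (m + 1)) → EuclideanSpace ℝ (Fin (m + 1)) → ℝ,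
      (∀ x y, x ≠ y → A * ((if m - 1 = 0 then
          log (2 * R * ‖x - y‖) * (∫ β in (0 : ℝ)..π, sin β ^ (m - 1)) else 0) +
        Q.coeff (m - 1) * ((2 * R * ‖x - y‖) ^ (m - 1))⁻¹) = φ x y) → EqOn
      (fun x => ∫ ξ, (∫ t in (0 : ℝ)..(2 * R), (t * log |t ^ 2 - ‖x - ξ‖ ^ 2|) •
        (opD^[m + 1 - 2] fun s : ℝ => s ^ (m + 1 - 2) • g ξ s) t) ∂(sphereMeasure (m + 1) R))
      (fun x => ∫ y, φ x y • f y) (ball 0 R) := fun φ hφ x hx => by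
    rw [heq hx]
    refine integral_congr_ae ?_
    have hae : ∀ᵐ y : EuclideanSpace ℝ (Fin (m + 1)), x ≠ y := by
      rw [ae_iff]
      have : {a : EuclideanSpace ℝ (Fin (m + 1)) | ¬x ≠ a} = {x} := by ext; simp [eq_comm]
      rw [this, measure_singleton]
    filter_upwards [hae] with y hy
    rw [hφ x y hy]
  refine ⟨fun x hx ξ hξ => ?_, fun x hx => ?_, ?_⟩
  · refine (intervalIntegrable_log_sq_sub_smul (hcont ξ hξ) (‖x - ξ‖ ^ 2) (2 * R)).congr fun t ht => ?_
    rw [uIoc_of_le h2R] at ht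
    rw [hopD ξ hξ t ht]
  · refine integrable_sphereMeasure hR ?_
    exact ((hint x hx).1.smul (c / 2)).congr (.of_forall fun θ => (hval x hx _ (hmem θ)).symm)
  -- In dimension two Q is constant and the kernel log |x-y| comes from the scaling term. In higher
  -- even dimensions that term is absent and the top coefficient of Q produces the Newtonian kernel.
  rcases Nat.eq_zero_or_pos j with h0 | h0
  · subst h0
    obtain rfl : m = 1 := by omega
    have h3 := hlap (fun x y => (A * π) * (log ‖x - y‖ + (log (2 * R) - log 2))) fun x y hxy => by
      have hd : 0 < ‖x - y‖ := norm_pos_iff.2 (sub_ne_zero.2 hxy)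
      rw [if_pos (by omega), hQ0 rfl, log_mul (by positivity) hd.ne']
      simp
      ring
    obtain ⟨hP1, hP2⟩ := laplacian_log_potential (A * π) (log (2 * R) - log 2) hf hs
    refine ⟨hP1.congr h3, fun x hx => ?_⟩
    rw [InnerProductSpace.laplacian_congr_nhds
      (h3.eventuallyEq_of_mem (isOpen_ball.mem_nhds hx)) |>.eq_of_nhds, hP2 x hx, hA]
    congr 1
    simp only [tsub_self, Nat.factorial_zero, pow_zero, pow_one]
    field_simp
  · have h1 : ((m - 1 : ℕ) : ℝ) ≠ 0 := by
      have : m - 1 ≠ 0 := by omega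
      exact_mod_cast this
    have h3 := hlap (fun x y => (A * (-(π / (m - 1 : ℕ)) * (-1) ^ j * ((2 * R) ^ (m - 1))⁻¹)) *
        (‖x - y‖ ^ (m - 1))⁻¹) fun x y _ => by
      rw [if_neg (by omega), hQc h0, mul_pow, mul_inv]
      ring
    obtain ⟨hP1, hP2⟩ := laplacian_pow_potential (by omega)
      (A * (-(π / (m - 1 : ℕ)) * (-1) ^ j * ((2 * R) ^ (m - 1))⁻¹)) hf hs
    refine ⟨hP1.congr h3, fun x hx => ?_⟩
    rw [InnerProductSpace.laplacian_congr_nhds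
      (h3.eventuallyEq_of_mem (isOpen_ball.mem_nhds hx)) |>.eq_of_nhds, hP2 x hx, hA]
    congr 1
    have h2 : R ^ m = R * R ^ (m - 1) := by rw [← pow_succ']; congr 1; omega
    rw [h2, mul_pow]
    field_simp
end

/-! ### Averages over beta distributed variables and their semigroup law. -/

section
open ProbabilityTheory
variable {F : Type*} [NormedAddCommGroup F] [NormedSpace ℝ F]

theorem measurable_betaPDF (p a : ℝ) : Measurable (betaPDF p a) :=
  (measurable_betaPDFReal p a).ennreal_ofReal

theorem ae_betaMeasure (p a : ℝ) : ∀ᵐ s ∂(betaMeasure p a), s ∈ Ioo (0 : ℝ) 1 := by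
  rw [betaMeasure, ae_withDensity_iff (measurable_betaPDF p a)]
  refine .of_forall fun s hs => ?_
  by_contra h
  rw [mem_Ioo, not_and_or, not_lt, not_lt] at h
  rcases h with h | h
  · exact hs (betaPDF_eq_zero_of_nonpos h)
  · exact hs (betaPDF_eq_zero_of_one_le h)

theorem betaMeasure_restrict_Icc (p a : ℝ) :
    (betaMeasure p a).restrict (Icc 0 1) = betaMeasure p a :=
  Measure.restrict_eq_self_of_ae_mem
    ((ae_betaMeasure p a).mono fun _ hs => Ioo_subset_Icc_self hs)

theorem integral_betaMeasure {p a : ℝ} (hp : 0 < p) (ha : 0 < a) (h : ℝ → F) :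
    ∫ s, h s ∂(betaMeasure p a) =
      (1 / beta p a) • ∫ s in Ioo (0 : ℝ) 1, (s ^ (p - 1) * (1 - s) ^ (a - 1)) • h s := by
  rw [betaMeasure, integral_withDensity_eq_integral_toReal_smul
    (measurable_betaPDF p a) (.of_forall fun _ => ENNReal.ofReal_lt_top),
    ← integral_smul, ← integral_indicator measurableSet_Ioo]
  refine integral_congr_ae (.of_forall fun s => ?_)
  simp only
  by_cases hs : s ∈ Ioo (0 : ℝ) 1
  · rw [indicator_of_mem hs, smul_smul, betaPDF, ENNReal.toReal_ofReal
      (betaPDFReal_pos hs.1 hs.2 hp ha).le, betaPDFReal, if_pos (mem_Ioo.1 hs), mul_assoc]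
  · rw [indicator_of_notMem hs, betaPDF, betaPDFReal, if_neg (mt mem_Ioo.2 hs)]
    simp

/-- A power of s changes only the first exponent of the beta density; the quotient of beta functions
restores the normalization. -/
theorem integral_rpow_smul_betaMeasure {p a q : ℝ} (hp : 0 < p) (ha : 0 < a) (hq : 0 < p + q)
    (h : ℝ → F) : ∫ s, s ^ q • h s ∂(betaMeasure p a) =
      (beta (p + q) a / beta p a) • ∫ s, h s ∂(betaMeasure (p + q) a) := by
  have e : beta (p + q) a / beta p a * (1 / beta (p + q) a) = 1 / beta p a := by
    have := (beta_pos hq ha).ne'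
    field_simp
  rw [integral_betaMeasure hp ha, integral_betaMeasure hq ha, smul_smul, e]
  congr 1
  refine setIntegral_congr_fun measurableSet_Ioo fun s hs => ?_
  rw [smul_smul, add_sub_right_comm, rpow_add hs.1]
  congr 1
  ring

/-- The normalized Erdélyi–Kober integral of order `a`: the mean of `g (t √s)` over a beta
distributed variable `s`. -/
noncomputable def betaMean (p a : ℝ) (g : ℝ → F) (t : ℝ) : F :=
  ∫ s, g (t * √s) ∂(betaMeasure p a)

theorem betaMean_congr {p a t : ℝ} (ht : 0 < t) {g h : ℝ → F} (hgh : ∀ s ∈ Ioo 0 t, g s = h s) :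
    betaMean p a g t = betaMean p a h t := by
  refine integral_congr_ae ?_
  filter_upwards [ae_betaMeasure p a] with s hs
  refine hgh _ ⟨mul_pos ht (sqrt_pos.2 hs.1), ?_⟩
  have : √s < 1 := by rw [sqrt_lt' one_pos]; simpa using hs.2
  nlinarith

theorem integrable_comp_sqrt {p a : ℝ} (hp : 0 < p) (ha : 0 < a) {g : ℝ → F} (hg : Continuous g)
    (t : ℝ) : Integrable (fun s => g (t * √s)) (betaMeasure p a) := by
  have := isProbabilityMeasureBeta hp ha
  rw [← betaMeasure_restrict_Icc]
  exact (hg.comp (by fun_prop)).continuousOn.integrableOn_compact isCompact_Icc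

theorem betaMean_eq_setIntegral (p a : ℝ) (g : ℝ → F) (t : ℝ) :
    betaMean p a g t = ∫ s in Icc (0 : ℝ) 1, (1 : ℝ) • g (t * √s) ∂(betaMeasure p a) := by
  simp only [one_smul, betaMeasure_restrict_Icc, betaMean]

theorem continuous_betaMean {p a : ℝ} (hp : 0 < p) (ha : 0 < a) {g : ℝ → F} (hg : Continuous g) :
    Continuous (betaMean p a g) := by
  have := isProbabilityMeasureBeta hp ha
  have h : Continuous fun t => ∫ s in Icc (0 : ℝ) 1, g (t * √s) ∂(betaMeasure p a) :=
    continuous_parametric_integral_of_continuous (by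
      have : Continuous fun q : ℝ × ℝ => g (q.1 * √q.2) := hg.comp (by fun_prop)
      exact this) isCompact_Icc
  simp only [betaMeasure_restrict_Icc] at h
  exact h

theorem contDiff_betaMean {p a : ℝ} (hp : 0 < p) (ha : 0 < a) {H : Type} [NormedAddCommGroup H]
    [NormedSpace ℝ H] [LocallyCompactSpace H] {Φ : H → ℝ → F}
    (hΦ : ContDiff ℝ ∞ fun q : H × ℝ => Φ q.1 q.2) :
    ContDiff ℝ ∞ fun q : H × ℝ => betaMean p a (Φ q.1) q.2 := by
  have := isProbabilityMeasureBeta hp ha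
  simp_rw [betaMean_eq_setIntegral]
  exact contDiff_setIntegral_smul (H := H × ℝ) (ι := fun s : ℝ => √s) (μ := betaMeasure p a)
    (w := fun _ => 1)
    (Φ := fun q : (H × ℝ) × ℝ => Φ q.1.1 (q.1.2 * q.2)) isCompact_Icc (by simp)
    continuous_sqrt (hΦ.comp (by fun_prop : ContDiff ℝ ∞ fun q : (H × ℝ) × ℝ =>
      (q.1.1, q.1.2 * q.2)))

theorem hasDerivAt_betaMean {p a : ℝ} (hp : 0 < p) (ha : 0 < a) {g : ℝ → F} (hg : ContDiff ℝ 1 g)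
    (t : ℝ) : HasDerivAt (betaMean p a g) (∫ s, √s • deriv g (t * √s) ∂(betaMeasure p a)) t := by
  have := isProbabilityMeasureBeta hp ha
  have hc := hg.continuous_deriv le_rfl
  have h := hasDerivAt_setIntegral_smul (μ := betaMeasure p a) (K := Icc 0 1) (w := fun _ => 1)
    (U := univ) (Φ := fun t s => g (t * √s)) (Φ' := fun t s => √s • deriv g (t * √s))
    isCompact_Icc (by simp) isOpen_univ ?_ ?_ (fun t _ s _ => ?_) (mem_univ t)
  · simp only [one_smul, betaMeasure_restrict_Icc] at h
    exact h
  · have : Continuous fun q : ℝ × ℝ => g (q.1 * √q.2) := hg.continuous.comp (by fun_prop)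
    exact this.continuousOn
  · have : Continuous fun q : ℝ × ℝ => √q.2 • deriv g (q.1 * √q.2) :=
      (by fun_prop : Continuous fun q : ℝ × ℝ => √q.2).smul (hc.comp (by fun_prop))
    exact this.continuousOn
  · have h1 : HasDerivAt (fun t => t * √s) (√s) t := by
      simpa using (hasDerivAt_id t).mul_const (√s)
    have h2 := (hg.differentiable one_ne_zero (t * √s)).hasDerivAt.scomp t h1
    exact h2

theorem betaMean_zero {p a : ℝ} (hp : 0 < p) (ha : 0 < a) [CompleteSpace F] (g : ℝ → F) :
    betaMean p a g 0 = g 0 := by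
  have := isProbabilityMeasureBeta hp ha
  simp [betaMean]

theorem integral_sqrt_pow_betaMeasure {p a : ℝ} (hp : 0 < p) (ha : 0 < a) (k : ℕ) :
    ∫ s, √s ^ k ∂(betaMeasure p a) = beta (p + k / 2) a / beta p a := by
  have hq : 0 < p + (k : ℝ) / 2 := by positivity
  have := isProbabilityMeasureBeta hq ha
  have h := integral_rpow_smul_betaMeasure hp ha hq (fun _ => (1 : ℝ))
  rw [integral_const, probReal_univ, one_smul, smul_eq_mul, mul_one] at h
  rw [← h]
  refine integral_congr_ae ?_
  filter_upwards [ae_betaMeasure p a] with s hs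
  rw [smul_eq_mul, mul_one, sqrt_eq_rpow, ← rpow_natCast, ← rpow_mul hs.1.le]
  congr 1
  ring

/-- On monomials the law is an identity between Gamma quotients. Linearity extends it to polynomials
and Weierstrass approximation to continuous g, because averages over probability measures do not
increase the uniform norm. -/
theorem betaMean_betaMean_real {p a b : ℝ} (hp : 0 < p) (ha : 0 < a) (hb : 0 < b) {g : ℝ → ℝ}
    (hg : Continuous g) :
    betaMean (p + a) b (betaMean p a g) 1 = betaMean p (a + b) g 1 := by
  have hpa : 0 < p + a := add_pos hp ha
  have hab : 0 < a + b := add_pos ha hb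
  have := isProbabilityMeasureBeta hp ha
  have := isProbabilityMeasureBeta hpa hb
  have := isProbabilityMeasureBeta hp hab
  have hadd : ∀ {p a : ℝ}, 0 < p → 0 < a → ∀ {g h : ℝ → ℝ}, Continuous g → Continuous h →
      betaMean p a (fun x => g x + h x) = fun t => betaMean p a g t + betaMean p a h t :=
    fun hp ha g h hg hh => funext fun t =>
      integral_add (integrable_comp_sqrt hp ha hg t) (integrable_comp_sqrt hp ha hh t)
  have hpoly : ∀ P : Polynomial ℝ, betaMean (p + a) b (betaMean p a P.eval) 1 =
      betaMean p (a + b) P.eval 1 := fun P => by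
    induction P using Polynomial.induction_on' with
    | add P Q hP hQ =>
      have e : (fun x => (P + Q).eval x) = fun x => P.eval x + Q.eval x :=
        funext fun x => Polynomial.eval_add
      have e' : (P + Q).eval = fun x => P.eval x + Q.eval x := e
      rw [e', hadd hp ha P.continuous Q.continuous, hadd hp hab P.continuous Q.continuous,
        hadd hpa hb (continuous_betaMean hp ha P.continuous)
          (continuous_betaMean hp ha Q.continuous)]
      simp only
      rw [hP, hQ]
    | monomial k c =>
      have e : ∀ {p a : ℝ}, 0 < p → 0 < a → ∀ t,
          betaMean p a (fun x => c * x ^ k) t = c * (t ^ k * (beta (p + k / 2) a / beta p a)) :=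
        fun hp ha t => by
          simp only [betaMean, mul_pow]
          rw [integral_const_mul, integral_const_mul, integral_sqrt_pow_betaMeasure hp ha]
      have e' : (Polynomial.monomial k c).eval = fun x => c * x ^ k :=
        funext fun x => Polynomial.eval_monomial
      have e2 : betaMean p a (fun x => c * x ^ k) =
          fun t => (c * (beta (p + k / 2) a / beta p a)) * t ^ k :=
        funext fun t => by rw [e hp ha]; ring
      rw [e', e2, e hp hab]
      simp only [betaMean, mul_pow]
      rw [integral_const_mul, integral_const_mul, integral_sqrt_pow_betaMeasure hpa hb]
      simp only [beta]
      have hk : 0 < p + (k : ℝ) / 2 := by positivity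
      have h1 := (Gamma_pos_of_pos hp).ne'
      have h2 := (Gamma_pos_of_pos ha).ne'
      have h3 := (Gamma_pos_of_pos hb).ne'
      have h4 := (Gamma_pos_of_pos hab).ne'
      have h5 := (Gamma_pos_of_pos hpa).ne'
      have h6 := (Gamma_pos_of_pos (add_pos hk ha)).ne'
      have h7 := (Gamma_pos_of_pos (add_pos hpa hb)).ne'
      rw [show p + a + (k : ℝ) / 2 = p + k / 2 + a by ring,
        show p + k / 2 + (a + b) = p + (k : ℝ) / 2 + a + b by ring,
        show p + (a + b) = p + a + b by ring]
      field_simp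
  have hbound : ∀ {p a : ℝ}, 0 < p → 0 < a → ∀ {g h : ℝ → ℝ}, Continuous g → Continuous h →
      ∀ {ε : ℝ}, (∀ x ∈ Icc (0 : ℝ) 1, |g x - h x| ≤ ε) → ∀ t ∈ Icc (0 : ℝ) 1,
      |betaMean p a g t - betaMean p a h t| ≤ ε := fun {p a} hp ha g h hg hh ε hε t ht => by
    have := isProbabilityMeasureBeta hp ha
    rw [betaMean, betaMean, ← integral_sub (integrable_comp_sqrt hp ha hg t)
      (integrable_comp_sqrt hp ha hh t)]
    have h1 := norm_integral_le_of_norm_le_const (μ := betaMeasure p a) (C := ε)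
      (f := fun s => g (t * √s) - h (t * √s)) (by
        filter_upwards [ae_betaMeasure p a] with s hs
        refine hε _ ⟨mul_nonneg ht.1 (sqrt_nonneg s), mul_le_one₀ ht.2 (sqrt_nonneg s) ?_⟩
        rw [sqrt_le_one]; exact hs.2.le)
    simpa using h1
  refine eq_of_forall_dist_le fun ε hε => ?_
  obtain ⟨P, hP⟩ := exists_polynomial_near_of_continuousOn 0 1 g hg.continuousOn (ε / 2)
    (by positivity)
  have hP' : ∀ x ∈ Icc (0 : ℝ) 1, |g x - P.eval x| ≤ ε / 2 := fun x hx => by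
    rw [abs_sub_comm]; exact (hP x hx).le
  have h1 := hbound hpa hb (continuous_betaMean hp ha hg) (continuous_betaMean hp ha P.continuous)
    (hbound hp ha hg P.continuous hP') 1 ⟨zero_le_one, le_rfl⟩
  have h2 := hbound hp hab hg P.continuous hP' 1 ⟨zero_le_one, le_rfl⟩
  rw [hpoly] at h1
  rw [dist_eq]
  rw [abs_le] at h1 h2 ⊢
  constructor <;> linarith [h1.1, h1.2, h2.1, h2.2]

theorem betaMean_mul (p a : ℝ) (g : ℝ → F) (c t : ℝ) :
    betaMean p a (fun s => g (c * s)) t = betaMean p a g (c * t) := by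
  simp only [betaMean, mul_assoc]

/-- The semigroup property. -/
theorem betaMean_betaMean [CompleteSpace F] {p a b : ℝ} (hp : 0 < p) (ha : 0 < a) (hb : 0 < b)
    {g : ℝ → F} (hg : Continuous g) :
    betaMean (p + a) b (betaMean p a g) = betaMean p (a + b) g := by
  have hpa : 0 < p + a := add_pos hp ha
  have hab : 0 < a + b := add_pos ha hb
  have hc : ∀ (ℓ : F →L[ℝ] ℝ) {p a : ℝ}, 0 < p → 0 < a → ∀ {g : ℝ → F}, Continuous g → ∀ t,
      ℓ (betaMean p a g t) = betaMean p a (fun x => ℓ (g x)) t := fun ℓ p a hp ha g hg t =>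
    (ℓ.integral_comp_comm (integrable_comp_sqrt hp ha hg t)).symm
  funext t
  -- Continuous functionals reduce the claim to real functions, and the dilation by t moves the
  -- point of evaluation to 1.
  refine (SeparatingDual.eq_iff_forall_dual_eq (R := ℝ)).2 fun ℓ => ?_
  rw [hc ℓ hpa hb (continuous_betaMean hp ha hg), hc ℓ hp hab hg]
  have h := betaMean_betaMean_real (g := fun x => ℓ (g (t * x))) hp ha hb
    (ℓ.continuous.comp (hg.comp (by fun_prop)))
  have e1 := betaMean_mul p (a + b) (fun x => ℓ (g x)) t 1
  have e2 : betaMean p a (fun x => ℓ (g (t * x))) = fun s => betaMean p a (fun x => ℓ (g x)) (t * s) :=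
    funext fun s => betaMean_mul p a (fun x => ℓ (g x)) t s
  have e3 := betaMean_mul (p + a) b (betaMean p a fun x => ℓ (g x)) t 1
  rw [mul_one] at e1 e3
  rw [e2] at h
  rw [e1, e3] at h
  rw [← h]
  congr 1
  funext s
  exact hc ℓ hp ha hg s

end

/-! ### Erdélyi–Kober integrals and their inversion. -/

section
open ProbabilityTheory
variable {F : Type*} [NormedAddCommGroup F] [NormedSpace ℝ F]

/-- The substitution r = t√s gives t² - r² = t²(1 - s). All powers of t cancel, and the constant is
what normalizes the beta density. -/
theorem ekIntegral_eq_betaMean {η a : ℝ} (hη : 0 < η + 1) (ha : 0 < a) (φ : ℝ → F) {t : ℝ}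
    (ht : 0 < t) : ekIntegral η a φ t =
      (Gamma (η + 1) / Gamma (η + 1 + a)) • betaMean (η + 1) a φ t := by
  have h1 := intervalIntegral.integral_comp_mul_left (a := 0) (b := 1)
    (fun r : ℝ => ((t ^ 2 - r ^ 2) ^ (a - 1) * r ^ (2 * η + 1)) • φ r) ht.ne'
  rw [mul_zero, mul_one] at h1
  have h2 : ∫ r in (0 : ℝ)..t, ((t ^ 2 - r ^ 2) ^ (a - 1) * r ^ (2 * η + 1)) • φ r =
      t • ∫ x in (0 : ℝ)..1, ((t ^ 2 - (t * x) ^ 2) ^ (a - 1) * (t * x) ^ (2 * η + 1)) • φ (t * x) := by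
    rw [h1, smul_smul, mul_inv_cancel₀ ht.ne', one_smul]
  have h3 := integral_comp_rpow_Ioi_of_pos (p := 1 / 2) (g := (Iio (1 : ℝ)).indicator fun x : ℝ =>
    ((t ^ 2 - (t * x) ^ 2) ^ (a - 1) * (t * x) ^ (2 * η + 1)) • φ (t * x)) (by norm_num)
  rw [setIntegral_indicator measurableSet_Iio, Ioi_inter_Iio] at h3
  rw [ekIntegral, h2, intervalIntegral.integral_of_le zero_le_one, integral_Ioc_eq_integral_Ioo,
    ← h3, betaMean, integral_betaMeasure hη ha]
  have h4 : ∫ x in Ioi (0 : ℝ), ((1 / 2 : ℝ) * x ^ ((1 / 2 : ℝ) - 1)) •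
      (Iio (1 : ℝ)).indicator (fun x : ℝ =>
        ((t ^ 2 - (t * x) ^ 2) ^ (a - 1) * (t * x) ^ (2 * η + 1)) • φ (t * x)) (x ^ (1 / 2 : ℝ)) =
      ∫ s in Ioo (0 : ℝ) 1, (t ^ (2 * (a + η) - 1) / 2) •
        ((s ^ (η + 1 - 1) * (1 - s) ^ (a - 1)) • φ (t * √s)) := by
    rw [← Ioi_inter_Iio, ← setIntegral_indicator measurableSet_Iio]
    refine setIntegral_congr_fun measurableSet_Ioi fun s hs => ?_
    have hs0 : (0 : ℝ) < s := hs
    rw [← sqrt_eq_rpow]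
    by_cases h : s < 1
    · have h' : √s ∈ Iio (1 : ℝ) := by rw [mem_Iio, sqrt_lt' one_pos]; simpa using h
      rw [indicator_of_mem h', indicator_of_mem (mem_Iio.2 h), smul_smul, smul_smul]
      congr 1
      have e1 : t ^ 2 - (t * √s) ^ 2 = t ^ 2 * (1 - s) := by
        rw [mul_pow, sq_sqrt hs0.le]; ring
      rw [e1, mul_rpow (by positivity) (by linarith), mul_rpow ht.le (sqrt_nonneg s),
        ← rpow_natCast t 2, ← rpow_mul ht.le, sqrt_eq_rpow, ← rpow_mul hs0.le]
      have e2 : t ^ (2 * (a + η) - 1) = t ^ (((2 : ℕ) : ℝ) * (a - 1)) * t ^ (2 * η + 1) := by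
        rw [← rpow_add ht]; congr 1; push_cast; ring
      have e3 : s ^ (η + 1 - 1) = s ^ ((1 : ℝ) / 2 - 1) * s ^ (1 / 2 * (2 * η + 1)) := by
        rw [← rpow_add hs0]; congr 1; ring
      rw [e2, e3]
      ring
    · have h' : √s ∉ Iio (1 : ℝ) := by
        rw [mem_Iio, sqrt_lt' one_pos]; simpa using h
      rw [indicator_of_notMem h', indicator_of_notMem (by simpa using h), smul_zero]
  rw [h4, integral_smul, smul_smul, smul_smul, smul_smul]
  congr 1
  have e5 : t ^ (2 * (a + η) - 1) = (t ^ (-2 * (a + η)))⁻¹ * t⁻¹ := by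
    rw [← rpow_neg ht.le, ← rpow_neg_one t, ← rpow_add ht]
    congr 1; ring
  have e6 : t ^ (-2 * (a + η)) ≠ 0 := (rpow_pos_of_pos ht _).ne'
  have g1 := (Gamma_pos_of_pos hη).ne'
  have g2 := (Gamma_pos_of_pos ha).ne'
  have g3 := (Gamma_pos_of_pos (add_pos hη ha)).ne'
  rw [e5, beta]
  field_simp

/-- In order one the factor (t² - r²)^(a-1) disappears, and the function is 2p ∫₀ᵗ r^(2p-1) g(r) dr.
-/
theorem hasDerivAt_rpow_smul_betaMean_one [CompleteSpace F] {p : ℝ} (hp : 0 < p) {g : ℝ → F}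
    (hg : Continuous g) {t : ℝ} (ht : 0 < t) :
    HasDerivAt (fun t => t ^ (2 * p) • betaMean p 1 g t) ((2 * p * t ^ (2 * p - 1)) • g t) t := by
  have h1 : ∀ t : ℝ, 0 < t → (2 * p) • ∫ r in (0 : ℝ)..t, r ^ (2 * p - 1) • g r =
      t ^ (2 * p) • betaMean p 1 g t := fun t ht => by
    have h := ekIntegral_eq_betaMean (η := p - 1) (a := 1) (by linarith) one_pos g ht
    rw [ekIntegral, sub_add_cancel, Gamma_one, Gamma_add_one hp.ne'] at h
    simp only [sub_self, rpow_zero, one_mul, div_one] at h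
    have e1 : 2 * (p - 1) + 1 = 2 * p - 1 := by ring
    have e2 : -2 * (1 + (p - 1)) = -(2 * p) := by ring
    have e3 : Gamma p / (p * Gamma p) = p⁻¹ := by
      have := (Gamma_pos_of_pos hp).ne'
      field_simp
    rw [e1, e2, e3] at h
    have h' : betaMean p 1 g t =
        (p * (2 * t ^ (-(2 * p)))) • ∫ r in (0 : ℝ)..t, r ^ (2 * p - 1) • g r := by
      rw [mul_smul, h, smul_smul, mul_inv_cancel₀ hp.ne', one_smul]
    rw [h', smul_smul, rpow_neg ht.le]
    congr 1
    have := (rpow_pos_of_pos ht (2 * p)).ne'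
    field_simp
  have hi : IntervalIntegrable (fun r : ℝ => r ^ (2 * p - 1) • g r) volume 0 t :=
    (intervalIntegral.intervalIntegrable_rpow' (by linarith)).smul_continuousOn hg.continuousOn
  have hc : ∀ r : ℝ, 0 < r → ContinuousAt (fun r : ℝ => r ^ (2 * p - 1) • g r) r := fun r hr =>
    (continuousAt_rpow_const r _ (Or.inl hr.ne')).smul hg.continuousAt
  have hd := intervalIntegral.integral_hasDerivAt_right hi
    ((ContinuousOn.stronglyMeasurableAtFilter (s := Ioi 0) isOpen_Ioi
      (fun r hr => (hc r hr).continuousWithinAt)) t ht) (hc t ht)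
  have := hd.const_smul (2 * p)
  rw [smul_smul] at this
  refine this.congr_of_eventuallyEq ?_
  filter_upwards [Ioi_mem_nhds ht] with s hs
  rw [Pi.smul_apply, h1 s hs]

theorem opD_iterate_congr {h h' : ℝ → F} (hh : ∀ t, 0 < t → h t = h' t) (m : ℕ) {t : ℝ}
    (ht : 0 < t) : opD^[m] h t = opD^[m] h' t := by
  induction m generalizing t with
  | zero => exact hh t ht
  | succ m ih =>
    rw [Function.iterate_succ_apply', Function.iterate_succ_apply', opD, opD]
    have : opD^[m] h =ᶠ[nhds t] opD^[m] h' := by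
      filter_upwards [Ioi_mem_nhds ht] with s hs using ih hs
    rw [this.deriv_eq]

theorem opD_iterate_const_smul (c : ℝ) (h : ℝ → F) (m : ℕ) :
    opD^[m] (fun t => c • h t) = fun t => c • opD^[m] h t := by
  induction m with
  | zero => rfl
  | succ m ih =>
    rw [Function.iterate_succ_apply', ih]
    funext t
    rw [Function.iterate_succ_apply', opD, opD, deriv_fun_const_smul_field, smul_comm]

theorem opD_rpow_smul_betaMean_one [CompleteSpace F] {p : ℝ} (hp : 0 < p) {g : ℝ → F}
    (hg : Continuous g) {t : ℝ} (ht : 0 < t) :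
    opD (fun t => t ^ (2 * p) • betaMean p 1 g t) t = p • t ^ (2 * (p - 1)) • g t := by
  rw [opD, (hasDerivAt_rpow_smul_betaMean_one hp hg ht).deriv, smul_smul, smul_smul]
  congr 1
  have : t ^ (2 * p - 1) = t ^ (2 * (p - 1)) * t := by
    rw [← rpow_add_one ht.ne']; congr 1; ring
  rw [this]
  field_simp

/-- `D ^ m` inverts the integral of order `m`. -/
theorem opD_iterate_betaMean [CompleteSpace F] {p : ℝ} (hp : 0 < p) {g : ℝ → F}
    (hg : Continuous g) (m : ℕ) {t : ℝ} (ht : 0 < t) :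
    opD^[m + 1] (fun t => t ^ (2 * (p + m)) • betaMean p (m + 1) g t) t =
      (Gamma (p + (m + 1)) / Gamma p) • t ^ (2 * (p - 1)) • g t := by
  have g1 := (Gamma_pos_of_pos hp).ne'
  induction m generalizing t with
  | zero =>
    have := opD_rpow_smul_betaMean_one hp hg ht
    simp only [Nat.cast_zero, add_zero, zero_add, Function.iterate_one]
    rw [this, Gamma_add_one hp.ne']
    congr 1
    field_simp
  | succ m ih =>
    have hpm : (0 : ℝ) < p + (m + 1) := by positivity
    have h1 : ∀ t, 0 < t → opD (fun t => t ^ (2 * (p + (m + 1 : ℕ))) •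
        betaMean p ((m + 1 : ℕ) + 1) g t) t =
        (p + (m + 1)) • (t ^ (2 * (p + m)) • betaMean p (m + 1) g t) := fun t ht => by
      push_cast
      -- The semigroup law splits off the outermost integral of order one, which D removes.
      rw [← betaMean_betaMean hp (show (0 : ℝ) < m + 1 by positivity) one_pos hg,
        opD_rpow_smul_betaMean_one hpm
        (continuous_betaMean hp (show (0 : ℝ) < m + 1 by positivity) hg) ht]
      congr 3
      ring
    rw [Function.iterate_succ_apply, opD_iterate_congr h1 _ ht, opD_iterate_const_smul]
    simp only
    rw [ih ht, smul_smul]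
    congr 1
    push_cast
    rw [show p + ((m : ℝ) + 1 + 1) = p + (m + 1) + 1 by ring, Gamma_add_one hpm.ne']
    ring

/-- Composition with a further integral raises the order to an integer, and integer orders are
inverted by iterates of D. -/
theorem betaMean_injective [CompleteSpace F] {p a : ℝ} (hp : 0 < p) (ha : 0 < a) {g h : ℝ → F}
    (hg : Continuous g) (hh : Continuous h)
    (hgh : ∀ t, 0 < t → betaMean p a g t = betaMean p a h t) {t : ℝ} (ht : 0 < t) : g t = h t := by
  obtain ⟨m, hm⟩ := exists_nat_gt a
  have hb : 0 < (m : ℝ) + 1 - a := by linarith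
  have e : a + ((m : ℝ) + 1 - a) = m + 1 := by ring
  have h1 : ∀ t, 0 < t → betaMean p (m + 1) g t = betaMean p (m + 1) h t := fun t ht => by
    rw [← e, ← betaMean_betaMean hp ha hb hg, ← betaMean_betaMean hp ha hb hh]
    exact betaMean_congr ht fun s hs => hgh s hs.1
  have h2 := opD_iterate_betaMean hp hg m ht
  rw [opD_iterate_congr (fun t ht => by rw [h1 t ht]) _ ht, opD_iterate_betaMean hp hh m ht] at h2
  have g1 := Gamma_pos_of_pos hp
  have g2 := Gamma_pos_of_pos (show (0 : ℝ) < p + (m + 1) by positivity)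
  have h3 := rpow_pos_of_pos ht (2 * (p - 1))
  exact (smul_right_injective F h3.ne' (smul_right_injective F (div_pos g2 g1).ne' h2)).symm

theorem ekIntegral_congr {η a t : ℝ} (ht : 0 < t) {φ ψ : ℝ → F} (h : ∀ s, 0 < s → φ s = ψ s) :
    ekIntegral η a φ t = ekIntegral η a ψ t := by
  rw [ekIntegral, ekIntegral]
  congr 1
  rw [intervalIntegral.integral_of_le ht.le, intervalIntegral.integral_of_le ht.le]
  exact setIntegral_congr_fun measurableSet_Ioc fun s hs => by rw [h s hs.1]

theorem ekOp_congr {η a t : ℝ} (ht : 0 < t) {φ ψ : ℝ → F} (h : ∀ s, 0 < s → φ s = ψ s) :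
    ekOp η a φ t = ekOp η a ψ t := by
  rw [ekOp, ekOp]
  split_ifs
  · exact ekIntegral_congr ht h
  · congr 1
    exact opD_iterate_congr (fun s hs => by rw [ekIntegral_congr hs h]) _ ht

/-- The operator `I_{η+α}^{-α}`, of either sign of `α`, inverts the integral of order `α`, in the
sense of the integrated relation of some natural order. -/
theorem ekOp_eq_of_betaMean_eq [CompleteSpace F] {η α : ℝ} (hη : 0 < η + 1) (hα : 0 < η + 1 + α)
    {u g : ℝ → F} (hu : Continuous u) (hg : Continuous g)
    (h : ∀ M : ℕ, 0 < M → 0 < α + M → ∀ t, 0 < t →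
      betaMean (η + 1 + α) M u t = betaMean (η + 1) (α + M) g t) {t : ℝ} (ht : 0 < t) :
    ekOp (η + α) (-α) u t = (Gamma (η + 1 + α) / Gamma (η + 1)) • g t := by
  have e0 : η + α + 1 = η + 1 + α := by ring
  rw [ekOp]
  split_ifs with hneg
  · have e1 : η + 1 + α + -α = η + 1 := by ring
    rw [ekIntegral_eq_betaMean (by linarith) hneg u ht, e0, e1]
    congr 1
    -- Here α < 0 and the operator is an integral of order -α. A further integral of order α + m > 0
    -- brings the total order to m, where the hypothesis applies; injectivity then removes it.
    obtain ⟨m, hm⟩ := exists_nat_gt (-α)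
    have hM : 0 < α + (m : ℝ) := by linarith
    have hm0 : 0 < m := by
      have : (0 : ℝ) < m := by linarith
      exact_mod_cast this
    refine betaMean_injective hη hM (continuous_betaMean hα hneg hu) hg (fun t ht => ?_) ht
    rw [← h m hm0 hM t ht]
    have := betaMean_betaMean hα hneg hM hu
    rw [e1, neg_add_cancel_left] at this
    rw [this]
  · have hα0 : 0 ≤ α := by linarith
    rw [neg_neg]
    set k := ⌊α⌋₊ with hk
    have hlt : α < k + 1 := Nat.lt_floor_add_one α
    have hb : 0 < -α + ((k + 1 : ℕ) : ℝ) := by push_cast; linarith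
    have hk1 : (0 : ℝ) < k + 1 := by positivity
    -- The fractional derivative starts from an integral of order k + 1 - α, for which the
    -- hypothesis gives nothing directly. A further integral of order α + 1 leads to the integer
    -- order k + 2, and injectivity leads back.
    have key : ∀ t, 0 < t → betaMean (η + 1 + α) (-α + ((k + 1 : ℕ) : ℝ)) u t =
        betaMean (η + 1) (k + 1) g t := fun t ht => by
      have hM : 0 < α + 1 := by linarith
      refine betaMean_injective (p := η + 1 + (k + 1)) (a := α + 1) (by linarith) hM
        (continuous_betaMean hα hb hu) (continuous_betaMean hη hk1 hg)
        (fun t ht => ?_) ht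
      have h1 := betaMean_betaMean hα hb hM hu
      have h2 := betaMean_betaMean hη hk1 hM hg
      have e2 : η + 1 + α + (-α + ((k + 1 : ℕ) : ℝ)) = η + 1 + (k + 1) := by push_cast; ring
      have e3 : -α + ((k + 1 : ℕ) : ℝ) + (α + 1) = ((k + 2 : ℕ) : ℝ) := by push_cast; ring
      have e4 : (k : ℝ) + 1 + (α + 1) = α + ((k + 2 : ℕ) : ℝ) := by push_cast; ring
      rw [e2, e3] at h1
      rw [e4] at h2
      rw [h1, h2]
      exact h (k + 2) (by omega) (by push_cast; linarith) t ht
    have h5 : ∀ t, 0 < t → t ^ (2 * (-α + ((k + 1 : ℕ) : ℝ) + (η + α))) •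
        ekIntegral (η + α) (-α + ((k + 1 : ℕ) : ℝ)) u t =
        (Gamma (η + 1 + α) / Gamma (η + 1 + (k + 1))) •
          (t ^ (2 * (η + 1 + k)) • betaMean (η + 1) (k + 1) g t) := fun t ht => by
      rw [ekIntegral_eq_betaMean (by linarith) hb u ht, e0, key t ht, smul_comm,
        show η + 1 + α + (-α + ((k + 1 : ℕ) : ℝ)) = η + 1 + (k + 1) by push_cast; ring,
        show -α + ((k + 1 : ℕ) : ℝ) + (η + α) = η + 1 + k by push_cast; ring]
    rw [opD_iterate_congr h5 _ ht, opD_iterate_const_smul]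
    simp only
    rw [opD_iterate_betaMean hη hg k ht, smul_smul, smul_smul, smul_smul]
    congr 1
    have e6 : t ^ (2 * (η + 1 - 1)) = (t ^ (-2 * (-α + (η + α))))⁻¹ := by
      rw [← rpow_neg ht.le]; congr 1; ring
    have g1 := (Gamma_pos_of_pos hη).ne'
    have g2 := (Gamma_pos_of_pos (show 0 < η + 1 + (k + 1) by linarith)).ne'
    have g3 := (rpow_pos_of_pos ht (-2 * (-α + (η + α)))).ne'
    rw [e6]
    field_simp

end

/-! ### Darboux's equation for spherical means. -/

section
open ProbabilityTheory
variable {F : Type*} [NormedAddCommGroup F] [NormedSpace ℝ F] {n : ℕ}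

/-- The square makes the truncation differentiable at its edge with a continuous derivative, as
needed for weights in Green's formula and for the cone cutoff. -/
theorem hasDerivAt_sq_max (s : ℝ) : HasDerivAt (fun s : ℝ => max 0 s ^ 2) (2 * max 0 s) s := by
  rcases lt_trichotomy s 0 with h | h | h
  · rw [max_eq_left h.le, mul_zero]
    refine (hasDerivAt_const s (0 : ℝ)).congr_of_eventuallyEq ?_
    filter_upwards [Iio_mem_nhds h] with x hx
    rw [max_eq_left (mem_Iio.1 hx).le]; simp
  · subst h
    rw [max_self, mul_zero, hasDerivAt_iff_isLittleO]
    simp only [max_self, sub_zero, smul_zero, ne_eq, OfNat.ofNat_ne_zero, not_false_eq_true,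
      zero_pow]
    have : (fun x : ℝ => max 0 x ^ 2) =O[nhds 0] fun x => x ^ 2 :=
      Asymptotics.IsBigO.of_bound 1 (.of_forall fun x => by
        rw [one_mul, norm_pow, norm_pow, norm_eq_abs, norm_eq_abs]
        refine pow_le_pow_left₀ (abs_nonneg _) ?_ 2
        rw [abs_of_nonneg (le_max_left _ _)]
        exact max_le (abs_nonneg x) (le_abs_self x))
    exact this.trans_isLittleO (Asymptotics.isLittleO_pow_id one_lt_two)
  · rw [max_eq_right h.le]
    have : HasDerivAt (fun s : ℝ => s ^ 2) (2 * s) s := by simpa using hasDerivAt_pow 2 s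
    refine this.congr_of_eventuallyEq ?_
    filter_upwards [Ioi_mem_nhds h] with x hx
    rw [max_eq_right (mem_Ioi.1 hx).le]

/-- In the derivative with respect to T the boundary terms cancel and 2T ∫₀ᵀ Z is left. A second
differentiation isolates Z. -/
theorem eq_zero_of_integral_sq_sub_smul [CompleteSpace F] {Z : ℝ → F} (hZ : Continuous Z)
    (h : ∀ T, 0 < T → ∫ r in (0 : ℝ)..T, (T ^ 2 - r ^ 2) • Z r = 0) {t : ℝ} (ht : 0 < t) :
    Z t = 0 := by
  have hZ2 : Continuous fun r : ℝ => r ^ 2 • Z r := by fun_prop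
  have h1 : ∀ T, 0 < T → ∫ r in (0 : ℝ)..T, Z r = 0 := fun T hT => by
    have hd := ((hasDerivAt_pow 2 T).smul (hZ.integral_hasStrictDerivAt 0 T).hasDerivAt).sub
      (hZ2.integral_hasStrictDerivAt 0 T).hasDerivAt
    have hZ3 : ∀ T : ℝ, Continuous fun r : ℝ => T ^ 2 • Z r := fun T => by fun_prop
    have h0 : (fun T => T ^ 2 • (∫ r in (0 : ℝ)..T, Z r) - ∫ r in (0 : ℝ)..T, r ^ 2 • Z r)
        =ᶠ[nhds T] fun _ => 0 := by
      filter_upwards [Ioi_mem_nhds hT] with T hT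
      rw [← h T hT, ← intervalIntegral.integral_smul, ← intervalIntegral.integral_sub
        ((hZ3 T).intervalIntegrable _ _) (hZ2.intervalIntegrable _ _)]
      simp only [sub_smul]
    have h2 := hd.unique ((hasDerivAt_const T (0 : F)).congr_of_eventuallyEq h0)
    simp only [add_sub_cancel_left] at h2
    have h3 : ((2 : ℕ) : ℝ) * T ^ (2 - 1) ≠ 0 := by
      have := hT.ne'
      simp [this]
    exact (smul_eq_zero.1 h2).resolve_left h3
  have hd := (hZ.integral_hasStrictDerivAt 0 t).hasDerivAt
  refine hd.unique ((hasDerivAt_const t (0 : F)).congr_of_eventuallyEq ?_)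
  filter_upwards [Ioi_mem_nhds ht] with T hT using h1 T hT

theorem hasDerivAt_sphMean {f : EuclideanSpace ℝ (Fin n) → F} (hf : ContDiff ℝ ∞ f)
    (x : EuclideanSpace ℝ (Fin n)) (t : ℝ) :
    HasDerivAt (sphMean f x) (((volume : Measure (EuclideanSpace ℝ (Fin n))).toSphere.real univ)⁻¹ •
      ∫ θ : sphere (0 : EuclideanSpace ℝ (Fin n)) 1,
        fderiv ℝ f (x + t • (θ : EuclideanSpace ℝ (Fin n))) θ
        ∂(volume : Measure (EuclideanSpace ℝ (Fin n))).toSphere) t := by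
  have hc := hf.continuous_fderiv (by simp)
  have h := hasDerivAt_setIntegral_smul
    (μ := (volume : Measure (EuclideanSpace ℝ (Fin n))).toSphere) (K := univ) (w := fun _ => 1)
    (U := univ) (Φ := fun t θ => f (x + t • (θ : EuclideanSpace ℝ (Fin n))))
    (Φ' := fun t θ => fderiv ℝ f (x + t • (θ : EuclideanSpace ℝ (Fin n))) θ)
    isCompact_univ (by simp) isOpen_univ ?_ ?_ (fun t _ θ _ => ?_) (mem_univ t)
  · simp only [one_smul, Measure.restrict_univ] at h
    exact h.const_smul _
  · have : Continuous fun q : ℝ × sphere (0 : EuclideanSpace ℝ (Fin n)) 1 =>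
      f (x + q.1 • (q.2 : EuclideanSpace ℝ (Fin n))) := hf.continuous.comp (by fun_prop)
    exact this.continuousOn
  · have : Continuous fun q : ℝ × sphere (0 : EuclideanSpace ℝ (Fin n)) 1 =>
      fderiv ℝ f (x + q.1 • (q.2 : EuclideanSpace ℝ (Fin n))) q.2 :=
        (hc.comp (by fun_prop)).clm_apply (by fun_prop)
    exact this.continuousOn
  · have h2 : HasDerivAt (fun t : ℝ => x + t • (θ : EuclideanSpace ℝ (Fin n))) θ t := by
      simpa using ((hasDerivAt_id t).smul_const (θ : EuclideanSpace ℝ (Fin n))).const_add x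
    exact (hf.differentiable (by simp) _).hasFDerivAt.comp_hasDerivAt t h2

theorem integral_radial_smul_sphere [CompleteSpace F] (hn : 1 ≤ n)
    {G : EuclideanSpace ℝ (Fin n) → F} {w : ℝ → ℝ} (hw : Continuous w) (hG : Continuous G) {T : ℝ}
    (hT : 0 ≤ T) (hwT : ∀ r, T ≤ r → w r = 0) :
    ∫ y, w ‖y‖ • G y = ∫ r in (0 : ℝ)..T, (r ^ (n - 1) * w r) •
      ∫ θ : sphere (0 : EuclideanSpace ℝ (Fin n)) 1, G (r • (θ : EuclideanSpace ℝ (Fin n)))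
        ∂(volume : Measure (EuclideanSpace ℝ (Fin n))).toSphere := by
  have : Nonempty (Fin n) := ⟨⟨0, hn⟩⟩
  have hi : Integrable fun y => w ‖y‖ • G y := by
    refine Continuous.integrable_of_hasCompactSupport (by fun_prop)
      (HasCompactSupport.intro (isCompact_closedBall 0 T) fun y hy => ?_)
    rw [mem_closedBall_zero_iff, not_le] at hy
    rw [hwT _ hy.le, zero_smul]
  rw [integral_eq_integral_sphere _ hi, intervalIntegral.integral_of_le hT]
  symm
  have h1 : ∀ r ∈ Ioi (0 : ℝ), r ^ (Module.finrank ℝ (EuclideanSpace ℝ (Fin n)) - 1) •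
      ∫ θ : sphere (0 : EuclideanSpace ℝ (Fin n)) 1, w ‖r • (θ : EuclideanSpace ℝ (Fin n))‖ •
        G (r • (θ : EuclideanSpace ℝ (Fin n)))
        ∂(volume : Measure (EuclideanSpace ℝ (Fin n))).toSphere =
      (r ^ (n - 1) * w r) •
      ∫ θ : sphere (0 : EuclideanSpace ℝ (Fin n)) 1, G (r • (θ : EuclideanSpace ℝ (Fin n)))
        ∂(volume : Measure (EuclideanSpace ℝ (Fin n))).toSphere := fun r hr => by
    have h2 : ∀ θ : sphere (0 : EuclideanSpace ℝ (Fin n)) 1,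
        ‖r • (θ : EuclideanSpace ℝ (Fin n))‖ = r := fun θ => by
      rw [norm_smul, norm_eq_of_mem_sphere, mul_one, norm_of_nonneg (mem_Ioi.1 hr).le]
    simp_rw [h2]
    rw [integral_smul, smul_smul, finrank_euclideanSpace_fin]
  rw [setIntegral_congr_fun measurableSet_Ioi h1]
  refine (setIntegral_eq_of_subset_of_forall_sdiff_eq_zero measurableSet_Ioi
      Ioc_subset_Ioi_self fun r hr => ?_).symm
  have h4 : T ≤ r := by
    by_contra h; exact hr.2 ⟨hr.1, (not_le.1 h).le⟩
  rw [hwT r h4, mul_zero, zero_smul]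

theorem contDiff_sphMean_right {f : EuclideanSpace ℝ (Fin n) → F} (hf : ContDiff ℝ ∞ f)
    (x : EuclideanSpace ℝ (Fin n)) : ContDiff ℝ ∞ (sphMean f x) := by
  have h : ContDiff ℝ ∞ fun t : ℝ => (x, t) := by fun_prop
  have h2 := (contDiff_sphMean hf).comp h
  exact h2

/-- The divergence theorem for spherical means. -/
theorem deriv_sphMean_eq [CompleteSpace F] (hn : 1 ≤ n) {f : EuclideanSpace ℝ (Fin n) → F}
    (hf : ContDiff ℝ ∞ f) (hfs : HasCompactSupport f) (x : EuclideanSpace ℝ (Fin n)) {t : ℝ}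
    (ht : 0 < t) : t ^ (n - 1) • deriv (sphMean f x) t =
      ∫ r in (0 : ℝ)..t, r ^ (n - 1) • sphMean (Laplacian.laplacian f) x r := by
  set σ := (volume : Measure (EuclideanSpace ℝ (Fin n))).toSphere.real univ with hσ
  have hσ0 : σ ≠ 0 := (toSphere_real_univ_pos hn).ne'
  set h := sphMean (Laplacian.laplacian f) x with hh
  have hhc : Continuous h := (contDiff_sphMean_right hf.laplacian_infty x).continuous
  have hqs : ContDiff ℝ ∞ (sphMean f x) := contDiff_sphMean_right hf x
  have hqc : Continuous (deriv (sphMean f x)) := hqs.continuous_deriv (by simp)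
  set g : EuclideanSpace ℝ (Fin n) → F := fun y => f (x + y) with hg
  have hgc : ContDiff ℝ ∞ g := hf.comp (by fun_prop)
  have hgs : HasCompactSupport g := by
    have := hfs.comp_homeomorph (Homeomorph.addLeft x)
    exact this
  have hgL : ∀ y, Laplacian.laplacian g y = Laplacian.laplacian f (x + y) := fun y => by
    have h1 := laplacian_comp_sub (f := fun y => f (x - y)) (hf.comp (by fun_prop)) 0 y
    have h2 := laplacian_comp_sub hf x (0 - y)
    simp only [zero_sub, sub_neg_eq_add] at h1 h2
    rw [h1, h2]
  have hgf : ∀ y, fderiv ℝ g y = fderiv ℝ f (x + y) := fun y => by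
    rw [hg, fderiv_comp_add_left]
  set H : ℝ → F := fun t => ∫ r in (0 : ℝ)..t, r ^ (n - 1) • h r with hH
  have hHc' : Continuous fun r : ℝ => r ^ (n - 1) • h r := by fun_prop
  have hHd : ∀ t, HasDerivAt H (t ^ (n - 1) • h t) t := fun t =>
    (hHc'.integral_hasStrictDerivAt 0 t).hasDerivAt
  have hHc : Continuous H := continuous_iff_continuousAt.2 fun t => (hHd t).continuousAt
  -- Differentiating the weight (T² - r²)² produces the factor r in Z and leaves the kernel T² - r²
  -- on both sides. The identity on spheres is recovered from its averages over all T.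
  have key := eq_zero_of_integral_sq_sub_smul
    (Z := fun r => r • (H r - r ^ (n - 1) • deriv (sphMean f x) r))
    (by fun_prop) (fun T hT => ?_) ht
  · have := (smul_eq_zero.1 key).resolve_left ht.ne'
    exact (sub_eq_zero.1 this).symm
  -- The weight is C¹ and vanishes outside the ball of radius T, so Green's formula has no boundary
  -- term.
  have hgreen := integral_comp_norm_sq_smul_laplacian
    (W := fun s => max 0 (T ^ 2 - s) ^ 2) (W' := fun s => -(2 * max 0 (T ^ 2 - s)))
    (fun s _ => ?_) (by fun_prop) hgc hgs
  swap
  · have h1 := (hasDerivAt_sq_max (T ^ 2 - s)).comp s ((hasDerivAt_id s).const_sub (T ^ 2))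
    refine h1.congr_deriv ?_
    ring
  have hTz : ∀ r, T ≤ r → max 0 (T ^ 2 - r ^ 2) = 0 := fun r hr =>
    max_eq_left (by nlinarith)
  have hL := integral_radial_smul_sphere hn (G := Laplacian.laplacian g)
    (w := fun r => max 0 (T ^ 2 - r ^ 2) ^ 2) (by fun_prop) hgc.laplacian_infty.continuous hT.le
    (fun r hr => by rw [hTz r hr]; simp)
  have hR := integral_radial_smul_sphere hn (G := fun y => fderiv ℝ g y y)
    (w := fun r => 2 * -(2 * max 0 (T ^ 2 - r ^ 2))) (by fun_prop)
    ((hgc.continuous_fderiv (by simp)).clm_apply continuous_id) hT.le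
    (fun r hr => by rw [hTz r hr]; simp)
  rw [hL, hR] at hgreen
  have e1 : ∀ r, ∫ θ : sphere (0 : EuclideanSpace ℝ (Fin n)) 1,
      Laplacian.laplacian g (r • (θ : EuclideanSpace ℝ (Fin n)))
        ∂(volume : Measure (EuclideanSpace ℝ (Fin n))).toSphere = σ • h r := fun r => by
    simp_rw [hgL]
    rw [hh, sphMean, smul_smul, mul_inv_cancel₀ hσ0, one_smul]
  have e2 : ∀ r, ∫ θ : sphere (0 : EuclideanSpace ℝ (Fin n)) 1,
      fderiv ℝ g (r • (θ : EuclideanSpace ℝ (Fin n))) (r • (θ : EuclideanSpace ℝ (Fin n)))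
        ∂(volume : Measure (EuclideanSpace ℝ (Fin n))).toSphere =
        σ • r • deriv (sphMean f x) r := fun r => by
    simp_rw [hgf, map_smul]
    rw [integral_smul, (hasDerivAt_sphMean hf x r).deriv, smul_comm σ, smul_smul σ,
      mul_inv_cancel₀ hσ0, one_smul]
  simp_rw [e1, e2] at hgreen
  have hmax : ∀ r ∈ uIcc 0 T, max 0 (T ^ 2 - r ^ 2) = T ^ 2 - r ^ 2 := fun r hr => by
    rw [uIcc_of_le hT.le] at hr
    exact max_eq_right (by nlinarith [hr.1, hr.2])
  -- Here H is the primitive of the right-hand side. The boundary terms vanish because H(0) = 0 and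
  -- the weight is zero at T.
  have hparts := intervalIntegral.integral_smul_deriv_eq_deriv_smul (a := 0) (b := T)
    (u := fun r : ℝ => (T ^ 2 - r ^ 2) ^ 2) (u' := fun r => -(4 * r * (T ^ 2 - r ^ 2))) (v := H)
    (v' := fun r => r ^ (n - 1) • h r) (fun r _ => ?_) (fun r _ => hHd r)
    ((by fun_prop : Continuous fun r : ℝ => -(4 * r * (T ^ 2 - r ^ 2))).intervalIntegrable _ _)
    (hHc'.intervalIntegrable _ _)
  swap
  · have h1 := ((hasDerivAt_pow 2 r).const_sub (T ^ 2)).pow 2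
    refine h1.congr_deriv ?_
    push_cast; ring
  have hH0 : H 0 = 0 := by simp [hH]
  simp only [sub_self, ne_eq, OfNat.ofNat_ne_zero, not_false_eq_true, zero_pow, zero_smul, hH0,
    smul_zero, zero_sub] at hparts
  have f1 : ∫ r in (0 : ℝ)..T, (r ^ (n - 1) * max 0 (T ^ 2 - r ^ 2) ^ 2) • σ • h r =
      σ • ∫ r in (0 : ℝ)..T, (T ^ 2 - r ^ 2) ^ 2 • r ^ (n - 1) • h r := by
    rw [← intervalIntegral.integral_smul]
    refine intervalIntegral.integral_congr fun r hr => ?_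
    rw [hmax r hr, smul_smul, smul_smul, smul_smul]
    congr 1; ring
  have f2 : ∫ r in (0 : ℝ)..T, (r ^ (n - 1) * (2 * -(2 * max 0 (T ^ 2 - r ^ 2)))) •
        σ • r • deriv (sphMean f x) r =
      -((σ * 4) • ∫ r in (0 : ℝ)..T, (T ^ 2 - r ^ 2) • r • r ^ (n - 1) •
        deriv (sphMean f x) r) := by
    rw [← intervalIntegral.integral_smul, ← intervalIntegral.integral_neg]
    refine intervalIntegral.integral_congr fun r hr => ?_
    rw [hmax r hr, smul_smul, smul_smul, smul_smul, smul_smul, smul_smul, ← neg_smul]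
    congr 1; ring
  have f3 : ∫ r in (0 : ℝ)..T, -(4 * r * (T ^ 2 - r ^ 2)) • H r =
      -((4 : ℝ) • ∫ r in (0 : ℝ)..T, (T ^ 2 - r ^ 2) • r • H r) := by
    rw [← intervalIntegral.integral_smul, ← intervalIntegral.integral_neg]
    refine intervalIntegral.integral_congr fun r hr => ?_
    rw [smul_smul, smul_smul, ← neg_smul]
    congr 1; ring
  rw [f1, f2, hparts, f3, neg_neg, neg_neg, smul_smul] at hgreen
  have h4 : σ * 4 ≠ 0 := by positivity
  have h5 := smul_right_injective F h4 hgreen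
  simp only [smul_sub]
  rw [intervalIntegral.integral_sub, h5, sub_self]
  · exact Continuous.intervalIntegrable (by fun_prop) _ _
  · exact Continuous.intervalIntegrable (by fun_prop) _ _

end

/-! ### The solution of the Euler–Poisson–Darboux equation. -/

section
open ProbabilityTheory
variable {F : Type*} [NormedAddCommGroup F] [NormedSpace ℝ F] {n : ℕ}

/-- Darboux's equation in normalized form. -/
theorem deriv_sphMean_eq_betaMean [CompleteSpace F] (hn : 1 ≤ n) {f : EuclideanSpace ℝ (Fin n) → F}
    (hf : ContDiff ℝ ∞ f) (hfs : HasCompactSupport f) (x : EuclideanSpace ℝ (Fin n)) {s : ℝ}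
    (hs : 0 ≤ s) : deriv (sphMean f x) s =
      (s / n) • betaMean ((n : ℝ) / 2) 1 (sphMean (Laplacian.laplacian f) x) s := by
  have hp : (0 : ℝ) < n / 2 := by positivity
  have hn0 : (n : ℝ) ≠ 0 := by positivity
  have hhc := (contDiff_sphMean_right hf.laplacian_infty x).continuous
  have hqc : Continuous (deriv (sphMean f x)) :=
    (contDiff_sphMean_right hf x).continuous_deriv (by simp)
  have hbc := continuous_betaMean hp one_pos hhc
  have key : EqOn (deriv (sphMean f x)) (fun s =>
      (s / n) • betaMean ((n : ℝ) / 2) 1 (sphMean (Laplacian.laplacian f) x) s) (Ioi 0) := by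
    intro t ht
    have ht : 0 < t := ht
    have h := ekIntegral_eq_betaMean (η := (n : ℝ) / 2 - 1) (a := 1) (by linarith) one_pos
      (sphMean (Laplacian.laplacian f) x) ht
    rw [ekIntegral, sub_add_cancel, Gamma_one, Gamma_add_one hp.ne'] at h
    simp only [sub_self, rpow_zero, one_mul, div_one] at h
    have e1 : 2 * ((n : ℝ) / 2 - 1) + 1 = ((n - 1 : ℕ) : ℝ) := by
      rw [Nat.cast_sub hn]; push_cast; ring
    have e2 : -2 * (1 + ((n : ℝ) / 2 - 1)) = -(n : ℝ) := by ring
    have e3 : Gamma ((n : ℝ) / 2) / (n / 2 * Gamma ((n : ℝ) / 2)) = 2 / n := by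
      have := (Gamma_pos_of_pos hp).ne'
      field_simp
    simp only [e1, e2, e3, rpow_natCast, rpow_neg ht.le] at h
    rw [← deriv_sphMean_eq hn hf hfs x ht, smul_smul] at h
    have e4 : 2 * (t ^ n)⁻¹ * t ^ (n - 1) = 2 / t := by
      obtain ⟨m, rfl⟩ : ∃ m, n = m + 1 := ⟨n - 1, by omega⟩
      rw [Nat.add_sub_cancel, pow_succ]
      field_simp
    rw [e4] at h
    have h2 := congrArg (fun z => (t / 2) • z) h
    simp only [smul_smul] at h2
    rw [show t / 2 * (2 / t) = 1 by field_simp, one_smul] at h2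
    rw [h2]
    simp only
    congr 1
    ring
  have := key.closure hqc (by fun_prop)
  rw [closure_Ioi] at this
  exact this hs

/-- Mean values of the spherical means: for `a > 0`, the solution of the Euler–Poisson–Darboux
equation with `α = a`. -/
noncomputable def epdBase (a : ℝ) (f : EuclideanSpace ℝ (Fin n) → F)
    (x : EuclideanSpace ℝ (Fin n)) (t : ℝ) : F :=
  betaMean ((n : ℝ) / 2) a (sphMean f x) t

theorem contDiff_epdBase (hn : 1 ≤ n) {a : ℝ} (ha : 0 < a) {f : EuclideanSpace ℝ (Fin n) → F}
    (hf : ContDiff ℝ ∞ f) :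
    ContDiff ℝ ∞ fun q : EuclideanSpace ℝ (Fin n) × ℝ => epdBase a f q.1 q.2 :=
  contDiff_betaMean (by positivity) ha (contDiff_sphMean hf)

/-- The chain rule gives a factor √s and Darboux's equation another one. Their product s shifts the
first beta parameter from n/2 to n/2 + 1, and the semigroup law merges the orders 1 and a into a +
1. -/
theorem hasDerivAt_epdBase [CompleteSpace F] (hn : 1 ≤ n) {a : ℝ} (ha : 0 < a)
    {f : EuclideanSpace ℝ (Fin n) → F} (hf : ContDiff ℝ ∞ f) (hfs : HasCompactSupport f)
    (x : EuclideanSpace ℝ (Fin n)) {t : ℝ} (ht : 0 ≤ t) :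
    HasDerivAt (epdBase a f x)
      ((t / (2 * a + n)) • epdBase (a + 1) (Laplacian.laplacian f) x t) t := by
  have hp : (0 : ℝ) < n / 2 := by positivity
  have hn0 : (0 : ℝ) < n := by positivity
  have hg := contDiff_sphMean_right hf x
  have hhc := (contDiff_sphMean_right hf.laplacian_infty x).continuous
  refine (hasDerivAt_betaMean hp ha (hg.of_le (by simp)) t).congr_deriv ?_
  set h := sphMean (Laplacian.laplacian f) x with hh
  have e1 : ∫ s, √s • deriv (sphMean f x) (t * √s) ∂(betaMeasure ((n : ℝ) / 2) a) =
      ∫ s, (t / n) • s ^ (1 : ℝ) • betaMean ((n : ℝ) / 2) 1 h (t * √s)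
        ∂(betaMeasure ((n : ℝ) / 2) a) := by
    refine integral_congr_ae ?_
    filter_upwards [ae_betaMeasure ((n : ℝ) / 2) a] with s hs
    rw [deriv_sphMean_eq_betaMean hn hf hfs x (by positivity), smul_smul, smul_smul, rpow_one]
    congr 1
    have := mul_self_sqrt hs.1.le
    linear_combination (t / n) * this
  rw [e1, integral_smul, integral_rpow_smul_betaMeasure hp ha (by positivity), smul_smul]
  rw [epdBase, add_comm a 1, ← betaMean_betaMean hp one_pos ha hhc]
  rw [betaMean.eq_1 ((n : ℝ) / 2 + 1)]
  congr 1
  have g1 := (Gamma_pos_of_pos hp).ne'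
  have g2 := (Gamma_pos_of_pos ha).ne'
  have g3 := (Gamma_pos_of_pos (add_pos hp ha)).ne'
  have g4 : (n : ℝ) / 2 + a ≠ 0 := by positivity
  have g5 : 2 * a + n ≠ 0 := by positivity
  rw [beta, beta, add_right_comm, Gamma_add_one hp.ne', Gamma_add_one g4]
  field_simp
  ring

theorem epdBase_zero [CompleteSpace F] (hn : 1 ≤ n) {a : ℝ} (ha : 0 < a)
    (f : EuclideanSpace ℝ (Fin n) → F) (x : EuclideanSpace ℝ (Fin n)) :
    epdBase a f x 0 = f x := by
  rw [epdBase, betaMean_zero (by positivity) ha, sphMean_zero hn]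

/-- The function t^(2a+n) times the solution of parameter a + 1 is differentiated in two ways: as an
integral of order one of the solution of parameter a, and by the product rule. Comparison gives the
descent relation, whose right-hand side makes sense for smaller a. -/
theorem epdBase_eq [CompleteSpace F] (hn : 1 ≤ n) {a : ℝ} (ha : 0 < a)
    {f : EuclideanSpace ℝ (Fin n) → F} (hf : ContDiff ℝ ∞ f) (hfs : HasCompactSupport f)
    (x : EuclideanSpace ℝ (Fin n)) {t : ℝ} (ht : 0 ≤ t) :
    epdBase a f x t = epdBase (a + 1) f x t +
      (t ^ 2 / ((2 * a + n) * (2 * a + n + 2))) •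
        epdBase (a + 2) (Laplacian.laplacian f) x t := by
  rcases ht.eq_or_lt with rfl | ht
  · rw [epdBase_zero hn ha, epdBase_zero hn (by positivity)]
    simp
  have hp : (0 : ℝ) < n / 2 := by positivity
  have hpa : (0 : ℝ) < n / 2 + a := by positivity
  have hg := (contDiff_sphMean_right hf x).continuous
  have h1 := hasDerivAt_rpow_smul_betaMean_one hpa (continuous_betaMean hp ha hg) ht
  have e1 : betaMean ((n : ℝ) / 2 + a) 1 (betaMean ((n : ℝ) / 2) a (sphMean f x)) =
      epdBase (a + 1) f x := betaMean_betaMean hp ha one_pos hg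
  rw [e1] at h1
  have h2 := (hasDerivAt_rpow_const (p := 2 * ((n : ℝ) / 2 + a)) (Or.inl ht.ne')).smul
    (hasDerivAt_epdBase hn (by positivity : 0 < a + 1) hf hfs x ht.le)
  have h3 := h1.unique h2
  set q := 2 * ((n : ℝ) / 2 + a) with hq
  have hq0 : 0 < q := by positivity
  have e2 : t ^ q = t ^ (q - 1) * t := by
    rw [← rpow_add_one ht.ne']; congr 1; ring
  have e3 : 2 * (a + 1) + (n : ℝ) = q + 2 := by rw [hq]; ring
  have e4 : 2 * a + (n : ℝ) = q := by rw [hq]; ring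
  have hc : q * t ^ (q - 1) ≠ 0 := (mul_pos hq0 (rpow_pos_of_pos ht _)).ne'
  refine smul_right_injective F hc ?_
  simp only [smul_add, smul_smul]
  change (q * t ^ (q - 1)) • betaMean ((n : ℝ) / 2) a (sphMean f x) t = _
  rw [h3, add_comm, e2, e3, e4, smul_smul, add_assoc a 1 1, one_add_one_eq_two]
  congr 2
  field_simp

/-- The solution is a double average of translates of f, so the Laplacian passes to f. -/
theorem laplacian_epdBase [CompleteSpace F] (hn : 1 ≤ n) {a : ℝ} (ha : 0 < a)
    {f : EuclideanSpace ℝ (Fin n) → F} (hf : ContDiff ℝ ∞ f) (x : EuclideanSpace ℝ (Fin n))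
    (t : ℝ) : Laplacian.laplacian (fun x => epdBase a f x t) x =
      epdBase a (Laplacian.laplacian f) x t := by
  have hp : (0 : ℝ) < n / 2 := by positivity
  have := isProbabilityMeasureBeta hp ha
  set σ := (volume : Measure (EuclideanSpace ℝ (Fin n))).toSphere with hσ
  have key : ∀ f : EuclideanSpace ℝ (Fin n) → F, ContDiff ℝ ∞ f →
      (fun x => epdBase a f x t) = fun x =>
      ∫ q in Icc (0 : ℝ) 1 ×ˢ univ, (σ.real univ)⁻¹ •
        f (x + (t * √q.1) • (q.2 : sphere (0 : EuclideanSpace ℝ (Fin n)) 1).1)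
        ∂((betaMeasure ((n : ℝ) / 2) a).prod σ) := fun f hf => by
    funext x
    have hc : Continuous fun q : ℝ × sphere (0 : EuclideanSpace ℝ (Fin n)) 1 =>
        (σ.real univ)⁻¹ • f (x + (t * √q.1) • (q.2 : EuclideanSpace ℝ (Fin n))) :=
      (hf.continuous.comp (by fun_prop)).const_smul _
    rw [setIntegral_prod _ (hc.continuousOn.integrableOn_compact
      (isCompact_Icc.prod isCompact_univ)), betaMeasure_restrict_Icc, Measure.restrict_univ]
    simp only [integral_smul]
    rw [← integral_smul]
    rfl
  rw [key f hf, congrFun (key _ hf.laplacian_infty) x]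
  exact laplacian_setIntegral_comp_add (μ := (betaMeasure ((n : ℝ) / 2) a).prod σ)
    (K := Icc (0 : ℝ) 1 ×ˢ univ) (w := fun _ => (σ.real univ)⁻¹)
    (ι := fun q => (t * √q.1) • (q.2 : EuclideanSpace ℝ (Fin n)))
    (isCompact_Icc.prod isCompact_univ)
    (continuousOn_const.integrableOn_compact (isCompact_Icc.prod isCompact_univ))
    (by fun_prop) hf x

/-- The solution of the Euler–Poisson–Darboux equation with `α = a`, defined for `a + k > 0` by `k`
descents in the parameter. -/
noncomputable def epd : ℕ → ℝ → (EuclideanSpace ℝ (Fin n) → F) → EuclideanSpace ℝ (Fin n) → ℝ → F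
  | 0, a, f, x, t => epdBase a f x t
  | k + 1, a, f, x, t => epd k (a + 1) f x t +
      (t ^ 2 / ((2 * a + n) * (2 * a + n + 2))) • epd k (a + 2) (Laplacian.laplacian f) x t

theorem contDiff_epd (hn : 1 ≤ n) {k : ℕ} {a : ℝ} (ha : 0 < a + k)
    {f : EuclideanSpace ℝ (Fin n) → F} (hf : ContDiff ℝ ∞ f) :
    ContDiff ℝ ∞ fun q : EuclideanSpace ℝ (Fin n) × ℝ => epd k a f q.1 q.2 := by
  induction k generalizing a f with
  | zero => exact contDiff_epdBase hn (by simpa using ha) hf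
  | succ k ih =>
    push_cast at ha
    have h1 := ih (a := a + 1) (by linarith) hf
    have h2 := ih (a := a + 2) (by linarith) hf.laplacian_infty
    simp only [epd]
    fun_prop

/-- The derivative formula is linear and compatible with the descent relation. Positivity of 2a + n
keeps all denominators away from zero. -/
theorem hasDerivAt_epd [CompleteSpace F] (hn : 1 ≤ n) {k : ℕ} {a : ℝ} (ha : 0 < a + k)
    (han : 0 < 2 * a + n) {f : EuclideanSpace ℝ (Fin n) → F} (hf : ContDiff ℝ ∞ f)
    (hfs : HasCompactSupport f) (x : EuclideanSpace ℝ (Fin n)) {t : ℝ} (ht : 0 ≤ t) :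
    HasDerivAt (epd k a f x)
      ((t / (2 * a + n)) • epd k (a + 1) (Laplacian.laplacian f) x t) t := by
  induction k generalizing a f with
  | zero => exact hasDerivAt_epdBase hn (by simpa using ha) hf hfs x ht
  | succ k ih =>
    push_cast at ha
    have hLs : HasCompactSupport (Laplacian.laplacian f) :=
      hfs.of_isClosed_subset (isClosed_tsupport _) (tsupport_laplacian_subset hf)
    have h1 := ih (a := a + 1) (by linarith) (by linarith) hf hfs
    have h2 := ih (a := a + 2) (by linarith) (by linarith) hf.laplacian_infty hLs
    have h3 := h1.add (((hasDerivAt_pow 2 t).div_const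
      ((2 * a + n) * (2 * a + n + 2))).smul h2)
    refine h3.congr_deriv ?_
    have e1 : a + 1 + 1 = a + 2 := by ring
    have e2 : a + 1 + 2 = a + 2 + 1 := by ring
    have e3 : 2 * (a + 2) + (n : ℝ) ≠ 0 := by linarith
    have e4 : 2 * (a + 1) + (n : ℝ) ≠ 0 := by linarith
    have e5 : 2 * a + (n : ℝ) + 2 ≠ 0 := by linarith
    have e6 : 2 * (a + 1) + (n : ℝ) + 2 ≠ 0 := by linarith
    simp only [epd, e1, e2, smul_add, smul_smul]
    match_scalars
    · field_simp; push_cast; ring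
    · field_simp; ring

theorem laplacian_epd [CompleteSpace F] (hn : 1 ≤ n) {k : ℕ} {a : ℝ} (ha : 0 < a + k)
    {f : EuclideanSpace ℝ (Fin n) → F} (hf : ContDiff ℝ ∞ f) (x : EuclideanSpace ℝ (Fin n))
    (t : ℝ) : Laplacian.laplacian (fun x => epd k a f x t) x =
      epd k a (Laplacian.laplacian f) x t := by
  induction k generalizing a f with
  | zero => exact laplacian_epdBase hn (by simpa using ha) hf x t
  | succ k ih =>
    push_cast at ha
    have hs : ∀ {a : ℝ} {f : EuclideanSpace ℝ (Fin n) → F}, 0 < a + k → ContDiff ℝ ∞ f →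
        ContDiffAt ℝ 2 (fun x => epd k a f x t) x := fun ha hf =>
      (((contDiff_epd hn ha hf).comp
        (by fun_prop : ContDiff ℝ ∞ fun x => (x, t))).contDiffAt).of_le (by norm_cast)
    have h1 := hs (a := a + 1) (by linarith) hf
    have h2 := hs (a := a + 2) (by linarith) hf.laplacian_infty
    simp only [epd]
    rw [← ih (by linarith) hf, ← ih (by linarith) hf.laplacian_infty]
    have h3 := h1.laplacian_add
      (h2.const_smul (t ^ 2 / ((2 * a + (n : ℝ)) * (2 * a + n + 2))))
    exact h3.trans (congrArg _ (InnerProductSpace.laplacian_smul _ h2))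

theorem epd_zero [CompleteSpace F] (hn : 1 ≤ n) {k : ℕ} {a : ℝ} (ha : 0 < a + k)
    (f : EuclideanSpace ℝ (Fin n) → F) (x : EuclideanSpace ℝ (Fin n)) :
    epd k a f x 0 = f x := by
  induction k generalizing a with
  | zero => exact epdBase_zero hn (by simpa using ha) f x
  | succ k ih =>
    push_cast at ha
    rw [epd, ih (by linarith)]
    simp

/-- The value does not depend on the number of descents; the base case is the descent relation for
positive parameters. -/
theorem epd_succ_eq [CompleteSpace F] (hn : 1 ≤ n) {k : ℕ} {a : ℝ} (ha : 0 < a + k)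
    {f : EuclideanSpace ℝ (Fin n) → F} (hf : ContDiff ℝ ∞ f)
    (hfs : HasCompactSupport f) (x : EuclideanSpace ℝ (Fin n)) {t : ℝ} (ht : 0 ≤ t) :
    epd (k + 1) a f x t = epd k a f x t := by
  induction k generalizing a f with
  | zero => exact (epdBase_eq hn (by simpa using ha) hf hfs x ht).symm
  | succ k ih =>
    push_cast at ha
    have hLs : HasCompactSupport (Laplacian.laplacian f) :=
      hfs.of_isClosed_subset (isClosed_tsupport _) (tsupport_laplacian_subset hf)
    rw [epd, ih (by linarith) hf hfs, ih (by linarith) hf.laplacian_infty hLs, epd]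

theorem epd_eq_epdBase [CompleteSpace F] (hn : 1 ≤ n) (k : ℕ) {a : ℝ} (ha : 0 < a)
    {f : EuclideanSpace ℝ (Fin n) → F} (hf : ContDiff ℝ ∞ f)
    (hfs : HasCompactSupport f) (x : EuclideanSpace ℝ (Fin n)) {t : ℝ} (ht : 0 ≤ t) :
    epd k a f x t = epdBase a f x t := by
  induction k with
  | zero => rfl
  | succ k ih => rw [epd_succ_eq hn (by positivity) hf hfs x ht, ih]

/-- Two applications of the derivative formula express u_t and u_tt through the parameters a + 1 and
a + 2, while Δu is the solution with data Δf. The equation is then the descent relation for Δf. -/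
theorem isEPDSolution_epd [CompleteSpace F] (hn : 1 ≤ n) {k : ℕ} {a : ℝ} (ha : 0 < a + k)
    (han : 0 < 2 * a + n) {f : EuclideanSpace ℝ (Fin n) → F} (hf : ContDiff ℝ ∞ f)
    (hfs : HasCompactSupport f) : IsEPDSolution a f (epd k a f) := by
  have hLs : HasCompactSupport (Laplacian.laplacian f) :=
    hfs.of_isClosed_subset (isClosed_tsupport _) (tsupport_laplacian_subset hf)
  refine ⟨((contDiff_epd hn ha hf).of_le (by norm_cast)).contDiffOn,
    ((contDiff_epd hn ha hf).of_le (by simp)).contDiffOn, fun x t ht => ?_,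
    epd_zero hn ha f, fun x => ?_⟩
  · have h1 := hasDerivAt_epd hn ha han hf hfs x ht.le
    have h2 := (((hasDerivAt_id t).div_const (2 * a + n))).smul
      (hasDerivAt_epd hn (by linarith : 0 < a + 1 + k) (by linarith) hf.laplacian_infty hLs x ht.le)
    have h3 : deriv (epd k a f x) =ᶠ[nhds t]
        fun t => (t / (2 * a + n)) • epd k (a + 1) (Laplacian.laplacian f) x t := by
      filter_upwards [Ioi_mem_nhds ht] with s hs
      exact (hasDerivAt_epd hn ha han hf hfs x (le_of_lt hs)).deriv
    have h4 : deriv (deriv (epd k a f x)) t = _ := h3.deriv_eq.trans h2.deriv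
    rw [h4, h1.deriv, laplacian_epd hn ha hf, ← epd_succ_eq hn ha hf.laplacian_infty hLs x ht.le,
      epd]
    have e1 : a + 1 + 1 = a + 2 := by ring
    have e3 : 2 * a + (n : ℝ) ≠ 0 := han.ne'
    have e4 : 2 * (a + 1) + (n : ℝ) ≠ 0 := by linarith
    have e5 : 2 * a + (n : ℝ) + 2 ≠ 0 := by linarith
    have e6 := ht.ne'
    rw [e1, id]
    match_scalars
    · field_simp; ring
    · field_simp; ring
  · have := hasDerivAt_epd hn ha han hf hfs x le_rfl
    rw [zero_div, zero_smul] at this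
    exact this.hasDerivWithinAt

/-- For a ≤ 0 the semigroup law is not at hand. Instead both sides, multiplied by t^(2a+n), have the
same derivative and vanish at t = 0. -/
theorem epd_add_one_eq_betaMean [CompleteSpace F] (hn : 1 ≤ n) {k : ℕ} {a : ℝ} (ha : 0 < a + k)
    (han : 0 < 2 * a + n) {f : EuclideanSpace ℝ (Fin n) → F} (hf : ContDiff ℝ ∞ f)
    (hfs : HasCompactSupport f) (x : EuclideanSpace ℝ (Fin n)) {t : ℝ} (ht : 0 < t) :
    betaMean ((n : ℝ) / 2 + a) 1 (epd k a f x) t = epd k (a + 1) f x t := by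
  have hLs : HasCompactSupport (Laplacian.laplacian f) :=
    hfs.of_isClosed_subset (isClosed_tsupport _) (tsupport_laplacian_subset hf)
  have hp : (0 : ℝ) < n / 2 + a := by linarith
  have hcont : ∀ {a : ℝ}, 0 < a + k → Continuous (epd k a f x) := fun ha =>
    (contDiff_epd hn ha hf).continuous.comp (by fun_prop : Continuous fun t : ℝ => (x, t))
  have hc0 := hcont ha
  have hc1 := hcont (a := a + 1) (by linarith)
  have hb := continuous_betaMean hp one_pos hc0
  set q := 2 * ((n : ℝ) / 2 + a) with hq
  have hq0 : 0 < q := by positivity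
  have e3 : 2 * (a + 1) + (n : ℝ) = q + 2 := by rw [hq]; ring
  have e4 : 2 * a + (n : ℝ) = q := by rw [hq]; ring
  have hd : ∀ s, 0 < s → HasDerivAt (fun s => s ^ q • epd k (a + 1) f x s)
      ((q * s ^ (q - 1)) • epd k a f x s) s := fun s hs => by
    refine ((hasDerivAt_rpow_const (p := q) (Or.inl hs.ne')).smul (hasDerivAt_epd hn
      (by linarith : 0 < a + 1 + k) (by linarith) hf hfs x hs.le)).congr_deriv ?_
    have e2 : s ^ q = s ^ (q - 1) * s := by
      rw [← rpow_add_one hs.ne']; congr 1; ring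
    rw [← epd_succ_eq hn ha hf hfs x hs.le, epd, e2, e3, e4, add_assoc a 1 1, one_add_one_eq_two]
    match_scalars
    · field_simp
    · field_simp
  set G : ℝ → F := fun s => s ^ q • (betaMean ((n : ℝ) / 2 + a) 1 (epd k a f x) s -
    epd k (a + 1) f x s) with hG
  have hGd : ∀ s, 0 < s → HasDerivAt G 0 s := fun s hs => by
    have h1 := (hasDerivAt_rpow_smul_betaMean_one hp hc0 hs).sub (hd s hs)
    rw [← hq, sub_self] at h1
    refine h1.congr_of_eventuallyEq (.of_forall fun s => ?_)
    simp only [hG, smul_sub, Pi.sub_apply]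
  have hGc : Continuous G := (continuous_rpow_const hq0.le).smul (hb.sub hc1)
  have h0 : G t = G 0 := by
    have h1 : G =ᶠ[nhdsWithin 0 (Ioi 0)] fun _ => G t := by
      filter_upwards [self_mem_nhdsWithin] with s hs
      exact isOpen_Ioi.is_const_of_deriv_eq_zero isPreconnected_Ioi
        (fun s hs => (hGd s hs).differentiableAt.differentiableWithinAt)
        (fun s hs => (hGd s hs).deriv) hs ht
    exact tendsto_nhds_unique (tendsto_const_nhds.congr' h1.symm)
      (hGc.tendsto 0 |>.mono_left nhdsWithin_le_nhds)
  rw [hG] at h0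
  simp only [zero_rpow hq0.ne', zero_smul] at h0
  have := (smul_eq_zero.1 h0).resolve_left (rpow_pos_of_pos ht q).ne'
  exact sub_eq_zero.1 this

theorem betaMean_epd [CompleteSpace F] (hn : 1 ≤ n) {k : ℕ} {a : ℝ} (ha : 0 < a + k)
    (han : 0 < 2 * a + n) {f : EuclideanSpace ℝ (Fin n) → F} (hf : ContDiff ℝ ∞ f)
    (hfs : HasCompactSupport f) (x : EuclideanSpace ℝ (Fin n)) (M : ℕ) {t : ℝ} (ht : 0 < t) :
    betaMean ((n : ℝ) / 2 + a) (M + 1) (epd k a f x) t = epd k (a + (M + 1)) f x t := by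
  have hp : (0 : ℝ) < n / 2 + a := by linarith
  have hc : Continuous (epd k a f x) :=
    (contDiff_epd hn ha hf).continuous.comp (by fun_prop : Continuous fun t : ℝ => (x, t))
  induction M generalizing t with
  | zero =>
    simp only [Nat.cast_zero, zero_add]
    exact epd_add_one_eq_betaMean hn ha han hf hfs x ht
  | succ M ih =>
    push_cast
    have hM : (0 : ℝ) < (M : ℝ) + 1 := by positivity
    rw [← betaMean_betaMean hp hM one_pos hc, betaMean_congr ht fun s hs => ih hs.1,
      add_assoc, epd_add_one_eq_betaMean hn (by linarith) (by linarith) hf hfs x ht, add_assoc]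

end

/-! ### The local energy estimate. -/

section
variable {n : ℕ}

/-- A cutoff function supported in a cone with a smoothed tip. -/
noncomputable def coneCutoff (S : ℝ) (p : EuclideanSpace ℝ (Fin n) × ℝ) : ℝ :=
  max 0 (S - √(1 + ‖p.1‖ ^ 2) - p.2) ^ 2

theorem coneCutoff_nonneg (S : ℝ) (p : EuclideanSpace ℝ (Fin n) × ℝ) : 0 ≤ coneCutoff S p := by
  unfold coneCutoff
  positivity

theorem coneCutoff_eq_zero {S : ℝ} {p : EuclideanSpace ℝ (Fin n) × ℝ} (hp : 0 ≤ p.2)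
    (h : S ≤ ‖p.1‖) : coneCutoff S p = 0 := by
  have : ‖p.1‖ ≤ √(1 + ‖p.1‖ ^ 2) := le_sqrt_of_sq_le (by linarith)
  rw [coneCutoff, max_eq_left (by linarith)]
  simp

theorem hasFDerivAt_coneCutoff (S : ℝ) (p : EuclideanSpace ℝ (Fin n) × ℝ) :
    HasFDerivAt (coneCutoff S) ((-(2 * max 0 (S - √(1 + ‖p.1‖ ^ 2) - p.2))) •
      ((√(1 + ‖p.1‖ ^ 2))⁻¹ • (innerSL ℝ p.1).comp (ContinuousLinearMap.fst ℝ _ ℝ) +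
        ContinuousLinearMap.snd ℝ (EuclideanSpace ℝ (Fin n)) ℝ)) p := by
  have h1 : HasFDerivAt (fun p : EuclideanSpace ℝ (Fin n) × ℝ => 1 + ‖p.1‖ ^ 2)
      ((2 • innerSL ℝ p.1).comp (ContinuousLinearMap.fst ℝ _ ℝ)) p :=
    (((hasStrictFDerivAt_norm_sq p.1).hasFDerivAt).comp p hasFDerivAt_fst).const_add 1
  have hpos : 0 < 1 + ‖p.1‖ ^ 2 := by positivity
  have h2 := (h1.sqrt hpos.ne').const_sub S |>.sub (hasFDerivAt_snd (𝕜 := ℝ) (p := p))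
  have h3 := (hasDerivAt_sq_max (S - √(1 + ‖p.1‖ ^ 2) - p.2)).comp_hasFDerivAt p h2
  refine h3.congr_fderiv ?_
  ext v
  · simp only [ContinuousLinearMap.comp_apply, ContinuousLinearMap.inl_apply,
      ContinuousLinearMap.smul_apply, ContinuousLinearMap.sub_apply, ContinuousLinearMap.neg_apply,
      ContinuousLinearMap.add_apply, ContinuousLinearMap.coe_fst', ContinuousLinearMap.coe_snd',
      smul_eq_mul, nsmul_eq_mul]
    push_cast
    field_simp
    ring
  · simp

theorem contDiff_coneCutoff (S : ℝ) :
    ContDiff ℝ 1 (coneCutoff S : EuclideanSpace ℝ (Fin n) × ℝ → ℝ) := by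
  have h1 : ContDiff ℝ 1 fun s : ℝ => max 0 s ^ 2 := by
    rw [contDiff_one_iff_deriv]
    refine ⟨fun s => (hasDerivAt_sq_max s).differentiableAt, ?_⟩
    rw [funext fun s => (hasDerivAt_sq_max s).deriv]
    fun_prop
  have h2 : ContDiff ℝ 1 fun p : EuclideanSpace ℝ (Fin n) × ℝ => √(1 + ‖p.1‖ ^ 2) :=
    (contDiff_const.add (contDiff_fst.norm_sq ℝ)).sqrt fun p => by positivity
  exact h1.comp ((contDiff_const.sub h2).sub contDiff_snd)

/-- The squared length of the gradient. -/
noncomputable def gradSq (A : (EuclideanSpace ℝ (Fin n) × ℝ) → (EuclideanSpace ℝ (Fin n) × ℝ) →L[ℝ] ℝ)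
    (p : EuclideanSpace ℝ (Fin n) × ℝ) : ℝ :=
  A p (0, 1) ^ 2 + ∑ i, A p (EuclideanSpace.single i 1, 0) ^ 2

theorem gradSq_nonneg (A : (EuclideanSpace ℝ (Fin n) × ℝ) →
    (EuclideanSpace ℝ (Fin n) × ℝ) →L[ℝ] ℝ) (p : EuclideanSpace ℝ (Fin n) × ℝ) : 0 ≤ gradSq A p := by
  unfold gradSq
  positivity

/-- The local energy inequality. -/
theorem fderiv_coneCutoff_mul_gradSq_le
    {A : (EuclideanSpace ℝ (Fin n) × ℝ) → (EuclideanSpace ℝ (Fin n) × ℝ) →L[ℝ] ℝ}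
    {B : (EuclideanSpace ℝ (Fin n) × ℝ) →L[ℝ] (EuclideanSpace ℝ (Fin n) × ℝ) →L[ℝ] ℝ}
    {p : EuclideanSpace ℝ (Fin n) × ℝ} (hB : HasFDerivAt A B p) (hsymm : ∀ u v, B u v = B v u)
    {κ : ℝ} (hκ : 0 ≤ κ)
    (heq : ∑ i, B (EuclideanSpace.single i 1, 0) (EuclideanSpace.single i 1, 0) -
      B (0, 1) (0, 1) - κ * A p (0, 1) = 0) (S : ℝ) :
    fderiv ℝ (fun q => coneCutoff S q * gradSq A q) p (0, 1) ≤
      ∑ i, fderiv ℝ (fun q => coneCutoff S q * (2 * A q (0, 1) *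
        A q (EuclideanSpace.single i 1, 0))) p (EuclideanSpace.single i 1, 0) := by
  have hχ := hasFDerivAt_coneCutoff S p
  have hAv : ∀ v, HasFDerivAt (fun q => A q v) ((ContinuousLinearMap.apply ℝ ℝ v).comp B) p :=
    fun v => (ContinuousLinearMap.apply ℝ ℝ v).hasFDerivAt.comp p hB
  have he : HasFDerivAt (gradSq A) _ p := ((hAv (0, 1)).pow 2).add
    (HasFDerivAt.fun_sum fun i (_ : i ∈ Finset.univ) => (hAv (EuclideanSpace.single i 1, 0)).pow 2)
  set m := max 0 (S - √(1 + ‖p.1‖ ^ 2) - p.2) with hm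
  have hm0 : 0 ≤ m := le_max_left _ _
  have hχ0 := coneCutoff_nonneg S p
  have hρ : 0 < √(1 + ‖p.1‖ ^ 2) := sqrt_pos.2 (by positivity)
  have hL : fderiv ℝ (fun q => coneCutoff S q * gradSq A q) p (0, 1) =
      coneCutoff S p * (2 * A p (0, 1) * B (0, 1) (0, 1) +
        ∑ i, 2 * A p (EuclideanSpace.single i 1, 0) * B (0, 1) (EuclideanSpace.single i 1, 0)) -
      2 * m * gradSq A p := by
    have h0 : fderiv ℝ (fun q => coneCutoff S q * gradSq A q) p = _ := (hχ.mul he).fderiv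
    rw [h0]
    simp [ContinuousLinearMap.sum_apply]
    ring
  have hR : ∀ i : Fin n, fderiv ℝ (fun q => coneCutoff S q * (2 * A q (0, 1) *
        A q (EuclideanSpace.single i 1, 0))) p (EuclideanSpace.single i 1, 0) =
      coneCutoff S p * (2 * A p (0, 1) *
        B (EuclideanSpace.single i 1, 0) (EuclideanSpace.single i 1, 0) +
        2 * A p (EuclideanSpace.single i 1, 0) * B (EuclideanSpace.single i 1, 0) (0, 1)) -
      4 * m * A p (0, 1) * ((√(1 + ‖p.1‖ ^ 2))⁻¹ *
        (p.1 i * A p (EuclideanSpace.single i 1, 0))) := fun i => by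
    have h0 : fderiv ℝ (fun q => coneCutoff S q * (2 * A q (0, 1) *
        A q (EuclideanSpace.single i 1, 0))) p = _ :=
      (hχ.mul (((hAv (0, 1)).const_mul 2).mul (hAv (EuclideanSpace.single i 1, 0)))).fderiv
    rw [h0]
    simp [EuclideanSpace.inner_single_right]
    ring
  simp_rw [hR]
  rw [hL, Finset.sum_sub_distrib, ← Finset.mul_sum, ← Finset.mul_sum, ← Finset.mul_sum,
    Finset.sum_add_distrib, ← Finset.mul_sum]
  simp_rw [hsymm (0, 1) (EuclideanSpace.single _ 1, 0)]
  set s := ∑ i, p.1 i * A p (EuclideanSpace.single i 1, 0) with hs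
  -- Cauchy–Schwarz, with |x| / √(1 + |x|²) ≤ 1: the cutoff has slope at most one in space and
  -- exactly one in time.
  have hcs : ((√(1 + ‖p.1‖ ^ 2))⁻¹ * s) ^ 2 ≤ ∑ i, A p (EuclideanSpace.single i 1, 0) ^ 2 := by
    have h1 := Finset.sum_mul_sq_le_sq_mul_sq Finset.univ (fun i => p.1 i)
      fun i => A p (EuclideanSpace.single i 1, 0)
    rw [← EuclideanSpace.real_norm_sq_eq] at h1
    have h2 : 0 ≤ ∑ i, A p (EuclideanSpace.single i 1, 0) ^ 2 := by positivity
    rw [mul_pow, inv_pow, sq_sqrt (by positivity), inv_mul_le_iff₀ (by positivity)]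
    linarith
  rw [gradSq]
  set b := (√(1 + ‖p.1‖ ^ 2))⁻¹ * s with hb
  have h1 : B (0, 1) (0, 1) = ∑ i, B (EuclideanSpace.single i 1, 0) (EuclideanSpace.single i 1, 0)
    - κ * A p (0, 1) := by linarith
  rw [h1]
  -- The damping term has the favourable sign; here κ ≥ 0 is used.
  have h2 : 0 ≤ coneCutoff S p * (κ * A p (0, 1) ^ 2) := by positivity
  -- The flux through the side of the cone is dominated by the energy density lost there.
  have h3 : 0 ≤ m * (A p (0, 1) ^ 2 + ∑ i, A p (EuclideanSpace.single i 1, 0) ^ 2 -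
      2 * A p (0, 1) * b) := mul_nonneg hm0 (by nlinarith [sq_nonneg (A p (0, 1) - b)])
  nlinarith

/-- The integral of a derivative of a compactly supported function vanishes. -/
theorem integral_fderiv_apply_eq_zero {g : EuclideanSpace ℝ (Fin n) → ℝ} (hg : ContDiff ℝ 1 g)
    (hgs : HasCompactSupport g) (v : EuclideanSpace ℝ (Fin n)) : ∫ x, fderiv ℝ g x v = 0 := by
  have h1 := (hg.continuous_fderiv one_ne_zero).clm_apply (continuous_const (y := v))
  have h := integral_smul_fderiv_eq_neg_fderiv_smul_of_integrable (μ := volume) (v := v)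
    (f := fun _ : EuclideanSpace ℝ (Fin n) => (1 : ℝ)) (g := g) (by simp) ?_ ?_ (by simp)
    fun x _ => hg.differentiable one_ne_zero x
  · simpa using h
  · simp only [one_smul]
    exact h1.integrable_of_hasCompactSupport (hgs.fderiv_apply ℝ v)
  · simp only [one_smul]
    exact hg.continuous.integrable_of_hasCompactSupport hgs

/-- Decay of the local energy. -/
theorem antitoneOn_integral_coneCutoff
    {A : (EuclideanSpace ℝ (Fin n) × ℝ) → (EuclideanSpace ℝ (Fin n) × ℝ) →L[ℝ] ℝ}
    (hA : ContinuousOn A (univ ×ˢ Ici 0)) (hA1 : ContDiffOn ℝ 1 A (univ ×ˢ Ioi 0)) (S : ℝ)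
    (hle : ∀ p : EuclideanSpace ℝ (Fin n) × ℝ, 0 < p.2 →
      fderiv ℝ (fun q => coneCutoff S q * gradSq A q) p (0, 1) ≤
      ∑ i, fderiv ℝ (fun q => coneCutoff S q * (2 * A q (0, 1) *
        A q (EuclideanSpace.single i 1, 0))) p (EuclideanSpace.single i 1, 0)) :
    AntitoneOn (fun t => ∫ x : EuclideanSpace ℝ (Fin n), coneCutoff S (x, t) * gradSq A (x, t))
      (Ici 0) := by
  have hΩ : IsOpen ((univ : Set (EuclideanSpace ℝ (Fin n))) ×ˢ Ioi (0 : ℝ)) :=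
    isOpen_univ.prod isOpen_Ioi
  have hK := isCompact_closedBall (0 : EuclideanSpace ℝ (Fin n)) S
  have hz : ∀ t, 0 ≤ t → ∀ x ∉ closedBall (0 : EuclideanSpace ℝ (Fin n)) S,
      coneCutoff S (x, t) = 0 := fun t ht x hx => by
    rw [mem_closedBall_zero_iff, not_le] at hx
    exact coneCutoff_eq_zero ht hx.le
  have hAc : ∀ v, ContinuousOn (fun q => A q v) (univ ×ˢ Ici 0) := fun v =>
    hA.clm_apply continuousOn_const
  have hA1v : ∀ v, ContDiffOn ℝ 1 (fun q => A q v) (univ ×ˢ Ioi 0) := fun v =>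
    hA1.clm_apply contDiffOn_const
  have hPc : ContinuousOn (fun q => coneCutoff S q * gradSq A q) (univ ×ˢ Ici 0) :=
    (contDiff_coneCutoff S).continuous.continuousOn.mul
      (((hAc _).pow 2).add (continuousOn_finsetSum _ fun i _ => (hAc _).pow 2))
  have hP1 : ContDiffOn ℝ 1 (fun q => coneCutoff S q * gradSq A q) (univ ×ˢ Ioi 0) :=
    (contDiff_coneCutoff S).contDiffOn.mul
      (((hA1v _).pow 2).add (ContDiffOn.sum fun i _ => (hA1v _).pow 2))
  have hQ1 : ∀ i, ContDiffOn ℝ 1 (fun q => coneCutoff S q * (2 * A q (0, 1) *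
        A q (EuclideanSpace.single i 1, 0))) (univ ×ˢ Ioi 0) := fun i =>
    (contDiff_coneCutoff S).contDiffOn.mul ((contDiffOn_const.mul (hA1v _)).mul (hA1v _))
  set P : EuclideanSpace ℝ (Fin n) × ℝ → ℝ := fun q => coneCutoff S q * gradSq A q with hP
  set Q : Fin n → EuclideanSpace ℝ (Fin n) × ℝ → ℝ := fun i q => coneCutoff S q *
    (2 * A q (0, 1) * A q (EuclideanSpace.single i 1, 0)) with hQ
  have hd : ∀ t, 0 < t → HasDerivAt (fun t => ∫ x, P (x, t))
      (∫ x in closedBall (0 : EuclideanSpace ℝ (Fin n)) S, fderiv ℝ P (x, t) (0, 1)) t :=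
    fun t ht => by
    have h := hasDerivAt_setIntegral_smul (μ := volume) (w := fun _ => 1) (U := Ioi 0)
      (Φ := fun t x => P (x, t)) (Φ' := fun t x => fderiv ℝ P (x, t) (0, 1)) hK
      (continuousOn_const.integrableOn_compact hK) isOpen_Ioi ?_ ?_ (fun s hs x _ => ?_) ht
    · simp only [one_smul] at h
      refine h.congr_of_eventuallyEq ?_
      filter_upwards [Ioi_mem_nhds ht] with s hs
      refine (setIntegral_eq_integral_of_forall_compl_eq_zero fun x hx => ?_).symm
      rw [hP]
      simp only
      rw [hz s (le_of_lt hs) x hx, zero_mul]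
    · exact hPc.comp (f := fun q : ℝ × EuclideanSpace ℝ (Fin n) => (q.2, q.1)) (by fun_prop)
        fun q hq => ⟨mem_univ _, le_of_lt (mem_Ioi.1 hq.1)⟩
    · have h1 := (hP1.continuousOn_fderiv_of_isOpen hΩ le_rfl).clm_apply
        (continuousOn_const (c := ((0, 1) : EuclideanSpace ℝ (Fin n) × ℝ)))
      exact h1.comp (f := fun q : ℝ × EuclideanSpace ℝ (Fin n) => (q.2, q.1)) (by fun_prop)
        fun q hq => ⟨mem_univ _, hq.1⟩
    · have h1 := ((hP1.differentiableOn one_ne_zero).differentiableAt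
        (hΩ.mem_nhds (show (x, s) ∈ univ ×ˢ Ioi (0 : ℝ) from ⟨mem_univ x, hs⟩))).hasFDerivAt
      exact h1.comp_hasDerivAt s ((hasDerivAt_const s x).prodMk (hasDerivAt_id s))
  refine antitoneOn_of_deriv_nonpos (convex_Ici 0) ?_ ?_ fun t ht => ?_
  · refine continuousOn_integral_of_compact_support hK ?_ fun t x ht hx => ?_
    · exact hPc.comp (f := fun q : ℝ × EuclideanSpace ℝ (Fin n) => (q.2, q.1)) (by fun_prop)
        fun q hq => ⟨mem_univ _, hq.1⟩
    · rw [hz t ht x hx, zero_mul]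
  · rw [interior_Ici]
    exact fun t ht => (hd t ht).differentiableAt.differentiableWithinAt
  rw [interior_Ici] at ht
  have ht : 0 < t := ht
  rw [(hd t ht).deriv]
  have hslice : ∀ x : EuclideanSpace ℝ (Fin n), (x, t) ∈ univ ×ˢ Ioi (0 : ℝ) := fun x =>
    ⟨mem_univ x, ht⟩
  have hQt : ∀ i, ContDiff ℝ 1 fun x => Q i (x, t) := fun i =>
    contDiffOn_univ.1 ((hQ1 i).comp (f := fun x => (x, t)) (by fun_prop) fun x _ => hslice x)
  have hQs : ∀ i, HasCompactSupport fun x => Q i (x, t) := fun i =>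
    HasCompactSupport.intro hK fun x hx => by
      rw [hQ]; simp only; rw [hz t ht.le x hx, zero_mul]
  have hQd : ∀ i x, fderiv ℝ (Q i) (x, t) (EuclideanSpace.single i 1, 0) =
      fderiv ℝ (fun x => Q i (x, t)) x (EuclideanSpace.single i 1) := fun i x => by
    have h1 := (((hQ1 i).differentiableOn one_ne_zero).differentiableAt
        (hΩ.mem_nhds (hslice x))).hasFDerivAt
    have h2 := h1.comp x (hasFDerivAt_prodMk_left (𝕜 := ℝ) x t)
    have h3 : fderiv ℝ (fun x => Q i (x, t)) x = _ := h2.fderiv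
    rw [h3]
    rfl
  have hQc : ∀ i, Continuous fun x => fderiv ℝ (Q i) (x, t) (EuclideanSpace.single i 1, 0) :=
    fun i => by
    simp_rw [hQd]
    exact ((hQt i).continuous_fderiv one_ne_zero).clm_apply continuous_const
  have hQI : ∀ i, Integrable fun x => fderiv ℝ (Q i) (x, t) (EuclideanSpace.single i 1, 0) :=
    fun i => by
    refine (hQc i).integrable_of_hasCompactSupport ?_
    simp_rw [hQd]
    exact (hQs i).fderiv_apply ℝ _
  calc ∫ x in closedBall (0 : EuclideanSpace ℝ (Fin n)) S, fderiv ℝ P (x, t) (0, 1)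
      ≤ ∫ x in closedBall (0 : EuclideanSpace ℝ (Fin n)) S,
        ∑ i, fderiv ℝ (Q i) (x, t) (EuclideanSpace.single i 1, 0) := by
        refine setIntegral_mono_on ?_ ?_ measurableSet_closedBall fun x _ => hle (x, t) ht
        · have h1 := (hP1.continuousOn_fderiv_of_isOpen hΩ le_rfl).clm_apply
            (continuousOn_const (c := ((0, 1) : EuclideanSpace ℝ (Fin n) × ℝ)))
          exact ContinuousOn.integrableOn_compact hK (h1.comp (f := fun x => (x, t)) (by fun_prop)
            fun x _ => hslice x)
        · exact (integrable_finsetSum _ fun i _ => hQI i).integrableOn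
    _ = ∫ x, ∑ i, fderiv ℝ (Q i) (x, t) (EuclideanSpace.single i 1, 0) := by
        refine setIntegral_eq_integral_of_forall_compl_eq_zero fun x hx => ?_
        refine Finset.sum_eq_zero fun i _ => ?_
        rw [hQd]
        have : (fun x => Q i (x, t)) =ᶠ[nhds x] fun _ => 0 := by
          filter_upwards [hK.isClosed.isOpen_compl.mem_nhds hx] with y hy
          rw [hQ]; simp only; rw [hz t ht.le y hy, zero_mul]
        rw [this.fderiv_eq]
        simp
    _ = 0 := by
        rw [integral_finsetSum _ fun i _ => hQI i]
        refine Finset.sum_eq_zero fun i _ => ?_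
        simp_rw [hQd]
        exact integral_fderiv_apply_eq_zero (hQt i) (hQs i) _

end

/-! ### Uniqueness for the Cauchy problem. -/

section
variable {F : Type*} [NormedAddCommGroup F] [NormedSpace ℝ F] {n : ℕ} {α : ℝ}

/-- Vanishing of a gradient field with decaying local energy. -/
theorem apply_eq_zero_of_fderiv_coneCutoff_le
    {A : (EuclideanSpace ℝ (Fin n) × ℝ) → (EuclideanSpace ℝ (Fin n) × ℝ) →L[ℝ] ℝ}
    (hA : ContinuousOn A (univ ×ˢ Ici 0)) (hA1 : ContDiffOn ℝ 1 A (univ ×ˢ Ioi 0))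
    (hle : ∀ S, ∀ p : EuclideanSpace ℝ (Fin n) × ℝ, 0 < p.2 →
      fderiv ℝ (fun q => coneCutoff S q * gradSq A q) p (0, 1) ≤
      ∑ i, fderiv ℝ (fun q => coneCutoff S q * (2 * A q (0, 1) *
        A q (EuclideanSpace.single i 1, 0))) p (EuclideanSpace.single i 1, 0))
    (h0 : ∀ x, gradSq A (x, 0) = 0) (x : EuclideanSpace ℝ (Fin n)) {s : ℝ} (hs : 0 < s) :
    A (x, s) (0, 1) = 0 := by
  by_contra hne
  -- With this S the cutoff equals 1 at (x, s), so a nonzero time derivative there would give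
  -- positive energy.
  set S := √(1 + ‖x‖ ^ 2) + s + 1 with hS
  have hanti := antitoneOn_integral_coneCutoff hA hA1 S (hle S) self_mem_Ici (mem_Ici.2 hs.le) hs.le
  simp only [h0, mul_zero, integral_zero] at hanti
  have hcont : Continuous fun y => coneCutoff S (y, s) * gradSq A (y, s) := by
    have hcA : Continuous fun y => A (y, s) :=
      continuousOn_univ.1 (hA1.continuousOn.comp
        (f := fun y => (y, s)) (by fun_prop) fun y _ => ⟨mem_univ y, hs⟩)
    have hc : ∀ v, Continuous fun y => A (y, s) v := fun v => hcA.clm_apply continuous_const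
    have hc2 : Continuous fun y => gradSq A (y, s) :=
      ((hc _).pow 2).add (continuous_finsetSum _ fun i _ => (hc _).pow 2)
    exact ((contDiff_coneCutoff S).continuous.comp (by fun_prop)).mul hc2
  refine hanti.not_gt (hcont.integral_pos_of_hasCompactSupport_nonneg_nonzero (x := x)
    (HasCompactSupport.intro (isCompact_closedBall 0 S) fun y hy => ?_)
    (fun y => mul_nonneg (coneCutoff_nonneg _ _) (gradSq_nonneg _ _)) ?_)
  · rw [mem_closedBall_zero_iff, not_le] at hy
    rw [coneCutoff_eq_zero (p := (y, s)) hs.le hy.le, zero_mul]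
  · have h1 : coneCutoff S (x, s) = 1 := by
      rw [coneCutoff, show S - √(1 + ‖x‖ ^ 2) - s = 1 by rw [hS]; ring]
      simp
    have h2 : 0 < A (x, s) (0, 1) ^ 2 := by positivity
    have h3 : 0 ≤ ∑ i, A (x, s) (EuclideanSpace.single i 1, 0) ^ 2 := by positivity
    rw [h1, one_mul, gradSq]
    exact (add_pos_of_pos_of_nonneg h2 h3).ne'

theorem HasFDerivAt.slice_left {W : EuclideanSpace ℝ (Fin n) × ℝ → F}
    {L : EuclideanSpace ℝ (Fin n) × ℝ →L[ℝ] F} {x : EuclideanSpace ℝ (Fin n)} {s : ℝ}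
    (h : HasFDerivAt W L (x, s)) : HasFDerivAt (fun y => W (y, s))
      (L.comp (ContinuousLinearMap.inl ℝ (EuclideanSpace ℝ (Fin n)) ℝ)) x :=
  h.comp x (hasFDerivAt_prodMk_left (𝕜 := ℝ) x s)

theorem HasFDerivAt.slice_right {W : EuclideanSpace ℝ (Fin n) × ℝ → F}
    {L : EuclideanSpace ℝ (Fin n) × ℝ →L[ℝ] F} {x : EuclideanSpace ℝ (Fin n)} {s : ℝ}
    (h : HasFDerivAt W L (x, s)) : HasDerivAt (fun r => W (x, r)) (L (0, 1)) s :=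
  h.comp_hasDerivAt s ((hasDerivAt_const s x).prodMk (hasDerivAt_id s))

namespace IsEPDSolution

variable {f g : EuclideanSpace ℝ (Fin n) → F} {u v : EuclideanSpace ℝ (Fin n) → ℝ → F}

theorem contDiffAt_left (hu : IsEPDSolution α f u) (x : EuclideanSpace ℝ (Fin n)) {t : ℝ}
    (ht : 0 < t) : ContDiffAt ℝ 2 (fun y => u y t) x :=
  (contDiffOn_univ.1 (hu.contDiffOn_two.comp (f := fun x => (x, t)) (by fun_prop)
    fun x _ => ⟨mem_univ x, ht⟩)).contDiffAt

theorem contDiffOn_right (hu : IsEPDSolution α f u) (x : EuclideanSpace ℝ (Fin n)) :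
    ContDiffOn ℝ 2 (u x) (Ioi 0) :=
  hu.contDiffOn_two.comp (f := fun t => (x, t)) (by fun_prop) fun _ ht => ⟨mem_univ x, ht⟩

theorem hasDerivAt_right (hu : IsEPDSolution α f u) (x : EuclideanSpace ℝ (Fin n)) {t : ℝ}
    (ht : 0 < t) : HasDerivAt (u x) (deriv (u x) t) t :=
  (((hu.contDiffOn_right x).differentiableOn two_ne_zero).differentiableAt
    (Ioi_mem_nhds ht)).hasDerivAt

theorem hasDerivAt_deriv_right (hu : IsEPDSolution α f u) (x : EuclideanSpace ℝ (Fin n)) {t : ℝ}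
    (ht : 0 < t) : HasDerivAt (deriv (u x)) (deriv (deriv (u x)) t) t :=
  ((((hu.contDiffOn_right x).deriv_of_isOpen (m := 1) isOpen_Ioi
    (by norm_num)).differentiableOn one_ne_zero).differentiableAt (Ioi_mem_nhds ht)).hasDerivAt

theorem sub (hu : IsEPDSolution α f u) (hv : IsEPDSolution α g v) :
    IsEPDSolution α (f - g) (u - v) := by
  refine ⟨hu.contDiffOn_two.sub hv.contDiffOn_two, hu.contDiffOn_one.sub hv.contDiffOn_one,
    fun x t ht => ?_, fun x => ?_, fun x => ?_⟩
  · have h1 : Laplacian.laplacian (fun y => (u - v) y t) x = _ :=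
      (hu.contDiffAt_left x ht).laplacian_sub (hv.contDiffAt_left x ht)
    have h2 : ∀ s, 0 < s → HasDerivAt ((u - v) x) (deriv (u x) s - deriv (v x) s) s :=
      fun s hs => (hu.hasDerivAt_right x hs).sub (hv.hasDerivAt_right x hs)
    have h3 : deriv ((u - v) x) =ᶠ[nhds t] deriv (u x) - deriv (v x) := by
      filter_upwards [Ioi_mem_nhds ht] with s hs using (h2 s hs).deriv
    rw [h1, h3.deriv_eq, ((hu.hasDerivAt_deriv_right x ht).sub
      (hv.hasDerivAt_deriv_right x ht)).deriv, (h2 t ht).deriv, smul_sub]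
    have e1 := hu.equation x t ht
    have e2 := hv.equation x t ht
    rw [← sub_self (0 : F)]
    nth_rewrite 1 [← e1]
    rw [← e2]
    abel
  · simp [hu.initial, hv.initial]
  · have := (hu.initial_deriv x).sub (hv.initial_deriv x)
    rwa [sub_zero] at this

/-- Reduces uniqueness to real-valued solutions, for which the energy is formulated. -/
theorem clm_comp (hu : IsEPDSolution α f u) (ℓ : F →L[ℝ] ℝ) :
    IsEPDSolution α (fun x => ℓ (f x)) fun x t => ℓ (u x t) := by
  refine ⟨ℓ.contDiff.comp_contDiffOn hu.contDiffOn_two, ℓ.contDiff.comp_contDiffOn hu.contDiffOn_one,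
    fun x t ht => ?_, fun x => ?_, fun x => ?_⟩
  · have h1 : Laplacian.laplacian (fun y => ℓ (u y t)) x = _ :=
      (hu.contDiffAt_left x ht).laplacian_CLM_comp_left (l := ℓ)
    have h2 : ∀ s, 0 < s → HasDerivAt (fun t => ℓ (u x t)) (ℓ (deriv (u x) s)) s :=
      fun s hs => ℓ.hasFDerivAt.comp_hasDerivAt s (hu.hasDerivAt_right x hs)
    have h3 : deriv (fun t => ℓ (u x t)) =ᶠ[nhds t] fun s => ℓ (deriv (u x) s) := by
      filter_upwards [Ioi_mem_nhds ht] with s hs using (h2 s hs).deriv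
    have h4 : HasDerivAt (fun s => ℓ (deriv (u x) s)) (ℓ (deriv (deriv (u x)) t)) t :=
      ℓ.hasFDerivAt.comp_hasDerivAt t (hu.hasDerivAt_deriv_right x ht)
    rw [h1, h3.deriv_eq, h4.deriv, (h2 t ht).deriv, Function.comp_apply, ← map_smul, ← map_sub,
      ← map_sub, hu.equation x t ht, map_zero]
  · rw [hu.initial]
  · have := ℓ.hasFDerivAt.comp_hasDerivWithinAt 0 (hu.initial_deriv x)
    rwa [map_zero] at this

/-- The lower bound on α is the condition that the damping coefficient (n + 2α - 1)/s is
nonnegative. Away from t = 0 the second derivatives are symmetric and the equation can be read in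
terms of the gradient field. -/
theorem fderiv_coneCutoff_le {f : EuclideanSpace ℝ (Fin n) → ℝ}
    {w : EuclideanSpace ℝ (Fin n) → ℝ → ℝ} (hw : IsEPDSolution α f w) (hα : (1 - (n : ℝ)) / 2 ≤ α)
    {A : (EuclideanSpace ℝ (Fin n) × ℝ) → (EuclideanSpace ℝ (Fin n) × ℝ) →L[ℝ] ℝ}
    (hWd : ∀ p : EuclideanSpace ℝ (Fin n) × ℝ, 0 < p.2 →
      HasFDerivAt (fun p => w p.1 p.2) (A p) p)
    (hB : ∀ p : EuclideanSpace ℝ (Fin n) × ℝ, 0 < p.2 → HasFDerivAt A (fderiv ℝ A p) p)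
    (S : ℝ) (p : EuclideanSpace ℝ (Fin n) × ℝ) (hp : 0 < p.2) :
    fderiv ℝ (fun q => coneCutoff S q * gradSq A q) p (0, 1) ≤
      ∑ i, fderiv ℝ (fun q => coneCutoff S q * (2 * A q (0, 1) *
        A q (EuclideanSpace.single i 1, 0))) p (EuclideanSpace.single i 1, 0) := by
  obtain ⟨x, s⟩ := p
  have hs : 0 < s := hp
  have hsymm := second_derivative_symmetric_of_eventually (𝕜 := ℝ) (f := fun p => w p.1 p.2)
    (f' := A) (by
      filter_upwards [(isOpen_univ.prod isOpen_Ioi).mem_nhds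
        (show (x, s) ∈ univ ×ˢ Ioi (0 : ℝ) from ⟨mem_univ x, hs⟩)] with q hq using hWd q hq.2)
    (hB (x, s) hs)
  have hκ : 0 ≤ ((n : ℝ) + 2 * α - 1) / s := div_nonneg (by linarith) hs.le
  have hAv : ∀ v, HasFDerivAt (fun q => A q v)
      ((ContinuousLinearMap.apply ℝ ℝ v).comp (fderiv ℝ A (x, s))) (x, s) :=
    fun v => (ContinuousLinearMap.apply ℝ ℝ v).hasFDerivAt.comp (x, s) (hB (x, s) hs)
  refine fderiv_coneCutoff_mul_gradSq_le (hB (x, s) hs) hsymm hκ ?_ S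
  have heq := hw.equation x s hs
  have hWt : ∀ r, 0 < r → deriv (w x) r = A (x, r) (0, 1) := fun r hr =>
    (hWd (x, r) hr).slice_right.deriv
  have h1 : ∀ i : Fin n, pd i (fun y => w y s) =
      fun y => A (y, s) (EuclideanSpace.single i 1, 0) := fun i => funext fun y => by
    rw [pd, (hWd (y, s) hs).slice_left.fderiv]
    rfl
  have h2 : ∀ i : Fin n, pd i (fun y => A (y, s) (EuclideanSpace.single i 1, 0)) x =
      fderiv ℝ A (x, s) (EuclideanSpace.single i 1, 0) (EuclideanSpace.single i 1, 0) :=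
    fun i => by
    rw [pd, (hAv (EuclideanSpace.single i 1, 0)).slice_left.fderiv]
    rfl
  have h3 : deriv (deriv (w x)) s = fderiv ℝ A (x, s) (0, 1) (0, 1) := by
    have h4 : deriv (w x) =ᶠ[nhds s] fun s => A (x, s) (0, 1) := by
      filter_upwards [Ioi_mem_nhds hs] with r hr using hWt r hr
    rw [h4.deriv_eq, (hAv (0, 1)).slice_right.deriv]
    rfl
  rw [laplacian_eq_sum (hw.contDiffAt_left x hs), h3, hWt s hs, smul_eq_mul] at heq
  simp_rw [h1, h2] at heq
  exact heq

/-- At t = 0 the spatial derivatives vanish with the initial value and the time derivative by the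
second initial condition. Regularity there is only one-sided, whence the derivative within the
half-space. -/
theorem gradSq_fderivWithin_eq_zero {f : EuclideanSpace ℝ (Fin n) → ℝ}
    {w : EuclideanSpace ℝ (Fin n) → ℝ → ℝ} (hw : IsEPDSolution α f w) (hf : ∀ x, f x = 0)
    (x : EuclideanSpace ℝ (Fin n)) :
    gradSq (fderivWithin ℝ (fun p : EuclideanSpace ℝ (Fin n) × ℝ => w p.1 p.2)
      (univ ×ˢ Ici 0)) (x, 0) = 0 := by
  have hd : HasFDerivWithinAt (fun p : EuclideanSpace ℝ (Fin n) × ℝ => w p.1 p.2) _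
      (univ ×ˢ Ici 0) (x, 0) :=
    ((hw.contDiffOn_one.differentiableOn one_ne_zero) (x, 0)
      ⟨mem_univ x, self_mem_Ici⟩).hasFDerivWithinAt
  set L := fderivWithin ℝ (fun p : EuclideanSpace ℝ (Fin n) × ℝ => w p.1 p.2)
    (univ ×ˢ Ici 0) (x, 0) with hL
  have h1 : HasDerivWithinAt (w x) (L (0, 1)) (Ici 0) 0 :=
    hd.comp_hasDerivWithinAt (f := fun s => (x, s)) (0 : ℝ)
      ((hasDerivWithinAt_const (0 : ℝ) (Ici 0) x).prodMk
      (hasDerivWithinAt_id (0 : ℝ) (Ici 0))) fun s hs => ⟨mem_univ _, hs⟩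
  have h2 : L (0, 1) = 0 :=
    (uniqueDiffOn_Ici (0 : ℝ) 0 self_mem_Ici).eq_deriv _ h1 (hw.initial_deriv x)
  have h3 : HasFDerivWithinAt (fun y => w y 0)
      (L.comp (ContinuousLinearMap.inl ℝ (EuclideanSpace ℝ (Fin n)) ℝ)) univ x :=
    HasFDerivWithinAt.comp (g := fun p : EuclideanSpace ℝ (Fin n) × ℝ => w p.1 p.2)
      (f := fun y => (y, (0 : ℝ))) x hd
      (hasFDerivAt_prodMk_left (𝕜 := ℝ) x (0 : ℝ)).hasFDerivWithinAt
      (show MapsTo (fun y => (y, (0 : ℝ))) univ (univ ×ˢ Ici 0) from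
        fun y _ => ⟨mem_univ y, self_mem_Ici⟩)
  rw [hasFDerivWithinAt_univ] at h3
  have h4 : (fun y => w y 0) = fun _ => (0 : ℝ) := funext fun y => by rw [hw.initial, hf]
  rw [h4] at h3
  have h5 := h3.unique (hasFDerivAt_const (0 : ℝ) x)
  have h6 : ∀ v, L (v, 0) = 0 := fun v => congrArg (fun L => L v) h5
  rw [gradSq, ← hL, h2]
  simp [h6]

/-- The energy is nonnegative, does not increase and starts at zero. Hence the time derivative
vanishes for t > 0, and the solution keeps its initial value 0. -/
theorem eq_zero_of_real {f : EuclideanSpace ℝ (Fin n) → ℝ} {w : EuclideanSpace ℝ (Fin n) → ℝ → ℝ}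
    (hw : IsEPDSolution α f w)
    (hf : ∀ x, f x = 0) (hα : (1 - (n : ℝ)) / 2 ≤ α) (x : EuclideanSpace ℝ (Fin n)) {t : ℝ}
    (ht : 0 ≤ t) : w x t = 0 := by
  have hΩ : IsOpen ((univ : Set (EuclideanSpace ℝ (Fin n))) ×ˢ Ioi (0 : ℝ)) :=
    isOpen_univ.prod isOpen_Ioi
  have hU : UniqueDiffOn ℝ ((univ : Set (EuclideanSpace ℝ (Fin n))) ×ˢ Ici (0 : ℝ)) :=
    uniqueDiffOn_univ.prod (uniqueDiffOn_Ici 0)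
  have h0 := hw.gradSq_fderivWithin_eq_zero hf
  have hA := hw.contDiffOn_one.continuousOn_fderivWithin hU le_rfl
  have hAf : ∀ p ∈ (univ : Set (EuclideanSpace ℝ (Fin n))) ×ˢ Ioi (0 : ℝ),
      fderivWithin ℝ (fun p : EuclideanSpace ℝ (Fin n) × ℝ => w p.1 p.2) (univ ×ˢ Ici 0) p =
      fderiv ℝ (fun p : EuclideanSpace ℝ (Fin n) × ℝ => w p.1 p.2) p :=
    fun p hp => fderivWithin_of_mem_nhds (Filter.mem_of_superset (hΩ.mem_nhds hp)
      (prod_mono Subset.rfl Ioi_subset_Ici_self))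
  have hA1 := (hw.contDiffOn_two.fderiv_of_isOpen (m := 1) hΩ (by norm_num)).congr hAf
  have hWd : ∀ p : EuclideanSpace ℝ (Fin n) × ℝ, 0 < p.2 →
      HasFDerivAt (fun p : EuclideanSpace ℝ (Fin n) × ℝ => w p.1 p.2)
      (fderivWithin ℝ (fun p : EuclideanSpace ℝ (Fin n) × ℝ => w p.1 p.2) (univ ×ˢ Ici 0) p) p :=
    fun p hp => by
    have hp' : p ∈ (univ : Set (EuclideanSpace ℝ (Fin n))) ×ˢ Ioi (0 : ℝ) := ⟨mem_univ _, hp⟩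
    rw [hAf p hp']
    exact ((hw.contDiffOn_two.differentiableOn two_ne_zero).differentiableAt
      (hΩ.mem_nhds hp')).hasFDerivAt
  generalize fderivWithin ℝ (fun p : EuclideanSpace ℝ (Fin n) × ℝ => w p.1 p.2)
    (univ ×ˢ Ici 0) = A at h0 hA hA1 hWd
  have hB : ∀ p : EuclideanSpace ℝ (Fin n) × ℝ, 0 < p.2 → HasFDerivAt A (fderiv ℝ A p) p :=
    fun p hp => ((hA1.differentiableOn one_ne_zero).differentiableAt
      (hΩ.mem_nhds (show p ∈ univ ×ˢ Ioi (0 : ℝ) from ⟨mem_univ _, hp⟩))).hasFDerivAt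
  have hder : ∀ s, 0 < s → HasDerivAt (w x) 0 s := fun s hs =>
    (hWd (x, s) hs).slice_right.congr_deriv
      (apply_eq_zero_of_fderiv_coneCutoff_le hA hA1 (hw.fderiv_coneCutoff_le hα hWd hB) h0 x hs)
  have hwc : ContinuousOn (w x) (Icc 0 t) :=
    hw.contDiffOn_one.continuousOn.comp (f := fun s => (x, s)) (by fun_prop)
      fun s hs => ⟨mem_univ x, hs.1⟩
  rw [constant_of_has_deriv_right_zero hwc (fun s hs => ?_) t ⟨ht, le_rfl⟩, hw.initial, hf]
  rcases hs.1.eq_or_lt with rfl | h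
  · exact hw.initial_deriv x
  · exact (hder s h).hasDerivWithinAt

/-- Uniqueness for the Cauchy problem. -/
theorem unique (hu : IsEPDSolution α f u) (hv : IsEPDSolution α f v)
    (hα : (1 - (n : ℝ)) / 2 ≤ α) (x : EuclideanSpace ℝ (Fin n)) {t : ℝ} (ht : 0 ≤ t) :
    u x t = v x t := by
  rw [SeparatingDual.eq_iff_forall_dual_eq (R := ℝ)]
  intro ℓ
  have := ((hu.sub hv).clm_comp ℓ).eq_zero_of_real (fun x => by simp) hα x ht
  simpa [sub_eq_zero] using this

end IsEPDSolution

end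

/-! ### Reduction to spherical means and the constants. -/

/-- The Erdélyi–Kober operator maps a solution of the Cauchy problem to the spherical means of its
initial value. -/
theorem IsEPDSolution.ekOp_eq_smul_sphMean {F : Type*} [NormedAddCommGroup F] [NormedSpace ℝ F]
    [CompleteSpace F] {n : ℕ} (hn : 1 ≤ n) {α : ℝ} (hα : (1 - (n : ℝ)) / 2 ≤ α)
    {f : EuclideanSpace ℝ (Fin n) → F} (hf : ContDiff ℝ ∞ f) (hfs : HasCompactSupport f)
    {u : EuclideanSpace ℝ (Fin n) → ℝ → F} (hu : IsEPDSolution α f u)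
    (x : EuclideanSpace ℝ (Fin n)) {t : ℝ} (ht : 0 < t) :
    ekOp ((n : ℝ) / 2 - 1 + α) (-α) (u x) t =
      (Gamma (α + (n : ℝ) / 2) / Gamma ((n : ℝ) / 2)) • sphMean f x t := by
  -- After k descents all parameters that occur are at least α + k > 0, where beta averages are
  -- defined.
  obtain ⟨k, hk⟩ := exists_nat_gt (-α)
  have hα0 : 0 < α + k := by linarith
  have h2α : 0 < 2 * α + n := by linarith
  have hp : (0 : ℝ) < n / 2 := by positivity
  rw [ekOp_congr ht fun s hs => hu.unique (isEPDSolution_epd hn hα0 h2α hf hfs) hα x hs.le]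
  have e : (n : ℝ) / 2 - 1 + 1 = n / 2 := by ring
  have h := ekOp_eq_of_betaMean_eq (η := (n : ℝ) / 2 - 1) (α := α) (u := epd k α f x)
    (g := sphMean f x) (by linarith) (by linarith)
    ((contDiff_epd hn hα0 hf).continuous.comp (by fun_prop : Continuous fun t : ℝ => (x, t)))
    (contDiff_sphMean_right hf x).continuous (fun M hM hαM t ht => ?_) ht
  · rw [h, e, add_comm α]
  · obtain ⟨M, rfl⟩ : ∃ M', M = M' + 1 := ⟨M - 1, by omega⟩
    push_cast at hαM ⊢
    -- The integrated solution has the positive parameter α + M + 1. There the continued solution is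
    -- a genuine beta average of spherical means.
    rw [e, betaMean_epd hn hα0 h2α hf hfs x M ht, epd_eq_epdBase hn k hαM hf hfs x ht.le, epdBase]

theorem theorem4p1 {𝕜 : Type*} [RCLike 𝕜] (n : ℕ) (hn : 2 ≤ n) (R : ℝ) (hR : 0 < R)
    (α : ℝ) (hα : (1 - (n : ℝ)) / 2 ≤ α)
    (f : EuclideanSpace ℝ (Fin n) → 𝕜) (hf : ContDiff ℝ ∞ f)
    (hsupp : tsupport f ⊆ ball (0 : EuclideanSpace ℝ (Fin n)) R)
    (u : EuclideanSpace ℝ (Fin n) → ℝ → 𝕜) (hu : IsEPDSolution α f u)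
    (η : ℝ) (hη : η = (n : ℝ) / 2 - 1) :
    -- the inverted trace is smooth, so that `D` may be applied to it any number of times
    (∀ ξ ∈ sphere (0 : EuclideanSpace ℝ (Fin n)) R,
      ContDiffOn ℝ ∞ (ekOp (η + α) (-α) (u ξ)) (Ioi (0 : ℝ))) ∧
    -- odd dimensions
    (Odd n →
      (∀ x ∈ ball (0 : EuclideanSpace ℝ (Fin n)) R,
        Integrable (fun ξ =>
          (opD^[n - 3] fun t : ℝ => t ^ (n - 2) • ekOp (η + α) (-α) (u ξ) t) ‖x - ξ‖)
          (sphereMeasure n R)) ∧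
      ContDiffOn ℝ 2 (fun x => ∫ ξ,
          (opD^[n - 3] fun t : ℝ => t ^ (n - 2) • ekOp (η + α) (-α) (u ξ) t) ‖x - ξ‖
          ∂(sphereMeasure n R)) (ball (0 : EuclideanSpace ℝ (Fin n)) R) ∧
      ∀ x ∈ ball (0 : EuclideanSpace ℝ (Fin n)) R,
        f x = ((-1 : ℝ) ^ ((n - 1) / 2) * π ^ (1 - (n : ℝ) / 2) /
            (4 * R * Real.Gamma (α + (n : ℝ) / 2))) •
          Laplacian.laplacian (fun x => ∫ ξ,
            (opD^[n - 3] fun t : ℝ => t ^ (n - 2) • ekOp (η + α) (-α) (u ξ) t) ‖x - ξ‖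
            ∂(sphereMeasure n R)) x) ∧
    -- even dimensions, including `n = 2`
    (Even n →
      (∀ x ∈ ball (0 : EuclideanSpace ℝ (Fin n)) R,
        ∀ ξ ∈ sphere (0 : EuclideanSpace ℝ (Fin n)) R,
          IntervalIntegrable (fun t : ℝ => (t * Real.log |t ^ 2 - ‖x - ξ‖ ^ 2|) •
            (opD^[n - 2] fun s : ℝ => s ^ (n - 2) • ekOp (η + α) (-α) (u ξ) s) t)
            volume 0 (2 * R)) ∧
      (∀ x ∈ ball (0 : EuclideanSpace ℝ (Fin n)) R,
        Integrable (fun ξ => ∫ t in (0 : ℝ)..(2 * R),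
          (t * Real.log |t ^ 2 - ‖x - ξ‖ ^ 2|) •
            (opD^[n - 2] fun s : ℝ => s ^ (n - 2) • ekOp (η + α) (-α) (u ξ) s) t)
          (sphereMeasure n R)) ∧
      ContDiffOn ℝ 2 (fun x => ∫ ξ, (∫ t in (0 : ℝ)..(2 * R),
          (t * Real.log |t ^ 2 - ‖x - ξ‖ ^ 2|) •
            (opD^[n - 2] fun s : ℝ => s ^ (n - 2) • ekOp (η + α) (-α) (u ξ) s) t)
          ∂(sphereMeasure n R)) (ball (0 : EuclideanSpace ℝ (Fin n)) R) ∧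
      ∀ x ∈ ball (0 : EuclideanSpace ℝ (Fin n)) R,
        f x = ((-1 : ℝ) ^ (n / 2 - 1) * π ^ (-((n : ℝ) / 2)) /
            (2 * R * Real.Gamma (α + (n : ℝ) / 2))) •
          Laplacian.laplacian (fun x => ∫ ξ, (∫ t in (0 : ℝ)..(2 * R),
            (t * Real.log |t ^ 2 - ‖x - ξ‖ ^ 2|) •
              (opD^[n - 2] fun s : ℝ => s ^ (n - 2) • ekOp (η + α) (-α) (u ξ) s) t)
            ∂(sphereMeasure n R)) x) := by
  subst hη
  have h2α : (0 : ℝ) < 2 * α + n := by linarith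
  -- From here on u enters only through this identity, which also gives the smoothness of the
  -- inverted trace.
  have hg : ∀ ξ, ∀ t, 0 < t → ekOp ((n : ℝ) / 2 - 1 + α) (-α) (u ξ) t =
      (Gamma (α + (n : ℝ) / 2) / Gamma ((n : ℝ) / 2)) • sphMean f ξ t := fun ξ t ht =>
    hu.ekOp_eq_smul_sphMean (by omega) hα hf
      (HasCompactSupport.of_support_subset_isCompact (isCompact_closedBall 0 R)
        ((subset_tsupport f).trans (hsupp.trans ball_subset_closedBall))) ξ ht
  refine ⟨fun ξ _ => ((contDiff_sphMean_right hf ξ).const_smul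
    (Gamma (α + (n : ℝ) / 2) / Gamma ((n : ℝ) / 2))).contDiffOn.congr fun t ht => hg ξ t ht, ?_, ?_⟩
  all_goals
    obtain ⟨m, rfl⟩ : ∃ m, n = m + 1 := ⟨n - 1, by omega⟩
    intro hpar
    have hm : 1 ≤ m := by omega
    have hm0 : (0 : ℝ) < (m : ℝ) / 2 := by positivity
    have hσ := toSphere_real_univ hm
    have hconst := two_pow_mul_factorial_mul_toSphere hm
    have hΓ1 := (Gamma_pos_of_pos hm0).ne'
    have hΓ2 := (Gamma_pos_of_pos (show (0 : ℝ) < ((m + 1 : ℕ) : ℝ) / 2 by positivity)).ne'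
    have hΓ3 := (Gamma_pos_of_pos (show (0 : ℝ) < α + ((m + 1 : ℕ) : ℝ) / 2 by linarith)).ne'
    have hR0 := hR.ne'
    have hpi : 0 < π := pi_pos
  · obtain ⟨j, hj⟩ : ∃ j, m - 1 = 2 * j + 1 := by
      obtain ⟨i, hi⟩ := hpar
      exact ⟨i - 1, by omega⟩
    obtain ⟨h1, h2, h3⟩ := sphMean_inversion_odd hj hR hf hsupp fun ξ _ => hg ξ
    refine ⟨h1, h2.of_le (by norm_cast), fun x hx => ?_⟩
    rw [h3 x hx, smul_smul, hσ]
    have e1 : (m + 1 - 1) / 2 = j + 1 := by omega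
    -- The powers of π in the constant and in the area of the unit sphere of ℝᵐ combine to the √π of
    -- the duplication formula.
    have e2 : π ^ (1 - ((m + 1 : ℕ) : ℝ) / 2) * π ^ ((m : ℝ) / 2) = √π := by
      rw [← rpow_add hpi, sqrt_eq_rpow]
      congr 1
      push_cast
      ring
    have e3 : (-1 : ℝ) ^ (j + 1) * (-1) ^ (j + 1) = 1 := by rw [← mul_pow]; simp
    rw [e1]
    symm
    -- It remains to see that the constants multiply to 1; the sign occurs twice and enters only
    -- through its square.
    convert one_smul ℝ (f x) using 2
    refine Eq.trans ?_ hconst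
    rw [← e2]
    generalize (-1 : ℝ) ^ (j + 1) = ε at e3 ⊢
    field_simp
    linear_combination 4 * e3
  · obtain ⟨j, hj⟩ : ∃ j, m - 1 = 2 * j := by
      obtain ⟨i, hi⟩ := hpar
      exact ⟨i - 1, by omega⟩
    obtain ⟨h1, h2, h3, h4⟩ := sphMean_inversion_even hm hj hR hf hsupp fun ξ _ => hg ξ
    refine ⟨h1, h2, h3.of_le (by norm_cast), fun x hx => ?_⟩
    rw [h4 x hx, smul_smul, hσ]
    have e1 : (m + 1) / 2 - 1 = j := by omega
    -- The additional factor π comes from the logarithmic kernel.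
    have e2 : π ^ (-(((m + 1 : ℕ) : ℝ) / 2)) * π * π ^ ((m : ℝ) / 2) = √π := by
      rw [← rpow_add_one hpi.ne', ← rpow_add hpi, sqrt_eq_rpow]
      congr 1
      push_cast
      ring
    have e3 : (-1 : ℝ) ^ j * (-1) ^ j = 1 := by rw [← mul_pow]; simp
    rw [e1]
    symm
    convert one_smul ℝ (f x) using 2
    refine Eq.trans ?_ hconst
    rw [← e2]
    generalize (-1 : ℝ) ^ j = ε at e3 ⊢
    field_simp
    linear_combination e3
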